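/- Let $\mathbb T=\mathbb R/2\pi\mathbb Z$, $\widehat f(k)=\frac1{2\pi}\int_0^{2\pi}f(x)e^{-ikx}\,dx$, $\langle k\rangle=(1+k^2)^{1/2}$ and $\|f\|_{H^r}^2=\sum_{k\in\mathbb Z}\langle k\rangle^{2r}|\widehat f(k)|^2$. Let $(-\Delta)^\alpha$ and $e^{it(-\Delta)^\alpha}$ be the Fourier multipliers with symbols $|k|^{2\alpha}$ and $e^{it|k|^{2\alpha}}$. Fix $\frac12<\alpha\le1$, $s>\frac12$ and $a\le 2\alpha-1$. For a sign $\sigma\in\{1,-1\}$ and $u_0\in H^s(\mathbb T)$ let $u\in C^0_t(I;H^s(\mathbb T))$ be the solution of $$iu_t+(-\Delta)^\alpha u=\sigma|u|^2u,\qquad u(0)=u_0,$$ on its maximal (open) interval of existence $I\ni0$, and put $P=\frac1\pi\int_0^{2\pi}|u_0(x)|^2\,dx$. (i) The function $t\mapsto u(t)-e^{it(-\Delta)^\alpha-i\sigma Pt}u_0$ belongs to $C^0_t(I;H^{s+a}(\mathbb T))$. For every $\varepsilon>0$ with $\frac12+\varepsilon\le s$ there is a constant $C>0$, depending only on $\alpha,s,a,\varepsilon$,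 such that, for all $\sigma$, all $u_0\in H^s(\mathbb T)$ and all $t\in I$, $$\begin{aligned}\big\|u(t)-e^{it(-\Delta)^\alpha-i\sigma Pt}u_0\big\|_{H^{s+a}}\le C\Big(&\|u_0\|_{H^s}\big(1+\|u_0\|_{H^{\frac12+\varepsilon}}^2\big)+\|u(t)\|_{H^s}\|u(t)\|_{H^{\frac12+\varepsilon}}^2\\&+\Big|\int_0^t\|u(t')\|_{H^s}\big(\|u(t')\|_{H^{\frac12+\varepsilon}}^2+\|u(t')\|_{H^{\frac12+\varepsilon}}^4\big)\,dt'\Big|\Big).\end{aligned}$$ (ii) If moreover $s\ge\alpha$, then $I=\mathbb R$, and for every $M$ there is a constant $C>0$, depending only on $\alpha,s,a,M$, such that, for all $\sigma$, all $u_0\in H^s(\mathbb T)$ with $\|u_0\|_{H^\alpha}\le M$ and all $t\in\mathbb R$, $$\big\|u(t)-e^{it(-\Delta)^\alpha-i\sigma Pt}u_0\big\|_{H^{s+a}}\le C\Big(\|u_0\|_{H^s}+\|u(t)\|_{H^s}+\Big|\int_0^t\|u(t')\|_{H^s}\,dt'\Big|\Big).$$ -/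

import Mathlib

noncomputable section

open MeasureTheory AddCircle Filter Topology

namespace FNLS

instance instFactTwoPiPos : Fact (0 < 2 * Real.pi) := ⟨Real.two_pi_pos⟩

/-- The torus `𝕋 = ℝ / 2πℤ`. -/
abbrev Torus : Type := AddCircle (2 * Real.pi)

/-- `L²(𝕋)`. The reference measure is the normalized one, `dx / 2π`. -/
abbrev L2 : Type := Lp ℂ 2 (haarAddCircle : Measure Torus)

/-- The Fourier coefficient `f̂(k) = (1/2π) ∫₀^{2π} f(x) e^{-ikx} dx`. -/
def coeff (f : L2) (k : ℤ) : ℂ := fourierCoeff (f : Torus → ℂ) k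

/-- The bracket `⟨k⟩ = (1 + k²)^{1/2}`. -/
def bracket (k : ℤ) : ℝ := Real.sqrt (1 + (k : ℝ) ^ 2)

/-- `f ∈ H^s(𝕋)`. -/
def MemSobolev (s : ℝ) (f : L2) : Prop :=
  Summable fun k : ℤ => bracket k ^ (2 * s) * ‖coeff f k‖ ^ 2

/-- The norm of `H^s(𝕋)`; it is meaningful for `f` with `MemSobolev s f`. -/
def sobolevNorm (s : ℝ) (f : L2) : ℝ :=
  Real.sqrt (∑' k : ℤ, bracket k ^ (2 * s) * ‖coeff f k‖ ^ 2)

/-- `u ∈ C⁰(I; H^s(𝕋))`. -/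
def ContinuousInSobolev (s : ℝ) (I : Set ℝ) (u : ℝ → L2) : Prop :=
  (∀ t ∈ I, MemSobolev s (u t)) ∧
    ∀ t₀ ∈ I, Tendsto (fun t => sobolevNorm s (u t - u t₀)) (𝓝[I] t₀) (𝓝 0)

/-- The symbol `|k|^{2α}` of `(-Δ)^α`. -/
def symbol (α : ℝ) (k : ℤ) : ℝ := |(k : ℝ)| ^ (2 * α)

theorem freeFlow_memℓp (α t : ℝ) (f : L2) :
    Memℓp (fun k : ℤ => Complex.exp (Complex.I * (t * symbol α k : ℝ)) *
      fourierBasis.repr f k) 2 := by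
  rw [← memℓp_norm_iff]
  have h := memℓp_norm_iff.2 (lp.memℓp (fourierBasis.repr f))
  refine (funext fun k => ?_ : (fun k : ℤ => ‖Complex.exp (Complex.I * (t * symbol α k : ℝ)) *
      fourierBasis.repr f k‖) = fun k => ‖fourierBasis.repr f k‖) ▸ h
  rw [norm_mul, mul_comm Complex.I, Complex.norm_exp_ofReal_mul_I, one_mul]

/-- The linear propagator `e^{it(-Δ)^α}` on `L²(𝕋)`: the Fourier multiplier `e^{it|k|^{2α}}`. -/
def freeFlow (α t : ℝ) (f : L2) : L2 :=
  fourierBasis.repr.symm ⟨_, freeFlow_memℓp α t f⟩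

theorem coeff_freeFlow (α t : ℝ) (f : L2) (k : ℤ) :
    coeff (freeFlow α t f) k =
      Complex.exp (Complex.I * (t * symbol α k : ℝ)) * coeff f k := by
  unfold coeff
  rw [← fourierBasis_repr, ← fourierBasis_repr, freeFlow, LinearIsometryEquiv.apply_symm_apply]

/-- `P = (1/π) ‖f‖²_{L²}`, the `L²` norm being taken with respect to `dx` (total mass `2π`). -/
def phase (f : L2) : ℝ := 1 / Real.pi * ∫ x : Torus, ‖f x‖ ^ 2

/-- `e^{it(-Δ)^α - iσPt} f` with `P = (1/π) ‖f‖²_{L²}`. -/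
def phasedFlow (σ α t : ℝ) (f : L2) : L2 :=
  Complex.exp (-Complex.I * (σ * phase f * t : ℝ)) • freeFlow α t f

/-- The Fourier coefficients of the cubic nonlinearity `|f|² f`. -/
def cubicCoeff (f : L2) (k : ℤ) : ℂ :=
  fourierCoeff (fun x : Torus => ((‖f x‖ ^ 2 : ℝ) : ℂ) * f x) k

/-- `u` is a solution in `C⁰(I; H^s(𝕋))`, on the open time interval `I ∋ 0`, of
`i u_t + (-Δ)^α u = σ |u|² u`, `u(0) = u₀`. The equation is tested against the exponentials
`e^{ikx}`. -/
structure IsSolution (σ α s : ℝ) (u₀ : L2) (I : Set ℝ) (u : ℝ → L2) : Prop where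
  isOpen : IsOpen I
  ordConnected : I.OrdConnected
  zero_mem : (0 : ℝ) ∈ I
  continuous : ContinuousInSobolev s I u
  initial : u 0 = u₀
  equation : ∀ t ∈ I, ∀ k : ℤ,
    DifferentiableAt ℝ (fun τ => coeff (u τ) k) t ∧
      Complex.I * deriv (fun τ => coeff (u τ) k) t + (symbol α k : ℂ) * coeff (u t) k =
        (σ : ℂ) * cubicCoeff (u t) k

/-- `I` is the maximal interval of existence and `u` the solution on it: `u` has no extension to
a solution on a larger interval. -/
structure IsMaximalSolution (σ α s : ℝ) (u₀ : L2) (I : Set ℝ) (u : ℝ → L2) : Prop where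
  isSolution : IsSolution σ α s u₀ I u
  maximal : ∀ (J : Set ℝ) (v : ℝ → L2), IsSolution σ α s u₀ J v → I ⊆ J →
    (∀ t ∈ I, v t = u t) → J = I

end FNLS

end

/-!
In the interaction picture `c t k = e^{-i (|k|^{2α} - σP) t} û(t, k)` the free evolution disappears,
and since mass is conserved the factor `e^{-iσPt}` removes exactly the resonant terms
`2 |û(j)|² û(k)` of the cubic sum. What is left is the diagonal `|û(k)|² û(k)`, which is smoother
than `u`, and the terms with frequencies `k`, `k - j`, `k - j - l`, `k - l` (`j, l ≠ 0`), which
oscillate in time with the frequency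
`Ω = |k|^{2α} - |k - j|^{2α} + |k - j - l|^{2α} - |k - l|^{2α}`.

Uniform convexity of `|x|^{2α}` on bounded intervals gives
`|Ω| ≥ c (|k| + |j| + |l|)^{2α - 2} |j l|`. Differentiation by parts in time divides the
oscillating terms by `Ω` and leaves a cubic boundary term and a quintic integral; in both the
division pays for a gain of `2α - 1` derivatives.

If `s ≥ α`, conservation of mass and energy bounds the `H^α` norm. As long as an `H^q` norm with
`1/2 < q ≤ s` stays bounded, the nonlinearity is linearly bounded in `H^s`; Gronwall's inequality
and Picard–Lindelöf then continue the solution past any finite endpoint.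
-/

noncomputable section

open MeasureTheory AddCircle Filter Topology
open scoped ENNReal ComplexConjugate

namespace FNLS

/-! ### Square-summable families and the trilinear Cauchy-Schwarz estimate -/

/-- The `ℓ²` norm of a family of extended nonnegative numbers. Working in `ℝ≥0∞` makes the
rearrangements of sums below free of summability conditions. -/
def l2Norm {ι : Type*} (a : ι → ℝ≥0∞) : ℝ≥0∞ := (∑' i, a i ^ 2) ^ (1 / 2 : ℝ)

theorem sq_inj {x y : ℝ≥0∞} : x ^ 2 = y ^ 2 ↔ x = y :=
  (ENNReal.pow_right_strictMono two_ne_zero).injective.eq_iff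

section l2Norm
variable {ι : Type*}

theorem l2Norm_sq (a : ι → ℝ≥0∞) : l2Norm a ^ 2 = ∑' i, a i ^ 2 := by
  rw [l2Norm, ← ENNReal.rpow_natCast, ← ENNReal.rpow_mul]; norm_num

theorem l2Norm_le_iff {a : ι → ℝ≥0∞} {b : ℝ≥0∞} : l2Norm a ≤ b ↔ ∑' i, a i ^ 2 ≤ b ^ 2 := by
  rw [← l2Norm_sq, ENNReal.pow_le_pow_left_iff two_ne_zero]

theorem l2Norm_mono {a b : ι → ℝ≥0∞} (h : ∀ i, a i ≤ b i) : l2Norm a ≤ l2Norm b := by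
  rw [l2Norm_le_iff, l2Norm_sq]
  exact ENNReal.tsum_le_tsum fun i => pow_le_pow_left' (h i) 2

theorem le_l2Norm (a : ι → ℝ≥0∞) (i : ι) : a i ≤ l2Norm a := by
  rw [← ENNReal.pow_le_pow_left_iff two_ne_zero, l2Norm_sq]
  exact ENNReal.le_tsum (f := fun i => a i ^ 2) i

theorem l2Norm_const_mul (c : ℝ≥0∞) (a : ι → ℝ≥0∞) : l2Norm (fun i => c * a i) = c * l2Norm a := by
  rw [← sq_inj]
  simp only [mul_pow, l2Norm_sq, ENNReal.tsum_mul_left]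

theorem l2Norm_add_le (a b : ι → ℝ≥0∞) : l2Norm (fun i => a i + b i) ≤ l2Norm a + l2Norm b := by
  let _ : MeasurableSpace ι := ⊤
  have h := ENNReal.lintegral_Lp_add_le (μ := Measure.count) (f := a) (g := b) (p := 2)
    (measurable_from_top.aemeasurable) (measurable_from_top.aemeasurable) (by norm_num)
  simp only [lintegral_count, Pi.add_apply, ENNReal.rpow_two] at h
  exact h

theorem tsum_mul_le_l2Norm (a b : ι → ℝ≥0∞) : ∑' i, a i * b i ≤ l2Norm a * l2Norm b := by
  let _ : MeasurableSpace ι := ⊤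
  have h := ENNReal.lintegral_mul_le_Lp_mul_Lq (μ := Measure.count) Real.HolderConjugate.two_two
    (f := a) (g := b) (measurable_from_top.aemeasurable) (measurable_from_top.aemeasurable)
  simp only [lintegral_count, Pi.mul_apply, ENNReal.rpow_two] at h
  exact h

theorem l2Norm_comp_equiv {κ : Type*} (e : κ ≃ ι) (a : ι → ℝ≥0∞) :
    l2Norm (fun i => a (e i)) = l2Norm a := by
  rw [l2Norm, l2Norm, e.tsum_eq (fun i => a i ^ 2)]

theorem l2Norm_prod_mul {κ : Type*} (a : ι → ℝ≥0∞) (b : κ → ℝ≥0∞) :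
    l2Norm (fun p : ι × κ => a p.1 * b p.2) = l2Norm a * l2Norm b := by
  rw [← sq_inj]
  simp only [mul_pow, l2Norm_sq]
  rw [ENNReal.tsum_prod (f := fun i j => a i ^ 2 * b j ^ 2)]
  simp only [ENNReal.tsum_mul_left, ENNReal.tsum_mul_right]

end l2Norm

/-- The bijection `(k, (j, l)) ↦ (k₁, (k₂, k₃))` with `k₁ = k - j`, `k₂ = k - j - l` and
`k₃ = k - l`, so that `k₁ - k₂ + k₃ = k`: it trades a frequency and its two increments for the three
interacting frequencies. -/
def freqEquiv : ℤ × (ℤ × ℤ) ≃ ℤ × (ℤ × ℤ) where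
  toFun x := (x.1 - x.2.1, (x.1 - x.2.1 - x.2.2, x.1 - x.2.2))
  invFun y := (y.1 - y.2.1 + y.2.2, (y.2.2 - y.2.1, y.1 - y.2.1))
  left_inv x := by ext <;> simp
  right_inv y := by ext <;> simp <;> ring

/-- The frequencies `(k₂, k₃)` as coordinates for the increments `(j, l)`, with `k` fixed. -/
def pairEquiv₂₃ (k : ℤ) : ℤ × ℤ ≃ ℤ × ℤ where
  toFun p := (k - p.1 - p.2, k - p.2)
  invFun y := (y.2 - y.1, k - y.2)
  left_inv p := by ext <;> simp
  right_inv y := by ext <;> simp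

/-- The frequencies `(k₁, k₃)` as coordinates for the increments `(j, l)`, with `k` fixed. -/
def pairEquiv₁₃ (k : ℤ) : ℤ × ℤ ≃ ℤ × ℤ where
  toFun p := (k - p.1, k - p.2)
  invFun y := (k - y.1, k - y.2)
  left_inv p := by ext <;> simp
  right_inv y := by ext <;> simp

/-- The frequencies `(k₁, k₂)` as coordinates for the increments `(j, l)`, with `k` fixed. -/
def pairEquiv₁₂ (k : ℤ) : ℤ × ℤ ≃ ℤ × ℤ where
  toFun p := (k - p.1, k - p.1 - p.2)
  invFun y := (k - y.1, y.1 - y.2)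
  left_inv p := by ext <;> simp
  right_inv y := by ext <;> simp

/-- The trilinear form `∑ K(k; j, l) a(k - j) b(k - j - l) c(k - l)` with kernel `K`, summed over
the pairs `p = (j, l)`. -/
def kernelForm (K : ℤ → ℤ × ℤ → ℝ≥0∞) (a b c : ℤ → ℝ≥0∞) (k : ℤ) : ℝ≥0∞ :=
  ∑' p : ℤ × ℤ, K k p * (a (k - p.1) * (b (k - p.1 - p.2) * c (k - p.2)))

theorem l2Norm_kernelForm_le {K : ℤ → ℤ × ℤ → ℝ≥0∞} {Z : ℝ≥0∞} (hK : ∀ k, l2Norm (K k) ≤ Z)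
    (a b c : ℤ → ℝ≥0∞) : l2Norm (kernelForm K a b c) ≤ Z * (l2Norm a * (l2Norm b * l2Norm c)) := by
  let abc (k : ℤ) (p : ℤ × ℤ) : ℝ≥0∞ := a (k - p.1) * (b (k - p.1 - p.2) * c (k - p.2))
  have hpointwise : ∀ k, kernelForm K a b c k ≤ Z * l2Norm (abc k) := fun k =>
    (tsum_mul_le_l2Norm _ _).trans (mul_le_mul_left (hK k) _)
  have hproduct : l2Norm (fun k => l2Norm (abc k)) = l2Norm a * (l2Norm b * l2Norm c) := by
    rw [← l2Norm_prod_mul, ← l2Norm_prod_mul, ← l2Norm_comp_equiv freqEquiv, ← sq_inj]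
    simp only [l2Norm_sq]
    rw [ENNReal.tsum_prod']
    rfl
  calc l2Norm (kernelForm K a b c) ≤ l2Norm fun k => Z * l2Norm (abc k) := l2Norm_mono hpointwise
    _ = Z * (l2Norm a * (l2Norm b * l2Norm c)) := by rw [l2Norm_const_mul, hproduct]

theorem one_le_bracket (k : ℤ) : 1 ≤ bracket k := by
  rw [bracket, Real.one_le_sqrt]; nlinarith [sq_nonneg (k : ℝ)]

theorem bracket_pos (k : ℤ) : 0 < bracket k := zero_lt_one.trans_le (one_le_bracket k)

theorem bracket_sq (k : ℤ) : bracket k ^ 2 = 1 + (k : ℝ) ^ 2 :=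
  Real.sq_sqrt (by positivity)

theorem abs_le_bracket (k : ℤ) : |(k : ℝ)| ≤ bracket k := by
  rw [bracket]; exact Real.abs_le_sqrt (by linarith)

theorem bracket_le_one_add_abs (k : ℤ) : bracket k ≤ 1 + |(k : ℝ)| := by
  rw [bracket, Real.sqrt_le_left (by positivity)]
  nlinarith [abs_nonneg (k : ℝ), sq_abs (k : ℝ)]

theorem bracket_le_add_abs_sub (k n : ℤ) : bracket k ≤ bracket n + |((k - n : ℤ) : ℝ)| := by
  have hpos := bracket_pos n
  have habs := abs_le_bracket n
  refine le_of_sq_le_sq ?_ (by positivity)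
  rw [add_sq, bracket_sq, bracket_sq, sq_abs]
  push_cast
  have : (n : ℝ) * (k - n) ≤ bracket n * |(k : ℝ) - n| := by
    refine (le_abs_self _).trans ?_
    rw [abs_mul]; gcongr
  nlinarith

theorem bracket_rpow_pos (k : ℤ) (r : ℝ) : 0 < bracket k ^ r :=
  Real.rpow_pos_of_pos (bracket_pos k) r

theorem bracket_rpow_le {r r' : ℝ} (h : r ≤ r') (k : ℤ) : bracket k ^ r ≤ bracket k ^ r' :=
  Real.rpow_le_rpow_of_exponent_le (one_le_bracket k) h

theorem summable_bracket_rpow {q : ℝ} (hq : 1 / 2 < q) :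
    Summable fun k : ℤ => bracket k ^ (-(2 * q)) := by
  have h : Summable fun k : ℤ => |(k : ℝ)| ^ (-(2 * q)) :=
    Real.summable_abs_int_rpow (by linarith)
  refine h.of_norm_bounded_eventually (eventually_cofinite.2 ?_)
  refine (Set.finite_singleton (0 : ℤ)).subset fun k hk => by_contra fun hk0 : k ≠ 0 => hk ?_
  rw [Real.norm_of_nonneg (bracket_rpow_pos k _).le]
  exact Real.rpow_le_rpow_of_nonpos (by positivity) (abs_le_bracket k) (by linarith)

/-- The weight `⟨k⟩^r` as an extended nonnegative number. -/
def eweight (r : ℝ) (k : ℤ) : ℝ≥0∞ := ENNReal.ofReal (bracket k ^ r)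

theorem eweight_mono {r r' : ℝ} (h : r ≤ r') (k : ℤ) : eweight r k ≤ eweight r' k :=
  ENNReal.ofReal_le_ofReal (bracket_rpow_le h k)

theorem eweight_mul (r r' : ℝ) (k : ℤ) : eweight r k * eweight r' k = eweight (r + r') k := by
  rw [eweight, eweight, eweight, ← ENNReal.ofReal_mul (bracket_rpow_pos k _).le,
    ← Real.rpow_add (bracket_pos k)]

theorem eweight_neg_mul (r : ℝ) (k : ℤ) : eweight (-r) k * eweight r k = 1 := by
  rw [eweight_mul, neg_add_cancel, eweight, Real.rpow_zero, ENNReal.ofReal_one]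

/-- The constant `(∑ ⟨k⟩^{-2q})^{1/2}`. -/
def bracketConst (q : ℝ) : ℝ≥0∞ := l2Norm (eweight (-q))

theorem bracketConst_lt_top {q : ℝ} (hq : 1 / 2 < q) : bracketConst q < ∞ := by
  have h : ∀ k : ℤ, eweight (-q) k ^ 2 = ENNReal.ofReal (bracket k ^ (-(2 * q))) := fun k => by
    rw [sq, eweight_mul, eweight]; ring_nf
  rw [bracketConst, l2Norm]
  simp only [h]
  exact ENNReal.rpow_lt_top_of_nonneg (by norm_num) (summable_bracket_rpow hq).tsum_ofReal_ne_top

/-! ### Weighted norms of coefficient sequences -/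

/-- The `H^r` norm of a sequence of Fourier coefficients; it is `∞` outside of `H^r`. -/
def wnorm (r : ℝ) (c : ℤ → ℂ) : ℝ≥0∞ := l2Norm fun k => eweight r k * ‖c k‖ₑ

theorem wnorm_mono_exp {r r' : ℝ} (h : r ≤ r') (c : ℤ → ℂ) : wnorm r c ≤ wnorm r' c :=
  l2Norm_mono fun k => mul_le_mul_left (eweight_mono h k) _

theorem wnorm_mono (r : ℝ) {c d : ℤ → ℂ} (h : ∀ k, ‖c k‖ ≤ ‖d k‖) : wnorm r c ≤ wnorm r d :=
  l2Norm_mono fun k => mul_le_mul_right (enorm_le_iff_norm_le.2 (h k)) _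

theorem wnorm_congr_norm (r : ℝ) {c d : ℤ → ℂ} (h : ∀ k, ‖c k‖ = ‖d k‖) :
    wnorm r c = wnorm r d :=
  le_antisymm (wnorm_mono r fun k => (h k).le) (wnorm_mono r fun k => (h k).ge)

theorem wnorm_add_le (r : ℝ) (c d : ℤ → ℂ) : wnorm r (c + d) ≤ wnorm r c + wnorm r d := by
  refine le_trans (l2Norm_mono fun k => ?_) (l2Norm_add_le _ _)
  rw [← mul_add]
  exact mul_le_mul_right (enorm_add_le _ _) _

theorem wnorm_neg (r : ℝ) (c : ℤ → ℂ) : wnorm r (-c) = wnorm r c :=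
  wnorm_congr_norm r fun k => by simp

theorem wnorm_sub_comm (r : ℝ) (c d : ℤ → ℂ) : wnorm r (c - d) = wnorm r (d - c) :=
  wnorm_congr_norm r fun _ => norm_sub_rev _ _

theorem wnorm_sub_le (r : ℝ) (c d : ℤ → ℂ) : wnorm r (c - d) ≤ wnorm r c + wnorm r d := by
  rw [sub_eq_add_neg, ← wnorm_neg r d]; exact wnorm_add_le r c (-d)

theorem wnorm_smul (r : ℝ) (z : ℂ) (c : ℤ → ℂ) : wnorm r (z • c) = ‖z‖ₑ * wnorm r c := by
  rw [wnorm, wnorm, ← l2Norm_const_mul]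
  congr 1; ext k
  rw [Pi.smul_apply, smul_eq_mul, enorm_mul]; ring

@[simp]
theorem wnorm_zero (r : ℝ) : wnorm r 0 = 0 := by
  simp [wnorm, l2Norm]

theorem wnorm_sub_lt_top {r : ℝ} {c d : ℤ → ℂ} (hc : wnorm r c < ∞) (hd : wnorm r d < ∞) :
    wnorm r (c - d) < ∞ :=
  (wnorm_sub_le r c d).trans_lt (ENNReal.add_lt_top.2 ⟨hc, hd⟩)

theorem enorm_le_wnorm (r : ℝ) (c : ℤ → ℂ) (k : ℤ) : ‖c k‖ₑ ≤ eweight (-r) k * wnorm r c := by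
  calc ‖c k‖ₑ = eweight (-r) k * (eweight r k * ‖c k‖ₑ) := by
        rw [← mul_assoc, eweight_neg_mul, one_mul]
    _ ≤ eweight (-r) k * wnorm r c :=
        mul_le_mul_right (le_l2Norm (fun k => eweight r k * ‖c k‖ₑ) k) _

/-! ### Trilinear Fourier multipliers -/

/-- The summand of index `p = (j, l)` of the trilinear multiplier `trilinear`. -/
def trilinearTerm (m : ℤ → ℤ × ℤ → ℂ) (f g h : ℤ → ℂ) (k : ℤ) (p : ℤ × ℤ) : ℂ :=
  m k p * (f (k - p.1) * (conj (g (k - p.1 - p.2)) * h (k - p.2)))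

/-- The trilinear multiplier `∑ m(k; j, l) f(k₁) conj (g (k₂)) h(k₃)` over the increments `(j, l)`,
where `k₁ = k - j`, `k₂ = k - j - l`, `k₃ = k - l`. -/
def trilinear (m : ℤ → ℤ × ℤ → ℂ) (f g h : ℤ → ℂ) (k : ℤ) : ℂ :=
  ∑' p, trilinearTerm m f g h k p

/-- The sum of the absolute values of the summands of `trilinear`. -/
def trilinearAbs (m : ℤ → ℤ × ℤ → ℂ) (f g h : ℤ → ℂ) (k : ℤ) : ℝ≥0∞ :=
  ∑' p, ‖trilinearTerm m f g h k p‖ₑ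

theorem enorm_trilinear_le (m : ℤ → ℤ × ℤ → ℂ) (f g h : ℤ → ℂ) (k : ℤ) :
    ‖trilinear m f g h k‖ₑ ≤ trilinearAbs m f g h k := enorm_tsum_le_tsum_enorm

/-- The pointwise bound on a multiplier under which `trilinear` maps into `H^r`, with one factor
measured in `H^s` and the others in `H^q`. Each of the first three terms on the right leaves two
factors free, whose decay makes the sum over `(j, l)` converge when `1/2 < q`; the last one gains
`⟨j⟩⁻¹⟨l⟩⁻¹`, which is itself square summable. -/
def Admissible (r s q A : ℝ) (m : ℤ → ℤ × ℤ → ℂ) : Prop :=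
  ∀ k p, ‖m k p‖ * bracket k ^ r ≤
    A * (bracket (k - p.1) ^ s + bracket (k - p.1 - p.2) ^ s + bracket (k - p.2) ^ s +
      bracket (k - p.1) ^ s * bracket (k - p.1 - p.2) ^ q * bracket (k - p.2) ^ q *
        (bracket p.1 ^ (-1 : ℝ) * bracket p.2 ^ (-1 : ℝ)))

/-- The symmetrized product of two `H^q` norms and one `H^s` norm. -/
def mixedNorm (s q : ℝ) (f g h : ℤ → ℂ) : ℝ≥0∞ :=
  wnorm s f * (wnorm q g * wnorm q h) + wnorm q f * (wnorm s g * wnorm q h) +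
    wnorm q f * (wnorm q g * wnorm s h)

theorem mixedNorm_le {s q : ℝ} (hqs : q ≤ s) (f g h : ℤ → ℂ) :
    mixedNorm s q f g h ≤ 3 * (wnorm s f * (wnorm s g * wnorm s h)) := by
  have hf := wnorm_mono_exp hqs f
  have hg := wnorm_mono_exp hqs g
  have hh := wnorm_mono_exp hqs h
  calc mixedNorm s q f g h
      ≤ wnorm s f * (wnorm s g * wnorm s h) + wnorm s f * (wnorm s g * wnorm s h) +
        wnorm s f * (wnorm s g * wnorm s h) := by rw [mixedNorm]; gcongr
    _ = 3 * (wnorm s f * (wnorm s g * wnorm s h)) := by ring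

theorem mixedNorm_self (s q : ℝ) (f : ℤ → ℂ) :
    mixedNorm s q f f f = 3 * (wnorm s f * wnorm q f ^ 2) := by
  rw [mixedNorm]; ring

/-- The constant of the trilinear estimate for admissible multipliers. -/
def trilinearConst (q A : ℝ) : ℝ≥0∞ :=
  ENNReal.ofReal A * (bracketConst q ^ 2 + bracketConst 1 ^ 2)

theorem trilinearConst_lt_top {q : ℝ} (hq : 1 / 2 < q) (A : ℝ) : trilinearConst q A < ∞ :=
  ENNReal.mul_lt_top ENNReal.ofReal_lt_top (ENNReal.add_lt_top.2
    ⟨ENNReal.pow_lt_top (bracketConst_lt_top hq),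
      ENNReal.pow_lt_top (bracketConst_lt_top (by norm_num))⟩)

theorem l2Norm_kernel₂₃ (q : ℝ) (k : ℤ) :
    l2Norm (fun p : ℤ × ℤ => eweight (-q) (k - p.1 - p.2) * eweight (-q) (k - p.2)) =
      bracketConst q ^ 2 :=
  (l2Norm_comp_equiv (pairEquiv₂₃ k) fun p : ℤ × ℤ => eweight (-q) p.1 * eweight (-q) p.2).trans
    ((l2Norm_prod_mul _ _).trans (sq _).symm)

theorem l2Norm_kernel₁₃ (q : ℝ) (k : ℤ) :
    l2Norm (fun p : ℤ × ℤ => eweight (-q) (k - p.1) * eweight (-q) (k - p.2)) =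
      bracketConst q ^ 2 :=
  (l2Norm_comp_equiv (pairEquiv₁₃ k) fun p : ℤ × ℤ => eweight (-q) p.1 * eweight (-q) p.2).trans
    ((l2Norm_prod_mul _ _).trans (sq _).symm)

theorem l2Norm_kernel₁₂ (q : ℝ) (k : ℤ) :
    l2Norm (fun p : ℤ × ℤ => eweight (-q) (k - p.1) * eweight (-q) (k - p.1 - p.2)) =
      bracketConst q ^ 2 :=
  (l2Norm_comp_equiv (pairEquiv₁₂ k) fun p : ℤ × ℤ => eweight (-q) p.1 * eweight (-q) p.2).trans
    ((l2Norm_prod_mul _ _).trans (sq _).symm)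

theorem l2Norm_kernel (q : ℝ) :
    l2Norm (fun p : ℤ × ℤ => eweight (-q) p.1 * eweight (-q) p.2) = bracketConst q ^ 2 :=
  (l2Norm_prod_mul _ _).trans (sq _).symm

namespace Admissible

variable {r s q A : ℝ} {m : ℤ → ℤ × ℤ → ℂ}

theorem nonneg (hm : Admissible r s q A m) : 0 ≤ A := by
  have h := (mul_nonneg (norm_nonneg _) (bracket_rpow_pos 0 r).le).trans (hm 0 0)
  refine nonneg_of_mul_nonneg_left h ?_
  have hpos := fun k => bracket_rpow_pos k s
  have hpos' := fun k => bracket_rpow_pos k q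
  have hpos'' := fun k => bracket_rpow_pos k (-1)
  simp only [Prod.fst_zero, Prod.snd_zero]
  exact add_pos (add_pos (add_pos (hpos _) (hpos _)) (hpos _))
    (mul_pos (mul_pos (mul_pos (hpos _) (hpos' _)) (hpos' _)) (mul_pos (hpos'' _) (hpos'' _)))

theorem enorm_mul_eweight_le (hm : Admissible r s q A m) (k : ℤ) (p : ℤ × ℤ) :
    ‖m k p‖ₑ * eweight r k ≤ ENNReal.ofReal A *
      (eweight s (k - p.1) + eweight s (k - p.1 - p.2) + eweight s (k - p.2) +
        eweight s (k - p.1) * eweight q (k - p.1 - p.2) * eweight q (k - p.2) *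
          (eweight (-1) p.1 * eweight (-1) p.2)) := by
  have h := ENNReal.ofReal_le_ofReal (hm k p)
  have hpos := fun (n : ℤ) (x : ℝ) => (bracket_rpow_pos n x).le
  have := hpos (k - p.1) s
  have := hpos (k - p.1 - p.2) s
  have := hpos (k - p.2) s
  have := hpos (k - p.1 - p.2) q
  have := hpos (k - p.2) q
  have := hpos p.1 (-1)
  have := hpos p.2 (-1)
  rw [ENNReal.ofReal_mul (norm_nonneg _), ofReal_norm, ENNReal.ofReal_mul hm.nonneg,
    ENNReal.ofReal_add (by positivity) (by positivity),
    ENNReal.ofReal_add (by positivity) (by positivity),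
    ENNReal.ofReal_add (by positivity) (by positivity),
    ENNReal.ofReal_mul (by positivity), ENNReal.ofReal_mul (by positivity),
    ENNReal.ofReal_mul (by positivity), ENNReal.ofReal_mul (by positivity)] at h
  exact h

theorem eweight_mul_trilinearAbs_le (hm : Admissible r s q A m) (f g h : ℤ → ℂ) (k : ℤ) :
    eweight r k * trilinearAbs m f g h k ≤ ENNReal.ofReal A *
      (kernelForm (fun k p => eweight (-q) (k - p.1 - p.2) * eweight (-q) (k - p.2))
          (fun n => eweight s n * ‖f n‖ₑ) (fun n => eweight q n * ‖g n‖ₑ)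
          (fun n => eweight q n * ‖h n‖ₑ) k +
        kernelForm (fun k p => eweight (-q) (k - p.1) * eweight (-q) (k - p.2))
          (fun n => eweight q n * ‖f n‖ₑ) (fun n => eweight s n * ‖g n‖ₑ)
          (fun n => eweight q n * ‖h n‖ₑ) k +
        kernelForm (fun k p => eweight (-q) (k - p.1) * eweight (-q) (k - p.1 - p.2))
          (fun n => eweight q n * ‖f n‖ₑ) (fun n => eweight q n * ‖g n‖ₑ)
          (fun n => eweight s n * ‖h n‖ₑ) k +
        kernelForm (fun _ p => eweight (-1) p.1 * eweight (-1) p.2)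
          (fun n => eweight s n * ‖f n‖ₑ) (fun n => eweight q n * ‖g n‖ₑ)
          (fun n => eweight q n * ‖h n‖ₑ) k) := by
  simp only [kernelForm, trilinearAbs]
  rw [← ENNReal.tsum_add, ← ENNReal.tsum_add, ← ENNReal.tsum_add, ← ENNReal.tsum_mul_left,
    ← ENNReal.tsum_mul_left]
  refine ENNReal.tsum_le_tsum fun p => ?_
  have enorm_eq (c : ℤ → ℂ) (n : ℤ) : ‖c n‖ₑ = eweight (-q) n * (eweight q n * ‖c n‖ₑ) := by
    rw [← mul_assoc, eweight_neg_mul, one_mul]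
  have hfactor : eweight r k * ‖trilinearTerm m f g h k p‖ₑ = (‖m k p‖ₑ * eweight r k) *
      (‖f (k - p.1)‖ₑ * (‖g (k - p.1 - p.2)‖ₑ * ‖h (k - p.2)‖ₑ)) := by
    rw [trilinearTerm, enorm_mul, enorm_mul, enorm_mul, RCLike.enorm_conj]; ring
  rw [hfactor]
  refine (mul_le_mul_left (hm.enorm_mul_eweight_le k p) _).trans (le_of_eq ?_)
  rw [mul_assoc, add_mul, add_mul, add_mul]
  refine congrArg _ (congrArg₂ _ (congrArg₂ _ (congrArg₂ _ ?_ ?_) ?_) ?_)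
  · conv_lhs => rw [enorm_eq g, enorm_eq h]
    ring
  · conv_lhs => rw [enorm_eq f, enorm_eq h]
    ring
  · conv_lhs => rw [enorm_eq f, enorm_eq g]
    ring
  · ring

theorem l2Norm_trilinearAbs_le (hm : Admissible r s q A m) (f g h : ℤ → ℂ) :
    l2Norm (fun k => eweight r k * trilinearAbs m f g h k) ≤
      trilinearConst q A * mixedNorm s q f g h := by
  refine (l2Norm_mono (hm.eweight_mul_trilinearAbs_le f g h)).trans ?_
  rw [l2Norm_const_mul, trilinearConst, mul_assoc]
  refine mul_le_mul_right ?_ _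
  calc _ ≤ bracketConst q ^ 2 * (wnorm s f * (wnorm q g * wnorm q h)) +
        bracketConst q ^ 2 * (wnorm q f * (wnorm s g * wnorm q h)) +
        bracketConst q ^ 2 * (wnorm q f * (wnorm q g * wnorm s h)) +
        bracketConst 1 ^ 2 * (wnorm s f * (wnorm q g * wnorm q h)) :=
      (l2Norm_add_le _ _).trans <| add_le_add ((l2Norm_add_le _ _).trans <|
        add_le_add ((l2Norm_add_le _ _).trans <|
          add_le_add (l2Norm_kernelForm_le (fun k => (l2Norm_kernel₂₃ q k).le) _ _ _)
            (l2Norm_kernelForm_le (fun k => (l2Norm_kernel₁₃ q k).le) _ _ _))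
          (l2Norm_kernelForm_le (fun k => (l2Norm_kernel₁₂ q k).le) _ _ _))
        (l2Norm_kernelForm_le (fun _ => (l2Norm_kernel 1).le) _ _ _)
    _ ≤ bracketConst q ^ 2 * mixedNorm s q f g h + bracketConst 1 ^ 2 * mixedNorm s q f g h := by
      rw [← mul_add, ← mul_add]
      refine add_le_add le_rfl (mul_le_mul_right ?_ _)
      rw [mixedNorm, add_assoc]
      exact le_self_add
    _ = _ := (add_mul _ _ _).symm

theorem wnorm_trilinear_le (hm : Admissible r s q A m) (f g h : ℤ → ℂ) :
    wnorm r (trilinear m f g h) ≤ trilinearConst q A * mixedNorm s q f g h :=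
  (l2Norm_mono fun k => mul_le_mul_right (enorm_trilinear_le m f g h k) _).trans
    (hm.l2Norm_trilinearAbs_le f g h)

theorem trilinearAbs_le (hm : Admissible r s q A m) (f g h : ℤ → ℂ) (k : ℤ) :
    trilinearAbs m f g h k ≤ eweight (-r) k * (trilinearConst q A * mixedNorm s q f g h) := by
  calc trilinearAbs m f g h k = eweight (-r) k * (eweight r k * trilinearAbs m f g h k) := by
        rw [← mul_assoc, eweight_neg_mul, one_mul]
    _ ≤ eweight (-r) k * (trilinearConst q A * mixedNorm s q f g h) :=
        mul_le_mul_right ((le_l2Norm (fun k => eweight r k * trilinearAbs m f g h k) k).trans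
          (hm.l2Norm_trilinearAbs_le f g h)) _

variable {f g h f' g' h' : ℤ → ℂ}

theorem summable_trilinearTerm (hm : Admissible r s q A m) (hq : 1 / 2 < q) (hqs : q ≤ s)
    (hf : wnorm s f < ∞) (hg : wnorm s g < ∞) (hh : wnorm s h < ∞) (k : ℤ) :
    Summable (trilinearTerm m f g h k) := by
  have hmixed : mixedNorm s q f g h < ∞ := (mixedNorm_le hqs f g h).trans_lt
    (ENNReal.mul_lt_top (by norm_num) (ENNReal.mul_lt_top hf (ENNReal.mul_lt_top hg hh)))
  have hAbs : trilinearAbs m f g h k < ∞ := (hm.trilinearAbs_le f g h k).trans_lt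
    (ENNReal.mul_lt_top ENNReal.ofReal_lt_top
      (ENNReal.mul_lt_top (trilinearConst_lt_top hq A) hmixed))
  exact .of_norm (tsum_enorm_ne_top_iff_summable_norm.1 hAbs.ne)

theorem trilinear_sub (hm : Admissible r s q A m) (hq : 1 / 2 < q) (hqs : q ≤ s)
    (hf : wnorm s f < ∞) (hg : wnorm s g < ∞) (hh : wnorm s h < ∞) (hf' : wnorm s f' < ∞)
    (hg' : wnorm s g' < ∞) (hh' : wnorm s h' < ∞) :
    trilinear m f g h - trilinear m f' g' h' =
      trilinear m (f - f') g h + trilinear m f' (g - g') h + trilinear m f' g' (h - h') := by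
  ext k
  have hS {a b c : ℤ → ℂ} (ha : wnorm s a < ∞) (hb : wnorm s b < ∞) (hc : wnorm s c < ∞) :=
    hm.summable_trilinearTerm hq hqs ha hb hc k
  have hS₁ := hS (wnorm_sub_lt_top hf hf') hg hh
  have hS₂ := hS hf' (wnorm_sub_lt_top hg hg') hh
  have hS₃ := hS hf' hg' (wnorm_sub_lt_top hh hh')
  simp only [Pi.sub_apply, Pi.add_apply, trilinear]
  rw [← (hS hf hg hh).tsum_sub (hS hf' hg' hh'), ← hS₁.tsum_add hS₂, ← (hS₁.add hS₂).tsum_add hS₃]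
  congr 1; ext p
  simp only [trilinearTerm, Pi.sub_apply, map_sub]
  ring

theorem wnorm_trilinear_sub_le (hm : Admissible r s q A m) (hq : 1 / 2 < q) (hqs : q ≤ s)
    (hf : wnorm s f < ∞) (hg : wnorm s g < ∞) (hh : wnorm s h < ∞) (hf' : wnorm s f' < ∞)
    (hg' : wnorm s g' < ∞) (hh' : wnorm s h' < ∞) :
    wnorm r (trilinear m f g h - trilinear m f' g' h') ≤ 3 * trilinearConst q A *
      (wnorm s (f - f') * (wnorm s g * wnorm s h) + wnorm s f' * (wnorm s (g - g') * wnorm s h) +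
        wnorm s f' * (wnorm s g' * wnorm s (h - h'))) := by
  rw [hm.trilinear_sub hq hqs hf hg hh hf' hg' hh']
  have hbound a b c : wnorm r (trilinear m a b c) ≤
      trilinearConst q A * (3 * (wnorm s a * (wnorm s b * wnorm s c))) :=
    (hm.wnorm_trilinear_le a b c).trans (mul_le_mul_right (mixedNorm_le hqs a b c) _)
  refine (wnorm_add_le _ _ _).trans <| (add_le_add ((wnorm_add_le _ _ _).trans
    (add_le_add (hbound _ _ _) (hbound _ _ _))) (hbound _ _ _)).trans (le_of_eq ?_)
  ring

end Admissible

/-! ### Lower bound for the resonance function -/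

theorem convexOn_comp_abs {R : ℝ} {h : ℝ → ℝ} (hconv : ConvexOn ℝ (Set.Icc 0 R) h)
    (hmono : MonotoneOn h (Set.Icc 0 R)) : ConvexOn ℝ (Set.Icc (-R) R) fun x => h |x| := by
  have habs : ∀ x ∈ Set.Icc (-R) R, |x| ∈ Set.Icc 0 R := fun x hx => ⟨abs_nonneg x, abs_le.2 hx⟩
  refine ⟨convex_Icc _ _, fun x hx y hy a b ha hb hab => ?_⟩
  have hcomb := convex_Icc (-R) R hx hy ha hb hab
  have hcomb' := convex_Icc 0 R (habs x hx) (habs y hy) ha hb hab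
  have htri : |a • x + b • y| ≤ a • |x| + b • |y| := by
    simpa only [smul_eq_mul, abs_mul, abs_of_nonneg ha, abs_of_nonneg hb] using
      abs_add_le (a * x) (b * y)
  exact (hmono (habs _ hcomb) hcomb' htri).trans (hconv.2 (habs x hx) (habs y hy) ha hb hab)

section RpowSubSq

variable {p c R : ℝ}

theorem hasDerivAt_rpow_sub_sq (hp : 1 ≤ p) (c y : ℝ) :
    HasDerivAt (fun y : ℝ => y ^ p - c / 2 * y ^ 2) (p * y ^ (p - 1) - c * y) y := by
  refine ((Real.hasDerivAt_rpow_const (Or.inr hp)).sub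
    (((hasDerivAt_id y).pow 2).const_mul (c / 2))).congr_deriv ?_
  simp only [id_eq, Nat.cast_ofNat]
  ring

theorem hasDerivAt_deriv_rpow_sub_sq (p c : ℝ) {y : ℝ} (hy : 0 < y) :
    HasDerivAt (fun y : ℝ => p * y ^ (p - 1) - c * y) (p * (p - 1) * y ^ (p - 2) - c) y := by
  refine (((Real.hasDerivAt_rpow_const (Or.inl hy.ne')).const_mul p).sub
    ((hasDerivAt_id y).const_mul c)).congr_deriv ?_
  rw [show p - 1 - 1 = p - 2 by ring]
  ring

theorem const_le_of_le_rpow (hp : 1 ≤ p) (hp2 : p ≤ 2) (hc : c ≤ p * (p - 1) * R ^ (p - 2))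
    {y : ℝ} (hy : 0 < y) (hyR : y ≤ R) : c ≤ p * (p - 1) * y ^ (p - 2) :=
  hc.trans <| mul_le_mul_of_nonneg_left (Real.rpow_le_rpow_of_nonpos hy hyR (by linarith))
    (mul_nonneg (by linarith) (by linarith))

theorem convexOn_rpow_sub_sq (hp : 1 ≤ p) (hp2 : p ≤ 2) (hc : c ≤ p * (p - 1) * R ^ (p - 2)) :
    ConvexOn ℝ (Set.Icc 0 R) fun y => y ^ p - c / 2 * y ^ 2 := by
  have hderiv := hasDerivAt_rpow_sub_sq hp c
  refine convexOn_of_hasDerivWithinAt2_nonneg (convex_Icc 0 R)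
    (fun y _ => (hderiv y).continuousAt.continuousWithinAt)
    (fun y _ => (hderiv y).hasDerivWithinAt)
    (f'' := fun y => p * (p - 1) * y ^ (p - 2) - c) ?_ ?_ <;>
    rw [interior_Icc] <;> intro y hy
  · exact (hasDerivAt_deriv_rpow_sub_sq p c hy.1).hasDerivWithinAt
  · exact sub_nonneg.2 (const_le_of_le_rpow hp hp2 hc hy.1 hy.2.le)

theorem monotoneOn_rpow_sub_sq (hp : 1 ≤ p) (hp2 : p ≤ 2) (hc : c ≤ p * (p - 1) * R ^ (p - 2)) :
    MonotoneOn (fun y => y ^ p - c / 2 * y ^ 2) (Set.Icc 0 R) := by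
  have hderiv := hasDerivAt_rpow_sub_sq hp c
  refine monotoneOn_of_hasDerivWithinAt_nonneg (convex_Icc 0 R)
    (fun y _ => (hderiv y).continuousAt.continuousWithinAt)
    (fun y _ => (hderiv y).hasDerivWithinAt) ?_
  rw [interior_Icc]
  intro y hy
  have hpow : y ^ (p - 1) = y ^ (p - 2) * y := by
    rw [← Real.rpow_add_one hy.1.ne']; congr 1; ring
  have hpos : 0 < y ^ (p - 2) := Real.rpow_pos_of_pos hy.1 _
  have hle : c ≤ p * y ^ (p - 2) := by
    nlinarith [const_le_of_le_rpow hp hp2 hc hy.1 hy.2.le,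
      mul_nonneg (mul_nonneg (by linarith : 0 ≤ p) (by linarith : 0 ≤ 2 - p)) hpos.le]
  rw [hpow]
  nlinarith [mul_le_mul_of_nonneg_right hle hy.1.le]

end RpowSubSq

theorem convexOn_abs_rpow_sub_sq {p : ℝ} (hp : 1 ≤ p) (hp2 : p ≤ 2) (R : ℝ) :
    ConvexOn ℝ (Set.Icc (-R) R) fun x => |x| ^ p - p * (p - 1) * R ^ (p - 2) / 2 * x ^ 2 := by
  simpa only [sq_abs] using
    convexOn_comp_abs (convexOn_rpow_sub_sq hp hp2 le_rfl) (monotoneOn_rpow_sub_sq hp hp2 le_rfl)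

theorem second_difference_nonneg {g : ℝ → ℝ} {S : Set ℝ} (hg : ConvexOn ℝ S g) {x j l : ℝ}
    (hj : 0 < j) (hl : 0 < l) (hx : x ∈ S) (hxjl : x - j - l ∈ S) :
    0 ≤ g x - g (x - j) + g (x - j - l) - g (x - l) := by
  have hjl : 0 < j + l := by linarith
  have hweight : l / (j + l) = 1 - j / (j + l) := by field_simp; ring
  have hconv₁ := hg.2 hx hxjl (div_nonneg hl.le hjl.le) (div_nonneg hj.le hjl.le) (by linarith)
  have hconv₂ := hg.2 hx hxjl (div_nonneg hj.le hjl.le) (div_nonneg hl.le hjl.le) (by linarith)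
  have hpoint₁ : (l / (j + l)) • x + (j / (j + l)) • (x - j - l) = x - j := by
    simp only [smul_eq_mul]; field_simp; ring
  have hpoint₂ : (j / (j + l)) • x + (l / (j + l)) • (x - j - l) = x - l := by
    simp only [smul_eq_mul]; field_simp; ring
  rw [hpoint₁, hweight, smul_eq_mul, smul_eq_mul] at hconv₁
  rw [hpoint₂, hweight, smul_eq_mul, smul_eq_mul] at hconv₂
  linarith

theorem second_difference_abs_rpow_ge {p R : ℝ} (hp : 1 ≤ p) (hp2 : p ≤ 2) {x j l : ℝ}
    (hj : 0 < j) (hl : 0 < l) (hx : x ∈ Set.Icc (-R) R) (hxjl : x - j - l ∈ Set.Icc (-R) R) :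
    p * (p - 1) * R ^ (p - 2) * |j * l| ≤
      |(|x| ^ p - |x - j| ^ p + |x - j - l| ^ p - |x - l| ^ p)| := by
  have := second_difference_nonneg (convexOn_abs_rpow_sub_sq hp hp2 R) hj hl hx hxjl
  refine le_trans ?_ (le_abs_self _)
  rw [abs_of_pos (mul_pos hj hl)]
  linarith

theorem abs_second_difference_ge {p R : ℝ} (hp : 1 ≤ p) (hp2 : p ≤ 2) {x j l : ℝ}
    (hx : x ∈ Set.Icc (-R) R) (hxj : x - j ∈ Set.Icc (-R) R) (hxl : x - l ∈ Set.Icc (-R) R)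
    (hxjl : x - j - l ∈ Set.Icc (-R) R) (hj : j ≠ 0) (hl : l ≠ 0) :
    p * (p - 1) * R ^ (p - 2) * |j * l| ≤
      |(|x| ^ p - |x - j| ^ p + |x - j - l| ^ p - |x - l| ^ p)| := by
  rcases lt_or_gt_of_ne hj with hj | hj <;> rcases lt_or_gt_of_ne hl with hl | hl
  · have := second_difference_abs_rpow_ge hp hp2 (neg_pos.2 hj) (neg_pos.2 hl) hxjl (by
      rw [show x - j - l - -j - -l = x by ring]; exact hx)
    rw [neg_mul_neg] at this
    refine this.trans (le_of_eq ?_)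
    rw [show x - j - l - -j = x - l by ring, show x - l - -l = x by ring,
      show x - j - l - -l = x - j by ring]
    congr 1; ring
  · have := second_difference_abs_rpow_ge hp hp2 (neg_pos.2 hj) hl hxj (by simpa using hxl)
    rw [neg_mul, abs_neg] at this
    refine this.trans (le_of_eq ?_)
    rw [show x - j - -j = x by ring, ← abs_neg]
    congr 1; ring
  · have := second_difference_abs_rpow_ge hp hp2 hj (neg_pos.2 hl) hxl (by
      rw [show x - l - j - -l = x - j by ring]; exact hxj)
    rw [mul_neg, abs_neg] at this
    refine this.trans (le_of_eq ?_)
    rw [show x - l - j - -l = x - j by ring, show x - l - -l = x by ring, ← abs_neg,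
      show x - l - j = x - j - l by ring]
    congr 1; ring
  · exact second_difference_abs_rpow_ge hp hp2 hj hl hx hxjl

/-- The resonance function `|k|^{2α} - |k₁|^{2α} + |k₂|^{2α} - |k₃|^{2α}` of the cubic interaction,
in the increments `p = (j, l)` of `freqEquiv`. -/
def resonance (α : ℝ) (k : ℤ) (p : ℤ × ℤ) : ℝ :=
  symbol α k - symbol α (k - p.1) + symbol α (k - p.1 - p.2) - symbol α (k - p.2)

theorem resonance_ge {α : ℝ} (hα : 1 / 2 ≤ α) (hα' : α ≤ 1) {k : ℤ} {p : ℤ × ℤ} (hj : p.1 ≠ 0)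
    (hl : p.2 ≠ 0) :
    2 * α * (2 * α - 1) * (|(k : ℝ)| + |(p.1 : ℝ)| + |(p.2 : ℝ)|) ^ (2 * α - 2) *
      |(p.1 : ℝ) * p.2| ≤ |resonance α k p| := by
  have hkbound := abs_le.1 (le_refl |(k : ℝ)|)
  have hjbound := abs_le.1 (le_refl |(p.1 : ℝ)|)
  have hlbound := abs_le.1 (le_refl |(p.2 : ℝ)|)
  have := abs_second_difference_ge (p := 2 * α) (x := (k : ℝ))
    (R := |(k : ℝ)| + |(p.1 : ℝ)| + |(p.2 : ℝ)|) (by linarith) (by linarith)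
    ⟨by linarith, by linarith⟩ ⟨by linarith, by linarith⟩ ⟨by linarith, by linarith⟩
    ⟨by linarith, by linarith⟩ (Int.cast_ne_zero.2 hj) (Int.cast_ne_zero.2 hl)
  simpa [resonance, symbol] using this

theorem resonance_ne_zero {α : ℝ} (hα : 1 / 2 < α) (hα' : α ≤ 1) {k : ℤ} {p : ℤ × ℤ}
    (hj : p.1 ≠ 0) (hl : p.2 ≠ 0) : resonance α k p ≠ 0 := by
  refine abs_pos.1 (lt_of_lt_of_le ?_ (resonance_ge hα.le hα' hj hl))
  have : (p.1 : ℝ) ≠ 0 := Int.cast_ne_zero.2 hj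
  have : (p.2 : ℝ) ≠ 0 := Int.cast_ne_zero.2 hl
  have : 0 < 2 * α - 1 := by linarith
  have : 0 < α := by linarith
  positivity

/-! ### The multipliers of the normal form -/

/-- The multiplier of the nonresonant part of the cubic nonlinearity. -/
def nonres (_ : ℤ) (p : ℤ × ℤ) : ℂ := if p.1 = 0 ∨ p.2 = 0 then 0 else 1

/-- The multiplier of `f ↦ |f̂(k)|² f̂(k)`. -/
def diagRes (_ : ℤ) (p : ℤ × ℤ) : ℂ := if p.1 = 0 ∧ p.2 = 0 then 1 else 0

/-- The multiplier of the normal form transformation. -/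
def normalForm (α : ℝ) (k : ℤ) (p : ℤ × ℤ) : ℂ :=
  if p.1 = 0 ∨ p.2 = 0 then 0 else (resonance α k p : ℂ)⁻¹

/-- The largest `max ⟨k₁⟩ ⟨k₂⟩ ⟨k₃⟩` of the brackets of the interacting frequencies. -/
def maxBracket (k : ℤ) (p : ℤ × ℤ) : ℝ :=
  max (bracket (k - p.1)) (max (bracket (k - p.1 - p.2)) (bracket (k - p.2)))

section MaxBracket

variable (k : ℤ) (p : ℤ × ℤ)

theorem bracket_le_maxBracket₁ : bracket (k - p.1) ≤ maxBracket k p := le_max_left _ _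

theorem bracket_le_maxBracket₂ : bracket (k - p.1 - p.2) ≤ maxBracket k p :=
  (le_max_left _ _).trans (le_max_right _ _)

theorem bracket_le_maxBracket₃ : bracket (k - p.2) ≤ maxBracket k p :=
  (le_max_right _ _).trans (le_max_right _ _)

theorem one_le_maxBracket : 1 ≤ maxBracket k p :=
  (one_le_bracket _).trans (bracket_le_maxBracket₁ k p)

theorem maxBracket_pos : 0 < maxBracket k p := zero_lt_one.trans_le (one_le_maxBracket k p)

theorem abs_frequencies_le_maxBracket : |(k : ℝ) - p.1| ≤ maxBracket k p ∧
    |(k : ℝ) - p.1 - p.2| ≤ maxBracket k p ∧ |(k : ℝ) - p.2| ≤ maxBracket k p := by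
  have h₁ := (abs_le_bracket _).trans (bracket_le_maxBracket₁ k p)
  have h₂ := (abs_le_bracket _).trans (bracket_le_maxBracket₂ k p)
  have h₃ := (abs_le_bracket _).trans (bracket_le_maxBracket₃ k p)
  push_cast at h₁ h₂ h₃
  exact ⟨h₁, h₂, h₃⟩

theorem abs_increments_le_maxBracket :
    |(p.1 : ℝ)| ≤ 2 * maxBracket k p ∧ |(p.2 : ℝ)| ≤ 2 * maxBracket k p := by
  obtain ⟨h₁, h₂, h₃⟩ := abs_frequencies_le_maxBracket k p
  simp only [abs_le] at *
  exact ⟨⟨by linarith, by linarith⟩, ⟨by linarith, by linarith⟩⟩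

theorem bracket_le_three_mul_maxBracket : bracket k ≤ 3 * maxBracket k p := by
  obtain ⟨-, h₂, h₃⟩ := abs_frequencies_le_maxBracket k p
  have hj : |((k - (k - p.1) : ℤ) : ℝ)| ≤ |(k : ℝ) - p.1 - p.2| + |(k : ℝ) - p.2| := by
    rw [add_comm]
    refine le_trans (le_of_eq ?_) (abs_sub _ _)
    push_cast; congr 1; ring
  linarith [bracket_le_add_abs_sub k (k - p.1), bracket_le_maxBracket₁ k p]

theorem maxBracket_rpow_le (s : ℝ) : maxBracket k p ^ s ≤
    bracket (k - p.1) ^ s + bracket (k - p.1 - p.2) ^ s + bracket (k - p.2) ^ s := by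
  have := bracket_rpow_pos (k - p.1) s
  have := bracket_rpow_pos (k - p.1 - p.2) s
  have := bracket_rpow_pos (k - p.2) s
  rw [maxBracket]
  rcases max_choice (bracket (k - p.1)) (max (bracket (k - p.1 - p.2)) (bracket (k - p.2)))
    with h | h <;> rw [h]
  · linarith
  · rcases max_choice (bracket (k - p.1 - p.2)) (bracket (k - p.2)) with h | h <;> rw [h] <;>
      linarith

end MaxBracket

theorem bracket_rpow_le_maxBracket_rpow {s : ℝ} (hs : 0 ≤ s) (k : ℤ) (p : ℤ × ℤ) :
    bracket k ^ s ≤ 3 ^ s * maxBracket k p ^ s := by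
  rw [← Real.mul_rpow (by norm_num) (maxBracket_pos k p).le]
  exact Real.rpow_le_rpow (bracket_pos k).le (bracket_le_three_mul_maxBracket k p) hs

theorem admissible_of_norm_le_one {s : ℝ} (hs : 0 ≤ s) (q : ℝ) {m : ℤ → ℤ × ℤ → ℂ}
    (hm : ∀ k p, ‖m k p‖ ≤ 1) : Admissible s s q (3 ^ s) m := by
  intro k p
  have := bracket_pos (k - p.1)
  have := bracket_pos (k - p.1 - p.2)
  have := bracket_pos (k - p.2)
  have := bracket_pos p.1
  have := bracket_pos p.2
  calc ‖m k p‖ * bracket k ^ s ≤ 1 * (3 ^ s * maxBracket k p ^ s) :=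
        mul_le_mul (hm k p) (bracket_rpow_le_maxBracket_rpow hs k p) (bracket_rpow_pos k s).le
          zero_le_one
    _ ≤ 3 ^ s * (bracket (k - p.1) ^ s + bracket (k - p.1 - p.2) ^ s + bracket (k - p.2) ^ s) := by
        rw [one_mul]; gcongr; exact maxBracket_rpow_le k p s
    _ ≤ _ := mul_le_mul_of_nonneg_left (le_add_of_nonneg_right (by positivity)) (by positivity)

theorem norm_nonres_le_one (k : ℤ) (p : ℤ × ℤ) : ‖nonres k p‖ ≤ 1 := by
  rw [nonres]; split_ifs <;> simp

theorem norm_diagRes_le_one (k : ℤ) (p : ℤ × ℤ) : ‖diagRes k p‖ ≤ 1 := by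
  rw [diagRes]; split_ifs <;> simp

theorem admissible_diagRes {r s q : ℝ} (hq : 1 / 2 ≤ q) (hr : r ≤ s + 1) :
    Admissible r s q 1 diagRes := by
  intro k p
  have := bracket_pos (k - p.1)
  have := bracket_pos (k - p.1 - p.2)
  have := bracket_pos (k - p.2)
  have := bracket_pos p.1
  have := bracket_pos p.2
  rw [diagRes]
  split_ifs with h
  · have hb0 : bracket 0 = 1 := by simp [bracket]
    rw [h.1, h.2]
    simp only [sub_zero, hb0, Real.one_rpow, mul_one, norm_one, one_mul]
    refine le_add_of_nonneg_of_le (by have := bracket_pos k; positivity) ?_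
    rw [← Real.rpow_add (bracket_pos k), ← Real.rpow_add (bracket_pos k)]
    exact bracket_rpow_le (by linarith) k
  · simp only [norm_zero, zero_mul]; positivity

theorem inv_abs_resonance_le {α : ℝ} (hα : 1 / 2 < α) (hα' : α ≤ 1) {k : ℤ} {p : ℤ × ℤ}
    (hj : p.1 ≠ 0) (hl : p.2 ≠ 0) :
    |resonance α k p|⁻¹ ≤ (2 * α * (2 * α - 1))⁻¹ * (7 * maxBracket k p ^ (2 - 2 * α)) *
      |(p.1 : ℝ) * p.2|⁻¹ := by
  set R := |(k : ℝ)| + |(p.1 : ℝ)| + |(p.2 : ℝ)|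
  have : (p.1 : ℝ) ≠ 0 := Int.cast_ne_zero.2 hj
  have : (p.2 : ℝ) ≠ 0 := Int.cast_ne_zero.2 hl
  have hR0 : 0 < R := by positivity
  have hα1 : 0 < 2 * α - 1 := by linarith
  have : 0 < α := by linarith
  have hRle : R ≤ 7 * maxBracket k p := by
    obtain ⟨hjle, hlle⟩ := abs_increments_le_maxBracket k p
    linarith [(abs_le_bracket k).trans (bracket_le_three_mul_maxBracket k p)]
  have hRpow : (R ^ (2 * α - 2))⁻¹ ≤ 7 * maxBracket k p ^ (2 - 2 * α) := by
    calc (R ^ (2 * α - 2))⁻¹ = R ^ (2 - 2 * α) := by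
          rw [← Real.rpow_neg hR0.le, neg_sub]
      _ ≤ (7 * maxBracket k p) ^ (2 - 2 * α) := Real.rpow_le_rpow hR0.le hRle (by linarith)
      _ = 7 ^ (2 - 2 * α) * maxBracket k p ^ (2 - 2 * α) :=
          Real.mul_rpow (by norm_num) (maxBracket_pos k p).le
      _ ≤ 7 * maxBracket k p ^ (2 - 2 * α) := by
          have := maxBracket_pos k p
          gcongr
          exact Real.rpow_le_self_of_one_le (by norm_num) (by linarith)
  calc |resonance α k p|⁻¹ ≤ (2 * α * (2 * α - 1) * R ^ (2 * α - 2) * |(p.1 : ℝ) * p.2|)⁻¹ :=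
        inv_anti₀ (by positivity) (resonance_ge hα.le hα' hj hl)
    _ = (2 * α * (2 * α - 1))⁻¹ * (R ^ (2 * α - 2))⁻¹ * |(p.1 : ℝ) * p.2|⁻¹ := by
        rw [mul_inv, mul_inv _ (R ^ _)]
    _ ≤ _ := by gcongr

theorem inv_abs_resonance_mul_bracket_rpow_le {α r s : ℝ} (hα : 1 / 2 < α) (hα' : α ≤ 1)
    (hs : 0 ≤ s) (hr : r ≤ s + (2 * α - 1)) {k : ℤ} {p : ℤ × ℤ} (hj : p.1 ≠ 0) (hl : p.2 ≠ 0) :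
    |resonance α k p|⁻¹ * bracket k ^ r ≤ (2 * α * (2 * α - 1))⁻¹ * (21 * 3 ^ s) *
      (maxBracket k p ^ s * maxBracket k p * |(p.1 : ℝ) * p.2|⁻¹) := by
  set W := maxBracket k p
  have hW : 0 < W := maxBracket_pos k p
  have hα1 : 0 < 2 * α - 1 := by linarith
  have : 0 < α := by linarith
  have hbracket : bracket k ^ r ≤ (3 ^ s * W ^ s) * (3 * W ^ (2 * α - 1)) := by
    calc bracket k ^ r ≤ bracket k ^ (s + (2 * α - 1)) := bracket_rpow_le hr k
      _ = bracket k ^ s * bracket k ^ (2 * α - 1) := Real.rpow_add (bracket_pos k) _ _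
      _ ≤ (3 ^ s * W ^ s) * (3 ^ (2 * α - 1) * W ^ (2 * α - 1)) :=
          mul_le_mul (bracket_rpow_le_maxBracket_rpow hs k p)
            (bracket_rpow_le_maxBracket_rpow hα1.le k p) (bracket_rpow_pos k _).le (by positivity)
      _ ≤ _ := by
          gcongr
          exact Real.rpow_le_self_of_one_le (by norm_num) (by linarith)
  have hpow : W ^ (2 - 2 * α) * W ^ (2 * α - 1) = W := by
    rw [← Real.rpow_add hW, show 2 - 2 * α + (2 * α - 1) = 1 by ring, Real.rpow_one]
  calc |resonance α k p|⁻¹ * bracket k ^ r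
      ≤ ((2 * α * (2 * α - 1))⁻¹ * (7 * W ^ (2 - 2 * α)) * |(p.1 : ℝ) * p.2|⁻¹) *
        ((3 ^ s * W ^ s) * (3 * W ^ (2 * α - 1))) :=
        mul_le_mul (inv_abs_resonance_le hα hα' hj hl) hbracket (bracket_rpow_pos k r).le
          (by positivity)
    _ = (2 * α * (2 * α - 1))⁻¹ * (21 * 3 ^ s) *
        (W ^ s * (W ^ (2 - 2 * α) * W ^ (2 * α - 1)) * |(p.1 : ℝ) * p.2|⁻¹) := by ring
    _ = _ := by rw [hpow]

theorem maxBracket_le_two_mul_bracket {k : ℤ} {p : ℤ × ℤ}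
    (hj : |(p.1 : ℝ)| ≤ maxBracket k p / 4) (hl : |(p.2 : ℝ)| ≤ maxBracket k p / 4) :
    maxBracket k p ≤ 2 * bracket (k - p.1) ∧ maxBracket k p ≤ 2 * bracket (k - p.1 - p.2) ∧
      maxBracket k p ≤ 2 * bracket (k - p.2) := by
  have h₁₂ := bracket_le_add_abs_sub (k - p.1) (k - p.1 - p.2)
  have h₂₁ := bracket_le_add_abs_sub (k - p.1 - p.2) (k - p.1)
  have h₂₃ := bracket_le_add_abs_sub (k - p.1 - p.2) (k - p.2)
  have h₃₂ := bracket_le_add_abs_sub (k - p.2) (k - p.1 - p.2)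
  rw [show k - p.1 - (k - p.1 - p.2) = p.2 by ring] at h₁₂
  rw [show k - p.1 - p.2 - (k - p.1) = -p.2 by ring, Int.cast_neg, abs_neg] at h₂₁
  rw [show k - p.1 - p.2 - (k - p.2) = -p.1 by ring, Int.cast_neg, abs_neg] at h₂₃
  rw [show k - p.2 - (k - p.1 - p.2) = p.1 by ring] at h₃₂
  have hclose : ∀ x, bracket (k - p.1) ≤ x + maxBracket k p / 2 →
      bracket (k - p.1 - p.2) ≤ x + maxBracket k p / 2 →
      bracket (k - p.2) ≤ x + maxBracket k p / 2 → maxBracket k p ≤ 2 * x := by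
    intro x h₁ h₂ h₃
    have : maxBracket k p ≤ x + maxBracket k p / 2 := max_le h₁ (max_le h₂ h₃)
    linarith
  have hW := maxBracket_pos k p
  exact ⟨hclose _ (by linarith) (by linarith) (by linarith),
    hclose _ (by linarith) (by linarith) (by linarith),
    hclose _ (by linarith) (by linarith) (by linarith)⟩

theorem rpow_mul_self_le {W x y z s q : ℝ} (hW : 1 ≤ W) (hx : W ≤ 2 * x) (hy : W ≤ 2 * y)
    (hz : W ≤ 2 * z) (hs : 0 ≤ s) (hq : 1 / 2 ≤ q) :
    W ^ s * W ≤ 2 ^ (s + 2 * q) * (x ^ s * y ^ q * z ^ q) := by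
  have hW0 : 0 < W := by linarith
  have hhalf : ∀ v, W ≤ 2 * v → W ^ (1 / 2 : ℝ) ≤ 2 ^ q * v ^ q := fun v hv => by
    rw [← Real.mul_rpow (by norm_num) (by linarith)]
    exact (Real.rpow_le_rpow_of_exponent_le hW hq).trans
      (Real.rpow_le_rpow hW0.le hv (by linarith))
  have hself : W ^ s ≤ 2 ^ s * x ^ s := by
    rw [← Real.mul_rpow (by norm_num) (by linarith)]; exact Real.rpow_le_rpow hW0.le hx hs
  have := Real.rpow_nonneg (by linarith : 0 ≤ x) s
  have := Real.rpow_nonneg (by linarith : 0 ≤ y) q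
  calc W ^ s * W = W ^ s * (W ^ (1 / 2 : ℝ) * W ^ (1 / 2 : ℝ)) := by
        rw [← Real.rpow_add hW0]; norm_num
    _ ≤ (2 ^ s * x ^ s) * ((2 ^ q * y ^ q) * (2 ^ q * z ^ q)) := by
        gcongr
        exacts [hhalf y hy, hhalf z hz]
    _ = 2 ^ (s + 2 * q) * (x ^ s * y ^ q * z ^ q) := by
        rw [two_mul, Real.rpow_add two_pos, Real.rpow_add two_pos]; ring

theorem inv_abs_le_bracket_rpow {n : ℤ} (hn : n ≠ 0) :
    |(n : ℝ)|⁻¹ ≤ 2 * bracket n ^ (-1 : ℝ) := by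
  have hn1 : (1 : ℝ) ≤ |(n : ℝ)| := by exact_mod_cast Int.one_le_abs hn
  rw [Real.rpow_neg_one, ← div_eq_mul_inv, inv_eq_one_div,
    div_le_div_iff₀ (by linarith) (bracket_pos n)]
  linarith [bracket_le_one_add_abs n]

-- Either `|jl| ≳ W`, and the resonance alone pays for the factor `W`, or the three brackets are
-- comparable, and `W` splits over the two low frequencies while `|jl|⁻¹` survives.
theorem maxBracket_rpow_mul_self_mul_inv_le {s q : ℝ} (hs : 0 ≤ s) (hq : 1 / 2 ≤ q) {k : ℤ}
    {p : ℤ × ℤ} (hj : p.1 ≠ 0) (hl : p.2 ≠ 0) :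
    maxBracket k p ^ s * maxBracket k p * |(p.1 : ℝ) * p.2|⁻¹ ≤ 4 * 2 ^ (s + 2 * q) *
      (bracket (k - p.1) ^ s + bracket (k - p.1 - p.2) ^ s + bracket (k - p.2) ^ s +
        bracket (k - p.1) ^ s * bracket (k - p.1 - p.2) ^ q * bracket (k - p.2) ^ q *
          (bracket p.1 ^ (-1 : ℝ) * bracket p.2 ^ (-1 : ℝ))) := by
  set W := maxBracket k p
  have hW : 0 < W := maxBracket_pos k p
  have hj1 : (1 : ℝ) ≤ |(p.1 : ℝ)| := by exact_mod_cast Int.one_le_abs hj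
  have hl1 : (1 : ℝ) ≤ |(p.2 : ℝ)| := by exact_mod_cast Int.one_le_abs hl
  have := bracket_pos (k - p.1)
  have := bracket_pos (k - p.1 - p.2)
  have := bracket_pos (k - p.2)
  have := bracket_pos p.1
  have := bracket_pos p.2
  rw [abs_mul]
  rcases le_or_gt (W / 4) (|(p.1 : ℝ)| * |(p.2 : ℝ)|) with hlarge | hsmall
  · calc W ^ s * W * (|(p.1 : ℝ)| * |(p.2 : ℝ)|)⁻¹ ≤ W ^ s * W * (W / 4)⁻¹ := by gcongr
      _ = 4 * 1 * W ^ s := by field_simp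
      _ ≤ 4 * 2 ^ (s + 2 * q) * _ := by
          refine mul_le_mul (mul_le_mul_of_nonneg_left
            (Real.one_le_rpow one_le_two (by linarith)) (by norm_num))
            ((maxBracket_rpow_le k p s).trans (le_add_of_nonneg_right ?_)) ?_ ?_ <;> positivity
  · obtain ⟨h₁, h₂, h₃⟩ := maxBracket_le_two_mul_bracket (k := k) (p := p)
      ((le_mul_of_one_le_right (by positivity) hl1).trans hsmall.le)
      ((le_mul_of_one_le_left (by positivity) hj1).trans hsmall.le)
    calc W ^ s * W * (|(p.1 : ℝ)| * |(p.2 : ℝ)|)⁻¹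
        = W ^ s * W * (|(p.1 : ℝ)|⁻¹ * |(p.2 : ℝ)|⁻¹) := by rw [mul_inv]
      _ ≤ 2 ^ (s + 2 * q) *
          (bracket (k - p.1) ^ s * bracket (k - p.1 - p.2) ^ q * bracket (k - p.2) ^ q) *
          ((2 * bracket p.1 ^ (-1 : ℝ)) * (2 * bracket p.2 ^ (-1 : ℝ))) := by
          refine mul_le_mul (rpow_mul_self_le (one_le_maxBracket k p) h₁ h₂ h₃ hs hq)
            (mul_le_mul (inv_abs_le_bracket_rpow hj) (inv_abs_le_bracket_rpow hl) ?_ ?_) ?_ ?_ <;>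
            positivity
      _ = 4 * 2 ^ (s + 2 * q) *
          (bracket (k - p.1) ^ s * bracket (k - p.1 - p.2) ^ q * bracket (k - p.2) ^ q *
            (bracket p.1 ^ (-1 : ℝ) * bracket p.2 ^ (-1 : ℝ))) := by ring
      _ ≤ _ := mul_le_mul_of_nonneg_left (le_add_of_nonneg_left (by positivity)) (by positivity)

/-- The constant with which `normalForm` is admissible. -/
def normalFormConst (α s q : ℝ) : ℝ :=
  (2 * α * (2 * α - 1))⁻¹ * (21 * 3 ^ s) * (4 * 2 ^ (s + 2 * q))

theorem admissible_normalForm {α r s q : ℝ} (hα : 1 / 2 < α) (hα' : α ≤ 1) (hs : 0 ≤ s)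
    (hq : 1 / 2 ≤ q) (hr : r ≤ s + (2 * α - 1)) :
    Admissible r s q (normalFormConst α s q) (normalForm α) := by
  intro k p
  have := bracket_pos (k - p.1)
  have := bracket_pos (k - p.1 - p.2)
  have := bracket_pos (k - p.2)
  have := bracket_pos p.1
  have := bracket_pos p.2
  have : 0 < 2 * α - 1 := by linarith
  have : 0 < α := by linarith
  rw [normalForm, normalFormConst]
  split_ifs with h
  · simp only [norm_zero, zero_mul]; positivity
  obtain ⟨hj, hl⟩ := not_or.1 h
  rw [norm_inv, Complex.norm_real, Real.norm_eq_abs, mul_assoc _ (4 * 2 ^ (s + 2 * q))]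
  exact (inv_abs_resonance_mul_bracket_rpow_le hα hα' hs hr hj hl).trans
    (mul_le_mul_of_nonneg_left (maxBracket_rpow_mul_self_mul_inv_le hs hq hj hl) (by positivity))

/-! ### Sobolev norms and coefficient sequences -/

theorem coeff_eq_repr (f : L2) (k : ℤ) : coeff f k = fourierBasis.repr f k :=
  (fourierBasis_repr f k).symm

theorem coeff_sub (f g : L2) : coeff (f - g) = coeff f - coeff g := by
  ext k; simp [coeff_eq_repr]

theorem coeff_smul (z : ℂ) (f : L2) : coeff (z • f) = z • coeff f := by
  ext k; simp [coeff_eq_repr]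

theorem weight_sq (s : ℝ) (k : ℤ) (z : ℂ) :
    (eweight s k * ‖z‖ₑ) ^ 2 = ENNReal.ofReal (bracket k ^ (2 * s) * ‖z‖ ^ 2) := by
  rw [eweight, ← ofReal_norm, ← ENNReal.ofReal_mul (bracket_rpow_pos k s).le,
    ← ENNReal.ofReal_pow (mul_nonneg (bracket_rpow_pos k s).le (norm_nonneg _)), mul_pow,
    ← Real.rpow_mul_natCast (bracket_pos k).le]
  congr 3; push_cast; ring

theorem wnorm_sq (s : ℝ) (c : ℤ → ℂ) :
    wnorm s c ^ 2 = ∑' k, ENNReal.ofReal (bracket k ^ (2 * s) * ‖c k‖ ^ 2) := by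
  simp only [wnorm, l2Norm_sq, weight_sq]

theorem weight_nonneg (s : ℝ) (k : ℤ) (z : ℂ) : 0 ≤ bracket k ^ (2 * s) * ‖z‖ ^ 2 :=
  mul_nonneg (bracket_rpow_pos k _).le (by positivity)

theorem summable_iff_wnorm_lt_top (s : ℝ) (c : ℤ → ℂ) :
    (Summable fun k : ℤ => bracket k ^ (2 * s) * ‖c k‖ ^ 2) ↔ wnorm s c < ∞ := by
  have hsq : wnorm s c < ∞ ↔ wnorm s c ^ 2 < ∞ := by simp [ENNReal.pow_lt_top_iff]
  rw [hsq, wnorm_sq, lt_top_iff_ne_top]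
  refine ⟨fun h => h.tsum_ofReal_ne_top, fun h => (ENNReal.summable_toReal h).congr fun k => ?_⟩
  rw [ENNReal.toReal_ofReal (weight_nonneg s k _)]

theorem memSobolev_iff (s : ℝ) (f : L2) : MemSobolev s f ↔ wnorm s (coeff f) < ∞ :=
  summable_iff_wnorm_lt_top s (coeff f)

theorem sqrt_tsum_eq_wnorm (s : ℝ) (c : ℤ → ℂ) :
    Real.sqrt (∑' k : ℤ, bracket k ^ (2 * s) * ‖c k‖ ^ 2) = (wnorm s c).toReal := by
  have h := congrArg ENNReal.toReal (wnorm_sq s c)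
  rw [ENNReal.tsum_toReal_eq fun _ => ENNReal.ofReal_ne_top, ENNReal.toReal_pow] at h
  simp only [ENNReal.toReal_ofReal (weight_nonneg s _ _)] at h
  rw [← h, Real.sqrt_sq ENNReal.toReal_nonneg]

theorem sobolevNorm_eq (s : ℝ) (f : L2) : sobolevNorm s f = (wnorm s (coeff f)).toReal :=
  sqrt_tsum_eq_wnorm s (coeff f)

theorem phase_eq (f : L2) : phase f = 2 * ∑' k, ‖coeff f k‖ ^ 2 := by
  have h := tsum_sq_fourierCoeff f
  rw [AddCircle.integral_haarAddCircle] at h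
  have hParseval : ∑' k, ‖coeff f k‖ ^ 2 = (2 * Real.pi)⁻¹ • ∫ t : Torus, ‖f t‖ ^ 2 := h
  rw [hParseval, phase, smul_eq_mul, mul_inv]
  have := Real.pi_pos.ne'
  field_simp

/-- The function with the Fourier coefficients `c`, and `0` by convention when `c` is not square
summable. -/
def ofCoeff (c : ℤ → ℂ) : L2 :=
  open Classical in if h : Memℓp c 2 then fourierBasis.repr.symm ⟨c, h⟩ else 0

theorem memℓp_of_wnorm {c : ℤ → ℂ} (h : wnorm 0 c < ∞) : Memℓp c 2 := by
  rw [memℓp_gen_iff (by norm_num)]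
  simpa using (summable_iff_wnorm_lt_top 0 c).2 h

theorem coeff_ofCoeff {c : ℤ → ℂ} (h : wnorm 0 c < ∞) : coeff (ofCoeff c) = c := by
  ext k
  rw [ofCoeff, dif_pos (memℓp_of_wnorm h), coeff_eq_repr, LinearIsometryEquiv.apply_symm_apply]

/-! ### The Fourier coefficients of the cubic nonlinearity -/

theorem tsum_enorm_le (s : ℝ) (c : ℤ → ℂ) : ∑' k, ‖c k‖ₑ ≤ bracketConst s * wnorm s c := by
  refine le_trans (le_of_eq ?_) (tsum_mul_le_l2Norm _ _)
  congr 1; ext k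
  rw [← mul_assoc, eweight_neg_mul, one_mul]

theorem summable_norm_of_wnorm {s : ℝ} (hs : 1 / 2 < s) {c : ℤ → ℂ} (h : wnorm s c < ∞) :
    Summable fun k => ‖c k‖ := by
  rw [← tsum_enorm_ne_top_iff_summable_norm]
  exact ((tsum_enorm_le s c).trans_lt (ENNReal.mul_lt_top (bracketConst_lt_top hs) h)).ne

/-- The Fourier coefficient as a functional on continuous functions. -/
def coeffCLM (k : ℤ) : C(Torus, ℂ) →L[ℂ] ℂ :=
  (lp.evalCLM ℂ (fun _ : ℤ => ℂ) 2 k).comp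
    ((fourierBasis (T := 2 * Real.pi)).repr.toContinuousLinearEquiv.toContinuousLinearMap.comp
      (ContinuousMap.toLp 2 haarAddCircle ℂ))

theorem coeffCLM_apply (k : ℤ) (g : C(Torus, ℂ)) : coeffCLM k g = fourierCoeff g k := by
  have : coeffCLM k g = fourierBasis.repr (ContinuousMap.toLp 2 haarAddCircle ℂ g) k := rfl
  rw [this, fourierBasis_repr, fourierCoeff_toLp]

theorem coeffCLM_fourier (k n : ℤ) : coeffCLM k (fourier n) = if n = k then 1 else 0 := by
  have : coeffCLM k (fourier n) = fourierBasis.repr (fourierLp 2 n) k := rfl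
  rw [this, ← coe_fourierBasis, HilbertBasis.repr_self, lp.single_apply]
  by_cases h : n = k
  · subst h; simp
  · rw [Pi.single_eq_of_ne (Ne.symm h), if_neg h]

theorem hasSum_mul_star_mul {A : Type*} [NormedRing A] [CompleteSpace A] [StarRing A]
    [NormedStarGroup A] {F : ℤ → A} {g : A}
    (hF : Summable fun k => ‖F k‖) (hg : HasSum F g) :
    HasSum (fun x : ℤ × (ℤ × ℤ) => F x.1 * (star (F x.2.1) * F x.2.2)) (g * (star g * g)) := by
  have hstar : Summable fun k => ‖star (F k)‖ := by simpa only [norm_star] using hF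
  have hpair : HasSum (fun x : ℤ × ℤ => star (F x.1) * F x.2) (star g * g) :=
    have hsummable : Summable fun x : ℤ × ℤ => star (F x.1) * F x.2 :=
      summable_mul_of_summable_norm hstar hF
    hg.star.mul hg hsummable
  have htriple : Summable fun x : ℤ × (ℤ × ℤ) => F x.1 * (star (F x.2.1) * F x.2.2) :=
    have hnorm : Summable fun x : ℤ × ℤ => ‖star (F x.1) * F x.2‖ := hstar.mul_norm hF
    summable_mul_of_summable_norm (f := F) (g := fun x : ℤ × ℤ => star (F x.1) * F x.2) hF hnorm
  exact HasSum.mul (f := F) (g := fun x : ℤ × ℤ => star (F x.1) * F x.2) hg hpair htriple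

theorem smul_fourier_mul_star_mul (c : ℤ → ℂ) (k : ℤ) (p : ℤ × ℤ) :
    c (k - p.1) • (fourier (k - p.1) : C(Torus, ℂ)) *
      (star (c (k - p.1 - p.2) • (fourier (k - p.1 - p.2) : C(Torus, ℂ))) *
        (c (k - p.2) • (fourier (k - p.2) : C(Torus, ℂ)))) =
      trilinearTerm (fun _ _ => 1) c c c k p • (fourier k : C(Torus, ℂ)) := by
  ext x
  have hchar : fourier k x = fourier (k - p.1) x *
      (conj (fourier (k - p.1 - p.2) x) * fourier (k - p.2) x) := by
    rw [← fourier_neg, ← fourier_add, ← fourier_add,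
      show k - p.1 + (-(k - p.1 - p.2) + (k - p.2)) = k by ring]
  simp only [ContinuousMap.mul_apply, ContinuousMap.smul_apply, ContinuousMap.star_apply,
    smul_eq_mul, hchar, star_mul', RCLike.star_def, trilinearTerm]
  ring

theorem fourierCoeff_cubic {c : ℤ → ℂ} (hc : Summable fun k => ‖c k‖) {g : C(Torus, ℂ)}
    (hg : HasSum (fun k => c k • (fourier k : C(Torus, ℂ))) g) (k : ℤ) :
    fourierCoeff (g * (star g * g) : C(Torus, ℂ)) k = trilinear (fun _ _ => 1) c c c k := by
  have hn : Summable fun k => ‖c k • (fourier k : C(Torus, ℂ))‖ := by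
    simpa [norm_smul, fourier_norm] using hc
  have hsum := (coeffCLM k).hasSum (hasSum_mul_star_mul hn hg)
  rw [coeffCLM_apply, ← freqEquiv.hasSum_iff] at hsum
  have hinj : Function.Injective fun p : ℤ × ℤ => (k, p) := fun p p' h => (Prod.mk.inj h).2
  have hfiber : HasSum (fun x : ℤ × (ℤ × ℤ) =>
      if x.1 = k then trilinearTerm (fun _ _ => 1) c c c k x.2 else 0)
      (fourierCoeff (g * (star g * g) : C(Torus, ℂ)) k) := by
    refine hsum.congr_fun fun x => ?_
    refine Eq.trans ?_ (congrArg (coeffCLM k) (smul_fourier_mul_star_mul c x.1 x.2)).symm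
    rw [map_smul, coeffCLM_fourier]
    split_ifs with h
    · rw [h, smul_eq_mul, mul_one]
    · rw [smul_zero]
  rw [← hinj.hasSum_iff] at hfiber
  · rw [trilinear, ← hfiber.tsum_eq]
    congr 1; ext p; simp
  · intro x hx
    rw [if_neg]
    rintro rfl
    exact hx ⟨x.2, rfl⟩

theorem cubicCoeff_eq {s : ℝ} (hs : 1 / 2 < s) {f : L2} (hf : wnorm s (coeff f) < ∞) :
    cubicCoeff f = trilinear (fun _ _ => 1) (coeff f) (coeff f) (coeff f) := by
  have hc := summable_norm_of_wnorm hs hf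
  obtain ⟨g, hg⟩ : Summable fun k => coeff f k • (fourier k : C(Torus, ℂ)) :=
    .of_norm (by simpa [norm_smul, fourier_norm] using hc)
  have hLp : ContinuousMap.toLp (E := ℂ) 2 (haarAddCircle : Measure Torus) ℂ g = f := by
    refine ((ContinuousMap.toLp 2 haarAddCircle ℂ).hasSum hg).unique ?_
    convert hasSum_fourier_series_L2 f using 1
    ext k
    rw [map_smul]
    rfl
  have hae : (f : Torus → ℂ) =ᵐ[haarAddCircle] g := by
    have := ContinuousMap.coeFn_toLp (p := 2) (𝕜 := ℂ) (haarAddCircle : Measure Torus) g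
    rwa [hLp] at this
  ext k
  rw [← fourierCoeff_cubic hc hg k, cubicCoeff]
  refine congrFun (fourierCoeff_congr_ae ?_) k
  filter_upwards [hae] with x hx
  rw [hx, Complex.ofReal_pow, ← Complex.conj_mul', mul_comm]
  rfl

/-! ### Summation and integration in time -/

theorem tsum_sub_tsum_eq_integral {ι : Type*} [Countable ι] {f f' : ι → ℝ → ℂ} {a b : ℝ}
    (hd : ∀ i, ∀ t ∈ Set.uIcc a b, HasDerivAt (f i) (f' i t) t)
    (hc : ∀ i, ContinuousOn (f' i) (Set.uIcc a b)) {C : ℝ≥0∞} (hC : C < ∞)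
    (hbd : ∀ t ∈ Set.uIcc a b, ∑' i, ‖f' i t‖ₑ ≤ C)
    (ha : Summable fun i => f i a) (hb : Summable fun i => f i b) :
    ∑' i, f i b - ∑' i, f i a = ∫ t in a..b, ∑' i, f' i t := by
  have hftc : ∀ i, f i b - f i a = ∫ t in a..b, f' i t := fun i =>
    (intervalIntegral.integral_eq_sub_of_hasDerivAt (hd i) (hc i).intervalIntegrable).symm
  have hmeas : ∀ i, AEStronglyMeasurable (f' i) (volume.restrict (Set.uIoc a b)) := fun i =>
    ((hc i).mono Set.uIoc_subset_uIcc).aestronglyMeasurable measurableSet_uIoc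
  have hfin : ∑' i, ∫⁻ t in Set.uIoc a b, ‖f' i t‖ₑ ≠ ∞ := by
    rw [← lintegral_tsum fun i => (hmeas i).enorm]
    refine ((setLIntegral_mono' measurableSet_uIoc fun t ht =>
      hbd t (Set.uIoc_subset_uIcc ht)).trans_lt ?_).ne
    rw [setLIntegral_const, Set.uIoc, Real.volume_Ioc]
    exact ENNReal.mul_lt_top hC ENNReal.ofReal_lt_top
  rw [← hb.tsum_sub ha]
  simp only [hftc, intervalIntegral.intervalIntegral_eq_integral_uIoc]
  rw [tsum_const_smul'', integral_tsum hmeas hfin]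

theorem sum_lintegral_le_lintegral_sum {α ι : Type*} [MeasurableSpace α] (μ : Measure α)
    (S : Finset ι) (f : ι → α → ℝ≥0∞) :
    ∑ i ∈ S, ∫⁻ t, f i t ∂μ ≤ ∫⁻ t, ∑ i ∈ S, f i t ∂μ := by
  classical
  induction S using Finset.induction_on with
  | empty => simp
  | insert i S hi ih =>
    simp only [Finset.sum_insert hi]
    exact (add_le_add_right ih _).trans (le_lintegral_add _ _)

theorem sum_mul_le_l2Norm {ι : Type*} (S : Finset ι) (x y : ι → ℝ≥0∞) :
    ∑ i ∈ S, x i * y i ≤ l2Norm (fun i : S => x i) * l2Norm y := by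
  rw [← Finset.sum_coe_sort S fun i => x i * y i, ← tsum_fintype (L := .unconditional _)]
  refine (tsum_mul_le_l2Norm _ _).trans (mul_le_mul_right ?_ _)
  rw [l2Norm_le_iff, l2Norm_sq]
  exact ENNReal.tsum_comp_le_tsum_of_injective Subtype.val_injective (fun i => y i ^ 2)

theorem l2Norm_finset_sq {ι : Type*} (S : Finset ι) (x : ι → ℝ≥0∞) :
    l2Norm (fun i : S => x i) ^ 2 = ∑ i ∈ S, x i ^ 2 := by
  rw [l2Norm_sq, tsum_fintype, Finset.sum_coe_sort S fun i => x i ^ 2]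

theorem l2Norm_finset_lintegral_le {α ι : Type*} [MeasurableSpace α] (μ : Measure α)
    (f : ι → α → ℝ≥0∞) (S : Finset ι)
    (hfin : l2Norm (fun i : S => ∫⁻ t, f i t ∂μ) ≠ ∞) :
    l2Norm (fun i : S => ∫⁻ t, f i t ∂μ) ≤ ∫⁻ t, l2Norm (fun i => f i t) ∂μ := by
  set x : ι → ℝ≥0∞ := fun i => ∫⁻ t, f i t ∂μ
  set X : ℝ≥0∞ := l2Norm (fun i : S => x i) with hX
  have hdual : X * X ≤ X * ∫⁻ t, l2Norm (fun i => f i t) ∂μ := by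
    calc X * X = ∑ i ∈ S, x i * ∫⁻ t, f i t ∂μ := by
          rw [← sq, hX, l2Norm_finset_sq]; exact Finset.sum_congr rfl fun i _ => sq _
      _ ≤ ∑ i ∈ S, ∫⁻ t, x i * f i t ∂μ :=
          Finset.sum_le_sum fun i _ => lintegral_const_mul_le _ _
      _ ≤ ∫⁻ t, ∑ i ∈ S, x i * f i t ∂μ := sum_lintegral_le_lintegral_sum μ S _
      _ ≤ ∫⁻ t, X * l2Norm (fun i => f i t) ∂μ :=
          lintegral_mono fun t => sum_mul_le_l2Norm S x fun i => f i t
      _ = X * ∫⁻ t, l2Norm (fun i => f i t) ∂μ := lintegral_const_mul' _ _ hfin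
  rcases eq_or_ne X 0 with h0 | h0
  · exact h0 ▸ zero_le
  · exact (ENNReal.mul_le_mul_iff_right h0 hfin).1 hdual

theorem l2Norm_lintegral_le {α ι : Type*} [MeasurableSpace α] (μ : Measure α)
    (f : ι → α → ℝ≥0∞) :
    l2Norm (fun i => ∫⁻ t, f i t ∂μ) ≤ ∫⁻ t, l2Norm (fun i => f i t) ∂μ := by
  rcases eq_or_ne (∫⁻ t, l2Norm (fun i => f i t) ∂μ) ∞ with hY | hY
  · exact hY ▸ le_top
  have hfin (i : ι) : ∫⁻ t, f i t ∂μ < ∞ :=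
    (lintegral_mono fun t => le_l2Norm (fun i => f i t) i).trans_lt hY.lt_top
  rw [l2Norm_le_iff, ENNReal.tsum_eq_iSup_sum]
  refine iSup_le fun S => ?_
  rw [← l2Norm_finset_sq]
  refine pow_le_pow_left' (l2Norm_finset_lintegral_le μ f S ?_) 2
  rw [← (ENNReal.pow_right_strictMono two_ne_zero).injective.ne_iff,
    l2Norm_finset_sq S fun i => ∫⁻ t, f i t ∂μ, ENNReal.top_pow two_ne_zero]
  exact (ENNReal.sum_lt_top.2 fun i _ => ENNReal.pow_lt_top (hfin i)).ne

theorem wnorm_integral_le {r : ℝ} {F : ℝ → ℤ → ℂ} {G : ℝ → ℝ} {a b : ℝ}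
    (hG : ContinuousOn G (Set.uIcc a b)) (hG0 : ∀ t ∈ Set.uIcc a b, 0 ≤ G t)
    (h : ∀ t ∈ Set.uIcc a b, wnorm r (F t) ≤ ENNReal.ofReal (G t)) :
    wnorm r (fun k => ∫ t in a..b, F t k) ≤ ENNReal.ofReal |∫ t in a..b, G t| := by
  have hcoeff (k : ℤ) : eweight r k * ‖∫ t in a..b, F t k‖ₑ ≤
      ∫⁻ t in Set.uIoc a b, eweight r k * ‖F t k‖ₑ := by
    rw [lintegral_const_mul' (eweight r k) _ ENNReal.ofReal_ne_top]
    refine mul_le_mul_right ?_ _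
    rw [← ofReal_norm, intervalIntegral.norm_intervalIntegral_eq, ofReal_norm]
    exact enorm_integral_le_lintegral_enorm _
  have hG0' : ∀ t ∈ Set.uIoc a b, 0 ≤ G t := fun t ht => hG0 t (Set.uIoc_subset_uIcc ht)
  calc wnorm r (fun k => ∫ t in a..b, F t k)
      ≤ ∫⁻ t in Set.uIoc a b, wnorm r (F t) := (l2Norm_mono hcoeff).trans (l2Norm_lintegral_le _ _)
    _ ≤ ∫⁻ t in Set.uIoc a b, ENNReal.ofReal (G t) :=
        setLIntegral_mono' measurableSet_uIoc fun t ht => h t (Set.uIoc_subset_uIcc ht)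
    _ = ENNReal.ofReal (∫ t in Set.uIoc a b, G t) :=
        (ofReal_integral_eq_lintegral_ofReal (intervalIntegrable_iff.1 hG.intervalIntegrable)
          ((ae_restrict_iff' measurableSet_uIoc).2 (Eventually.of_forall hG0'))).symm
    _ = ENNReal.ofReal |∫ t in a..b, G t| := by
        rw [intervalIntegral.abs_intervalIntegral_eq,
          abs_of_nonneg (setIntegral_nonneg measurableSet_uIoc hG0')]

/-! ### Continuity in `H^r` -/

/-- Continuity in `H^r`, on the set `I`, of a family of coefficient sequences; the counterpart of
`ContinuousInSobolev` on the Fourier side. -/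
def SeqContinuousOn (r : ℝ) (I : Set ℝ) (c : ℝ → ℤ → ℂ) : Prop :=
  (∀ t ∈ I, wnorm r (c t) < ∞) ∧
    ∀ t₀ ∈ I, Tendsto (fun t => wnorm r (c t - c t₀)) (𝓝[I] t₀) (𝓝 0)

theorem continuousInSobolev_iff {s : ℝ} {I : Set ℝ} {u : ℝ → L2} :
    ContinuousInSobolev s I u ↔ SeqContinuousOn s I (fun t => coeff (u t)) := by
  unfold ContinuousInSobolev SeqContinuousOn
  simp only [memSobolev_iff, sobolevNorm_eq, coeff_sub]
  refine and_congr_right fun hfin => forall₂_congr fun t₀ ht₀ => ?_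
  have hne : ∀ᶠ t in 𝓝[I] t₀, wnorm s (coeff (u t) - coeff (u t₀)) ≠ ∞ := by
    filter_upwards [self_mem_nhdsWithin] with t ht
    exact (wnorm_sub_lt_top (hfin t ht) (hfin t₀ ht₀)).ne
  constructor
  · intro h
    have hofReal := ENNReal.tendsto_ofReal h
    rw [ENNReal.ofReal_zero] at hofReal
    refine hofReal.congr' ?_
    filter_upwards [hne] with t ht
    exact ENNReal.ofReal_toReal ht
  · intro h
    exact (ENNReal.tendsto_toReal ENNReal.zero_ne_top).comp h

namespace SeqContinuousOn

variable {r s : ℝ} {I : Set ℝ} {c d : ℝ → ℤ → ℂ}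

theorem tendsto_of_le {l : Filter ℝ} {f g : ℝ → ℝ≥0∞} (hg : Tendsto g l (𝓝 0))
    (h : ∀ᶠ t in l, f t ≤ g t) : Tendsto f l (𝓝 0) :=
  tendsto_of_tendsto_of_tendsto_of_le_of_le' tendsto_const_nhds hg
    (Eventually.of_forall fun _ => zero_le) h

theorem mono_exp (h : r ≤ s) (hc : SeqContinuousOn s I c) : SeqContinuousOn r I c :=
  ⟨fun t ht => (wnorm_mono_exp h _).trans_lt (hc.1 t ht), fun t₀ ht₀ =>
    tendsto_of_le (hc.2 t₀ ht₀) (Eventually.of_forall fun _ => wnorm_mono_exp h _)⟩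

theorem congr (hc : SeqContinuousOn s I c) (h : ∀ t ∈ I, d t = c t) : SeqContinuousOn s I d :=
  ⟨fun t ht => h t ht ▸ hc.1 t ht, fun t₀ ht₀ => by
    refine (hc.2 t₀ ht₀).congr' ?_
    filter_upwards [self_mem_nhdsWithin] with t ht
    rw [h t ht, h t₀ ht₀]⟩

theorem const {e : ℤ → ℂ} (he : wnorm s e < ∞) : SeqContinuousOn s I (fun _ => e) :=
  ⟨fun _ _ => he, fun t₀ _ => by simpa using tendsto_const_nhds⟩

theorem add (hc : SeqContinuousOn s I c) (hd : SeqContinuousOn s I d) :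
    SeqContinuousOn s I (fun t => c t + d t) :=
  ⟨fun t ht => (wnorm_add_le _ _ _).trans_lt (ENNReal.add_lt_top.2 ⟨hc.1 t ht, hd.1 t ht⟩),
    fun t₀ ht₀ => by
      have h := (hc.2 t₀ ht₀).add (hd.2 t₀ ht₀)
      rw [add_zero] at h
      refine tendsto_of_le h (Eventually.of_forall fun t => ?_)
      rw [add_sub_add_comm]
      exact wnorm_add_le _ _ _⟩

theorem smul (z : ℂ) (hc : SeqContinuousOn s I c) : SeqContinuousOn s I (fun t => z • c t) :=
  ⟨fun t ht => by
    rw [wnorm_smul]; exact ENNReal.mul_lt_top enorm_lt_top (hc.1 t ht),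
    fun t₀ ht₀ => by
      have h := ENNReal.Tendsto.const_mul (a := ‖z‖ₑ) (hc.2 t₀ ht₀) (Or.inr enorm_ne_top)
      rw [mul_zero] at h
      refine h.congr fun t => ?_
      rw [← smul_sub, wnorm_smul]⟩

theorem sub (hc : SeqContinuousOn s I c) (hd : SeqContinuousOn s I d) :
    SeqContinuousOn s I (fun t => c t - d t) := by
  refine (hc.add (hd.smul (-1))).congr fun t _ => ?_
  rw [neg_one_smul, sub_eq_add_neg]

theorem tendsto_wnorm (hc : SeqContinuousOn s I c) {t₀ : ℝ} (ht₀ : t₀ ∈ I) :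
    Tendsto (fun t => wnorm s (c t)) (𝓝[I] t₀) (𝓝 (wnorm s (c t₀))) := by
  rw [ENNReal.tendsto_nhds (hc.1 t₀ ht₀).ne]
  intro ε hε
  filter_upwards [(ENNReal.tendsto_nhds_zero.1 (hc.2 t₀ ht₀)) ε hε] with t ht
  refine ⟨tsub_le_iff_right.2 ?_, ?_⟩
  · calc wnorm s (c t₀) = wnorm s (c t + (c t₀ - c t)) := by rw [add_sub_cancel]
      _ ≤ wnorm s (c t) + wnorm s (c t₀ - c t) := wnorm_add_le _ _ _
      _ ≤ wnorm s (c t) + ε := by rw [wnorm_sub_comm]; gcongr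
  · calc wnorm s (c t) = wnorm s (c t₀ + (c t - c t₀)) := by rw [add_sub_cancel]
      _ ≤ wnorm s (c t₀) + wnorm s (c t - c t₀) := wnorm_add_le _ _ _
      _ ≤ wnorm s (c t₀) + ε := by gcongr

theorem toReal_wnorm (hc : SeqContinuousOn s I c) :
    ContinuousOn (fun t => (wnorm s (c t)).toReal) I := fun t₀ ht₀ =>
  (ENNReal.tendsto_toReal (hc.1 t₀ ht₀).ne).comp (hc.tendsto_wnorm ht₀)

theorem coeff (hc : SeqContinuousOn s I c) (k : ℤ) : ContinuousOn (fun t => c t k) I := by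
  intro t₀ ht₀
  rw [ContinuousWithinAt, tendsto_iff_edist_tendsto_0]
  have h := ENNReal.Tendsto.const_mul (a := eweight (-s) k) (hc.2 t₀ ht₀)
    (Or.inr ENNReal.ofReal_ne_top)
  rw [mul_zero] at h
  refine tendsto_of_le h (Eventually.of_forall fun t => ?_)
  rw [edist_eq_enorm_sub]
  exact enorm_le_wnorm s (c t - c t₀) k

theorem bounded_on_uIcc (hc : SeqContinuousOn s I c) {a b : ℝ} (hab : Set.uIcc a b ⊆ I) :
    ∃ K : ℝ, ∀ t ∈ Set.uIcc a b, wnorm s (c t) ≤ ENNReal.ofReal K := by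
  obtain ⟨K, hK⟩ := (isCompact_uIcc.image_of_continuousOn (hc.toReal_wnorm.mono hab)).bddAbove
  refine ⟨max K 0, fun t ht => ?_⟩
  rw [ENNReal.le_ofReal_iff_toReal_le (hc.1 t (hab ht)).ne (le_max_right _ _)]
  exact (hK ⟨t, ht, rfl⟩).trans (le_max_left _ _)

theorem trilinear {f g h : ℝ → ℤ → ℂ} {q A : ℝ} {m : ℤ → ℤ × ℤ → ℂ} (hq : 1 / 2 < q) (hqs : q ≤ s)
    (hm : Admissible r s q A m) (hf : SeqContinuousOn s I f) (hg : SeqContinuousOn s I g)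
    (hh : SeqContinuousOn s I h) :
    SeqContinuousOn r I (fun t => FNLS.trilinear m (f t) (g t) (h t)) := by
  have hC := trilinearConst_lt_top hq A
  refine ⟨fun t ht => ?_, fun t₀ ht₀ => ?_⟩
  · refine (hm.wnorm_trilinear_le _ _ _).trans_lt (ENNReal.mul_lt_top hC ?_)
    exact (mixedNorm_le hqs _ _ _).trans_lt (ENNReal.mul_lt_top (by norm_num)
      (ENNReal.mul_lt_top (hf.1 t ht) (ENNReal.mul_lt_top (hg.1 t ht) (hh.1 t ht))))
  · have hf₀ := (hf.1 t₀ ht₀).ne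
    have hg₀ := (hg.1 t₀ ht₀).ne
    have hh₀ := (hh.1 t₀ ht₀).ne
    have hzero := ENNReal.zero_ne_top
    have hdiff_f := ENNReal.Tendsto.mul (hf.2 t₀ ht₀) (Or.inr (ENNReal.mul_ne_top hg₀ hh₀))
      (ENNReal.Tendsto.mul (hg.tendsto_wnorm ht₀) (Or.inr hh₀) (hh.tendsto_wnorm ht₀) (Or.inr hg₀))
      (Or.inr hzero)
    have hdiff_g := ENNReal.Tendsto.const_mul (a := wnorm s (f t₀))
      (ENNReal.Tendsto.mul (hg.2 t₀ ht₀) (Or.inr hh₀) (hh.tendsto_wnorm ht₀) (Or.inr hzero))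
      (Or.inr hf₀)
    have hdiff_h := ENNReal.Tendsto.const_mul (a := wnorm s (f t₀))
      (ENNReal.Tendsto.const_mul (a := wnorm s (g t₀)) (hh.2 t₀ ht₀) (Or.inr hg₀)) (Or.inr hf₀)
    have hbound := ENNReal.Tendsto.const_mul (a := 3 * trilinearConst q A)
      ((hdiff_f.add hdiff_g).add hdiff_h) (Or.inr (ENNReal.mul_ne_top (by norm_num) hC.ne))
    simp only [zero_mul, mul_zero, add_zero] at hbound
    refine tendsto_of_le hbound ?_
    filter_upwards [self_mem_nhdsWithin] with t ht
    exact hm.wnorm_trilinear_sub_le hq hqs (hf.1 t ht) (hg.1 t ht) (hh.1 t ht) (hf.1 t₀ ht₀)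
      (hg.1 t₀ ht₀) (hh.1 t₀ ht₀)

end SeqContinuousOn

/-- Multiplication of a coefficient sequence by the unimodular factors `e^{i t θ_k}`. -/
def modulate (θ : ℤ → ℝ) (t : ℝ) (c : ℤ → ℂ) : ℤ → ℂ :=
  fun k => Complex.exp (Complex.I * (t * θ k : ℝ)) * c k

theorem norm_exp_I_mul_ofReal (x : ℝ) : ‖Complex.exp (Complex.I * (x : ℂ))‖ = 1 := by
  rw [mul_comm, Complex.norm_exp_ofReal_mul_I]

@[simp] theorem wnorm_modulate (r : ℝ) (θ : ℤ → ℝ) (t : ℝ) (c : ℤ → ℂ) :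
    wnorm r (modulate θ t c) = wnorm r c :=
  wnorm_congr_norm r fun k => by rw [modulate, norm_mul, norm_exp_I_mul_ofReal, one_mul]

@[simp] theorem modulate_zero (θ : ℤ → ℝ) (c : ℤ → ℂ) : modulate θ 0 c = c := by
  ext k; simp [modulate]

theorem modulate_sub (θ : ℤ → ℝ) (t : ℝ) (c d : ℤ → ℂ) :
    modulate θ t (c - d) = modulate θ t c - modulate θ t d := by
  ext k; simp [modulate, mul_sub]

theorem modulate_modulate_neg (θ : ℤ → ℝ) (t : ℝ) (c : ℤ → ℂ) :
    modulate θ t (modulate θ (-t) c) = c := by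
  ext k
  simp only [modulate]
  rw [← mul_assoc, ← Complex.exp_add]
  push_cast
  rw [show Complex.I * (↑t * ↑(θ k)) + Complex.I * (-↑t * ↑(θ k)) = 0 by ring, Complex.exp_zero,
    one_mul]

theorem norm_modulate_sub_modulate_le (θ : ℤ → ℝ) (t t₀ : ℝ) (c : ℤ → ℂ) (k : ℤ) :
    ‖(modulate θ t c - modulate θ t₀ c) k‖ ≤ 2 * ‖c k‖ := by
  refine (norm_sub_le _ _).trans (le_of_eq ?_)
  rw [modulate, modulate, norm_mul, norm_mul, norm_exp_I_mul_ofReal, norm_exp_I_mul_ofReal]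
  ring

theorem tendsto_wnorm_modulate_sub {r : ℝ} (θ : ℤ → ℝ) {c : ℤ → ℂ} (hc : wnorm r c < ∞) (t₀ : ℝ) :
    Tendsto (fun t => wnorm r (modulate θ t c - modulate θ t₀ c)) (𝓝 t₀) (𝓝 0) := by
  have hs := (summable_iff_wnorm_lt_top r c).2 hc
  have htsum : Tendsto
      (fun t => ∑' k, bracket k ^ (2 * r) * ‖(modulate θ t c - modulate θ t₀ c) k‖ ^ 2) (𝓝 t₀)
      (𝓝 (∑' _ : ℤ, (0 : ℝ))) := by
    refine tendsto_tsum_of_dominated_convergence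
      (bound := fun k => 4 * (bracket k ^ (2 * r) * ‖c k‖ ^ 2)) (hs.mul_left 4) (fun k => ?_) ?_
    · have hcont : Continuous fun t =>
          bracket k ^ (2 * r) * ‖(modulate θ t c - modulate θ t₀ c) k‖ ^ 2 := by
        simp only [modulate, Pi.sub_apply]
        fun_prop
      simpa using hcont.tendsto t₀
    · refine Eventually.of_forall fun t k => ?_
      rw [Real.norm_of_nonneg (weight_nonneg r k _)]
      have hpos := (bracket_rpow_pos k (2 * r)).le
      calc bracket k ^ (2 * r) * ‖(modulate θ t c - modulate θ t₀ c) k‖ ^ 2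
          ≤ bracket k ^ (2 * r) * (2 * ‖c k‖) ^ 2 := by
            gcongr; exact norm_modulate_sub_modulate_le θ t t₀ c k
        _ = 4 * (bracket k ^ (2 * r) * ‖c k‖ ^ 2) := by ring
  rw [tsum_zero] at htsum
  have hsqrt := ENNReal.tendsto_ofReal ((Real.continuous_sqrt.tendsto 0).comp htsum)
  rw [Real.sqrt_zero, ENNReal.ofReal_zero] at hsqrt
  refine hsqrt.congr fun t => ?_
  rw [Function.comp_apply, sqrt_tsum_eq_wnorm, ENNReal.ofReal_toReal]
  exact (wnorm_sub_lt_top (by rwa [wnorm_modulate]) (by rwa [wnorm_modulate])).ne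

theorem SeqContinuousOn.modulate {r : ℝ} {I : Set ℝ} {c : ℝ → ℤ → ℂ} (θ : ℤ → ℝ)
    (hc : SeqContinuousOn r I c) :
    SeqContinuousOn r I (fun t => FNLS.modulate θ t (c t)) := by
  refine ⟨fun t ht => by rw [wnorm_modulate]; exact hc.1 t ht, fun t₀ ht₀ => ?_⟩
  have hsum := (hc.2 t₀ ht₀).add
    ((tendsto_wnorm_modulate_sub θ (hc.1 t₀ ht₀) t₀).mono_left nhdsWithin_le_nhds)
  rw [add_zero] at hsum
  refine SeqContinuousOn.tendsto_of_le hsum (Eventually.of_forall fun t => ?_)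
  rw [show FNLS.modulate θ t (c t) - FNLS.modulate θ t₀ (c t₀) = FNLS.modulate θ t (c t - c t₀) +
      (FNLS.modulate θ t (c t₀) - FNLS.modulate θ t₀ (c t₀)) by rw [modulate_sub]; abel]
  refine (wnorm_add_le _ _ _).trans ?_
  rw [wnorm_modulate]

theorem SeqContinuousOn.modulate_neg {r : ℝ} {I : Set ℝ} {c : ℝ → ℤ → ℂ} (θ : ℤ → ℝ)
    (hc : SeqContinuousOn r I c) :
    SeqContinuousOn r I (fun t => FNLS.modulate θ (-t) (c t)) := by
  refine (hc.modulate fun k => -θ k).congr fun t _ => ?_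
  ext k; simp [FNLS.modulate]

/-! ### The equation for the Fourier coefficients -/

/-- The Fourier coefficients of `|f|² f` when `c` are those of `f` (see `cubicCoeff_eq`). -/
def cubicSeq (c : ℤ → ℂ) : ℤ → ℂ := trilinear (fun _ _ => 1) c c c

/-- The vector field of the equation, written for the Fourier coefficients as `∂ₜ c = rhs σ α c`. -/
def rhs (σ α : ℝ) (c : ℤ → ℂ) : ℤ → ℂ :=
  fun k => Complex.I * (symbol α k * c k) - Complex.I * (σ * cubicSeq c k)

/-- The family `c` of coefficient sequences solves the equation on the open interval `I` with
values in `H^s`. Unlike `IsSolution`, neither `0 ∈ I` nor an initial value is prescribed. -/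
structure SeqSolution (σ α s : ℝ) (I : Set ℝ) (c : ℝ → ℤ → ℂ) : Prop where
  isOpen : IsOpen I
  ordConnected : I.OrdConnected
  seqContinuousOn : SeqContinuousOn s I c
  hasDerivAt : ∀ t ∈ I, ∀ k, HasDerivAt (fun τ => c τ k) (rhs σ α (c t) k) t

theorem IsSolution.seqSolution {σ α s : ℝ} (hs : 1 / 2 < s) {u₀ : L2} {I : Set ℝ} {u : ℝ → L2}
    (h : IsSolution σ α s u₀ I u) : SeqSolution σ α s I (fun t => coeff (u t)) where
  isOpen := h.isOpen
  ordConnected := h.ordConnected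
  seqContinuousOn := continuousInSobolev_iff.1 h.continuous
  hasDerivAt t ht k := by
    obtain ⟨hdiff, heq⟩ := h.equation t ht k
    refine hdiff.hasDerivAt.congr_deriv ?_
    rw [cubicCoeff_eq hs ((continuousInSobolev_iff.1 h.continuous).1 t ht)] at heq
    rw [rhs, cubicSeq]
    linear_combination (-Complex.I) * heq +
      deriv (fun τ => coeff (u τ) k) t * Complex.I_mul_I

theorem admissible_one {s : ℝ} (hs : 0 ≤ s) (q : ℝ) : Admissible s s q (3 ^ s) fun _ _ => 1 :=
  admissible_of_norm_le_one hs q fun _ _ => by simp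

theorem SeqContinuousOn.cubicSeq {s : ℝ} (hs : 1 / 2 < s) {I : Set ℝ} {c : ℝ → ℤ → ℂ}
    (hc : SeqContinuousOn s I c) : SeqContinuousOn s I (fun t => FNLS.cubicSeq (c t)) :=
  .trilinear hs le_rfl (admissible_one (by linarith) s) hc hc hc

theorem SeqSolution.uIcc_subset {σ α s : ℝ} {I : Set ℝ} {c : ℝ → ℤ → ℂ}
    (h : SeqSolution σ α s I c) {a b : ℝ} (ha : a ∈ I) (hb : b ∈ I) : Set.uIcc a b ⊆ I :=
  h.ordConnected.uIcc_subset ha hb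

/-! ### The quartic form -/

/-- The summand of `quartic a f g h` at `x = (k, (j, l))`. -/
def quarticTerm (a f g h : ℤ → ℂ) (x : ℤ × (ℤ × ℤ)) : ℂ :=
  conj (a x.1) * trilinearTerm (fun _ _ => 1) f g h x.1 x.2

/-- The quartic form `∑ conj (a(k)) f(k - j) conj (g(k - j - l)) h(k - l)`, the sum being over
`k`, `j`, `l`; for four equal entries it is `(1/2π) ∫ |f|⁴`. -/
def quartic (a f g h : ℤ → ℂ) : ℂ := ∑' x, quarticTerm a f g h x

/-- The exchange of the frequencies `k` and `k - j` of a summand of `quartic`. -/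
def swap₀₁ : ℤ × (ℤ × ℤ) ≃ ℤ × (ℤ × ℤ) where
  toFun x := (x.1 - x.2.1, (-x.2.1, x.2.2))
  invFun x := (x.1 - x.2.1, (-x.2.1, x.2.2))
  left_inv x := by ext <;> simp
  right_inv x := by ext <;> simp

/-- The exchange of the frequencies `k` and `k - j - l` of a summand of `quartic`. -/
def swap₀₂ : ℤ × (ℤ × ℤ) ≃ ℤ × (ℤ × ℤ) where
  toFun x := (x.1 - x.2.1 - x.2.2, (-x.2.1, -x.2.2))
  invFun x := (x.1 - x.2.1 - x.2.2, (-x.2.1, -x.2.2))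
  left_inv x := by ext <;> simp; ring
  right_inv x := by ext <;> simp; ring

/-- The exchange of the frequencies `k - j` and `k - l` of a summand of `quartic`. -/
def swap₁₃ : ℤ × (ℤ × ℤ) ≃ ℤ × (ℤ × ℤ) where
  toFun x := (x.1, (x.2.2, x.2.1))
  invFun x := (x.1, (x.2.2, x.2.1))
  left_inv _ := rfl
  right_inv _ := rfl

theorem quarticTerm_swap₀₁ (a f g h : ℤ → ℂ) (x : ℤ × (ℤ × ℤ)) :
    quarticTerm f a h g (swap₀₁ x) = conj (quarticTerm a f g h x) := by
  obtain ⟨k, j, l⟩ := x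
  simp only [quarticTerm, trilinearTerm, swap₀₁, Equiv.coe_fn_mk, map_mul, Complex.conj_conj,
    map_one]
  rw [show k - j - -j = k by ring, show k - l = k - j - -j - l by ring]
  rw [show k - j - -j = k by ring]
  ring

theorem quarticTerm_swap₀₂ (a f g h : ℤ → ℂ) (x : ℤ × (ℤ × ℤ)) :
    quarticTerm g h a f (swap₀₂ x) = quarticTerm a f g h x := by
  obtain ⟨k, j, l⟩ := x
  simp only [quarticTerm, trilinearTerm, swap₀₂, Equiv.coe_fn_mk]
  rw [show k - j - l - -j = k - l by ring, show k - l - -l = k by ring,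
    show k - j - l - -l = k - j by ring]
  ring

theorem quarticTerm_swap₁₃ (a f g h : ℤ → ℂ) (x : ℤ × (ℤ × ℤ)) :
    quarticTerm a h g f (swap₁₃ x) = quarticTerm a f g h x := by
  obtain ⟨k, j, l⟩ := x
  simp only [quarticTerm, trilinearTerm, swap₁₃, Equiv.coe_fn_mk]
  rw [show k - l - j = k - j - l by ring]
  ring

theorem conj_quartic (a f g h : ℤ → ℂ) : conj (quartic a f g h) = quartic f a h g := by
  rw [quartic, quartic, Complex.conj_tsum, ← swap₀₁.tsum_eq (quarticTerm f a h g)]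
  exact tsum_congr fun x => (quarticTerm_swap₀₁ a f g h x).symm

theorem quartic_swap₀₂ (a f g h : ℤ → ℂ) : quartic g h a f = quartic a f g h := by
  rw [quartic, quartic, ← swap₀₂.tsum_eq]
  exact tsum_congr fun x => quarticTerm_swap₀₂ a f g h x

theorem quartic_swap₁₃ (a f g h : ℤ → ℂ) : quartic a h g f = quartic a f g h := by
  rw [quartic, quartic, ← swap₁₃.tsum_eq]
  exact tsum_congr fun x => quarticTerm_swap₁₃ a f g h x

/-- The sum of the absolute values of the summands of `quartic`, which bounds it and decides its
summability. -/
def quarticAbs (a f g h : ℤ → ℂ) : ℝ≥0∞ := ∑' x, ‖quarticTerm a f g h x‖ₑ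

theorem quarticAbs_swap₀₁ (a f g h : ℤ → ℂ) : quarticAbs f a h g = quarticAbs a f g h := by
  rw [quarticAbs, quarticAbs, ← swap₀₁.tsum_eq]
  exact tsum_congr fun x => by rw [quarticTerm_swap₀₁, RCLike.enorm_conj]

theorem quarticAbs_swap₀₂ (a f g h : ℤ → ℂ) : quarticAbs g h a f = quarticAbs a f g h := by
  rw [quarticAbs, quarticAbs, ← swap₀₂.tsum_eq]
  exact tsum_congr fun x => by rw [quarticTerm_swap₀₂]

theorem quarticAbs_swap₁₃ (a f g h : ℤ → ℂ) : quarticAbs a h g f = quarticAbs a f g h := by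
  rw [quarticAbs, quarticAbs, ← swap₁₃.tsum_eq]
  exact tsum_congr fun x => by rw [quarticTerm_swap₁₃]

theorem quarticAbs_eq (a f g h : ℤ → ℂ) :
    quarticAbs a f g h = ∑' k, ‖a k‖ₑ * trilinearAbs (fun _ _ => 1) f g h k := by
  rw [quarticAbs, ENNReal.tsum_prod']
  refine tsum_congr fun k => ?_
  rw [trilinearAbs, ← ENNReal.tsum_mul_left]
  exact tsum_congr fun p => by rw [quarticTerm, enorm_mul, RCLike.enorm_conj]

theorem tsum_mul_le_wnorm (r : ℝ) (a : ℤ → ℂ) (b : ℤ → ℝ≥0∞) :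
    ∑' k, ‖a k‖ₑ * b k ≤ wnorm (-r) a * l2Norm fun k => eweight r k * b k := by
  refine le_trans (le_of_eq ?_) (tsum_mul_le_l2Norm _ _)
  refine tsum_congr fun k => ?_
  calc _ = (eweight (-r) k * eweight r k) * (‖a k‖ₑ * b k) := by rw [eweight_neg_mul, one_mul]
    _ = (eweight (-r) k * ‖a k‖ₑ) * (eweight r k * b k) := by ring

theorem quarticAbs_le {r q : ℝ} (hr : 0 ≤ r) (a f g h : ℤ → ℂ) :
    quarticAbs a f g h ≤ wnorm (-r) a * (trilinearConst q (3 ^ r) * mixedNorm r q f g h) := by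
  rw [quarticAbs_eq]
  exact (tsum_mul_le_wnorm r a _).trans (mul_le_mul_right
    ((admissible_one hr q).l2Norm_trilinearAbs_le f g h) _)

theorem summable_quarticTerm {a f g h : ℤ → ℂ} (H : quarticAbs a f g h < ∞) :
    Summable (quarticTerm a f g h) :=
  Summable.of_norm (tsum_enorm_ne_top_iff_summable_norm.1 H.ne)

theorem hasSum_quartic {a f g h : ℤ → ℂ} (H : quarticAbs a f g h < ∞) :
    HasSum (fun k => conj (a k) * trilinear (fun _ _ => 1) f g h k) (quartic a f g h) := by
  have hs := summable_quarticTerm H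
  refine (hs.hasSum.prod_fiberwise fun k => (hs.prod_factor k).hasSum).congr_fun fun k => ?_
  simp only [quarticTerm, trilinear, tsum_mul_left]

/-! ### Weighted `ℓ²` balance laws -/

theorem tsum_enorm_mul_mul_le {r s : ℝ} (hr : r ≤ s) {w : ℤ → ℝ}
    (hw : ∀ k, |w k| ≤ bracket k ^ (2 * r)) (a b : ℤ → ℂ) :
    ∑' k, ‖(w k : ℂ)‖ₑ * (‖a k‖ₑ * ‖b k‖ₑ) ≤ wnorm s a * wnorm s b := by
  have hwe (k : ℤ) : ‖(w k : ℂ)‖ₑ ≤ eweight r k * eweight r k := by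
    rw [eweight, ← ENNReal.ofReal_mul (bracket_rpow_pos k r).le, ← Real.rpow_add (bracket_pos k),
      ← ofReal_norm, Complex.norm_real, Real.norm_eq_abs, ← two_mul]
    exact ENNReal.ofReal_le_ofReal (hw k)
  calc ∑' k, ‖(w k : ℂ)‖ₑ * (‖a k‖ₑ * ‖b k‖ₑ)
      ≤ ∑' k, eweight r k * ‖a k‖ₑ * (eweight r k * ‖b k‖ₑ) :=
        ENNReal.tsum_le_tsum fun k =>
          (mul_le_mul_left (hwe k) _).trans (le_of_eq (mul_mul_mul_comm _ _ _ _))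
    _ ≤ wnorm r a * wnorm r b := tsum_mul_le_l2Norm _ _
    _ ≤ wnorm s a * wnorm s b := mul_le_mul' (wnorm_mono_exp hr a) (wnorm_mono_exp hr b)

theorem summable_weight_mul_mul_conj {r s : ℝ} (hr : r ≤ s) {w : ℤ → ℝ}
    (hw : ∀ k, |w k| ≤ bracket k ^ (2 * r)) {a : ℤ → ℂ} (ha : wnorm s a < ∞) :
    Summable fun k => (w k : ℂ) * (a k * conj (a k)) := by
  refine Summable.of_norm (tsum_enorm_ne_top_iff_summable_norm.1 (ne_of_lt ?_))
  refine lt_of_le_of_lt (le_of_eq ?_)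
    ((tsum_enorm_mul_mul_le hr hw a a).trans_lt (ENNReal.mul_lt_top ha ha))
  exact tsum_congr fun k => by rw [enorm_mul, enorm_mul, RCLike.enorm_conj]

theorem enorm_mul_sub_conj_le (σ w : ℝ) (x y : ℂ) :
    ‖(w : ℂ) * (-(Complex.I * σ) * (conj x * y - conj (conj x * y)))‖ₑ ≤
      2 * ‖(σ : ℂ)‖ₑ * (‖(w : ℂ)‖ₑ * (‖x‖ₑ * ‖y‖ₑ)) := by
  have hI : ‖Complex.I‖ₑ = 1 := by rw [← ofReal_norm, Complex.norm_I, ENNReal.ofReal_one]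
  have hsub := enorm_sub_le (a := conj x * y) (b := conj (conj x * y))
  rw [RCLike.enorm_conj, enorm_mul, RCLike.enorm_conj] at hsub
  rw [enorm_mul, enorm_mul, enorm_neg, enorm_mul, hI]
  refine (mul_le_mul_right (mul_le_mul_right hsub _) _).trans (le_of_eq ?_)
  ring

/-- The linear part of the equation drops out of the derivative of `|c(k)|²`. -/
theorem SeqSolution.hasDerivAt_mul_conj {σ α s : ℝ} {I : Set ℝ} {c : ℝ → ℤ → ℂ}
    (h : SeqSolution σ α s I c) {t : ℝ} (ht : t ∈ I) (k : ℤ) :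
    HasDerivAt (fun τ => c τ k * conj (c τ k))
      (-(Complex.I * σ) *
        (conj (c t k) * cubicSeq (c t) k - conj (conj (c t k) * cubicSeq (c t) k))) t := by
  have hd := h.hasDerivAt t ht k
  refine (hd.mul hd.star).congr_deriv ?_
  simp only [rhs, Complex.star_def, map_sub, map_mul, Complex.conj_I, Complex.conj_ofReal,
    Complex.conj_conj]
  ring

theorem SeqSolution.weighted_balance {σ α s r : ℝ} (hs : 1 / 2 < s) (hr : r ≤ s)
    {w : ℤ → ℝ} (hw : ∀ k, |w k| ≤ bracket k ^ (2 * r)) {I : Set ℝ}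
    {c : ℝ → ℤ → ℂ} (h : SeqSolution σ α s I c) {t₀ t : ℝ} (ht₀ : t₀ ∈ I) (ht : t ∈ I) :
    ∑' k, (w k : ℂ) * (c t k * conj (c t k)) - ∑' k, (w k : ℂ) * (c t₀ k * conj (c t₀ k)) =
      ∫ τ in t₀..t, ∑' k, (w k : ℂ) * (-(Complex.I * σ) *
        (conj (c τ k) * cubicSeq (c τ) k - conj (conj (c τ k) * cubicSeq (c τ) k))) := by
  have hsub := h.uIcc_subset ht₀ ht
  have hcubic := h.seqContinuousOn.cubicSeq hs
  obtain ⟨K, hK⟩ := h.seqContinuousOn.bounded_on_uIcc hsub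
  obtain ⟨K', hK'⟩ := hcubic.bounded_on_uIcc hsub
  refine tsum_sub_tsum_eq_integral (C := 2 * ‖(σ : ℂ)‖ₑ * (ENNReal.ofReal K * ENNReal.ofReal K'))
    (f := fun k τ => (w k : ℂ) * (c τ k * conj (c τ k)))
    (fun k τ hτ => (h.hasDerivAt_mul_conj (hsub hτ) k).const_mul _)
    (fun k => ?_) ?_ (fun τ hτ => ?_)
    (summable_weight_mul_mul_conj hr hw (h.seqContinuousOn.1 t₀ ht₀))
    (summable_weight_mul_mul_conj hr hw (h.seqContinuousOn.1 t ht))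
  · have hprod : ContinuousOn (fun τ => conj (c τ k) * cubicSeq (c τ) k) (Set.uIcc t₀ t) :=
      (Complex.continuous_conj.comp_continuousOn ((h.seqContinuousOn.coeff k).mono hsub)).mul
        ((hcubic.coeff k).mono hsub)
    exact continuousOn_const.mul (continuousOn_const.mul
      (hprod.sub (Complex.continuous_conj.comp_continuousOn hprod)))
  · exact ENNReal.mul_lt_top (ENNReal.mul_lt_top (by norm_num) enorm_lt_top)
      (ENNReal.mul_lt_top ENNReal.ofReal_lt_top ENNReal.ofReal_lt_top)
  · calc _ ≤ ∑' k, 2 * ‖(σ : ℂ)‖ₑ * (‖(w k : ℂ)‖ₑ * (‖c τ k‖ₑ * ‖cubicSeq (c τ) k‖ₑ)) :=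
          ENNReal.tsum_le_tsum fun k => enorm_mul_sub_conj_le σ (w k) _ _
      _ = 2 * ‖(σ : ℂ)‖ₑ * ∑' k, ‖(w k : ℂ)‖ₑ * (‖c τ k‖ₑ * ‖cubicSeq (c τ) k‖ₑ) :=
          ENNReal.tsum_mul_left
      _ ≤ _ := mul_le_mul_right ((tsum_enorm_mul_mul_le hr hw _ _).trans
          (mul_le_mul' (hK τ hτ) (hK' τ hτ))) _

theorem quarticAbs_lt_top {s : ℝ} (hs : 1 / 2 < s) {c : ℤ → ℂ} (hc : wnorm s c < ∞) :
    quarticAbs c c c c < ∞ := by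
  refine (quarticAbs_le (r := s) (q := s) (by linarith) c c c c).trans_lt (ENNReal.mul_lt_top ?_ ?_)
  · exact (wnorm_mono_exp (by linarith) c).trans_lt hc
  · refine ENNReal.mul_lt_top (trilinearConst_lt_top hs _) ((mixedNorm_le le_rfl c c c).trans_lt ?_)
    exact ENNReal.mul_lt_top (by norm_num) (ENNReal.mul_lt_top hc (ENNReal.mul_lt_top hc hc))

theorem SeqSolution.mass_eq {σ α s : ℝ} (hs : 1 / 2 < s) {I : Set ℝ} {c : ℝ → ℤ → ℂ}
    (h : SeqSolution σ α s I c) {t₀ t : ℝ} (ht₀ : t₀ ∈ I) (ht : t ∈ I) :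
    ∑' k, ‖c t k‖ ^ 2 = ∑' k, ‖c t₀ k‖ ^ 2 := by
  have hbalance :=
    h.weighted_balance (r := 0) hs (by linarith) (w := fun _ => 1) (by simp) ht₀ ht
  have hzero : ∀ τ ∈ Set.uIcc t₀ t, ∑' k, ((1 : ℝ) : ℂ) * (-(Complex.I * σ) *
      (conj (c τ k) * cubicSeq (c τ) k - conj (conj (c τ k) * cubicSeq (c τ) k))) = 0 := by
    intro τ hτ
    have hquartic :=
      hasSum_quartic (quarticAbs_lt_top hs (h.seqContinuousOn.1 τ (h.uIcc_subset ht₀ ht hτ)))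
    have him := ((hquartic.sub (Complex.hasSum_conj'.2 hquartic)).mul_left
      (-(Complex.I * σ))).tsum_eq
    rw [conj_quartic, sub_self, mul_zero] at him
    simp only [Complex.ofReal_one, one_mul]
    exact him
  rw [intervalIntegral.integral_congr (g := fun _ => 0) hzero, intervalIntegral.integral_zero,
    sub_eq_zero] at hbalance
  simp only [Complex.ofReal_one, one_mul, Complex.mul_conj'] at hbalance
  exact_mod_cast hbalance

/-! ### Decomposition of the nonlinearity -/

theorem tsum_norm_sq_sub_left (c : ℤ → ℂ) (k : ℤ) :
    ∑' j, ‖c (k - j)‖ ^ 2 = ∑' j, ‖c j‖ ^ 2 :=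
  (Equiv.subLeft k).tsum_eq fun j => ‖c j‖ ^ 2

theorem trilinear_snd_eq_zero (c : ℤ → ℂ) (k : ℤ) :
    trilinear (fun _ p => if p.2 = 0 then 1 else 0) c c c k = (∑' j, ‖c j‖ ^ 2 : ℝ) * c k := by
  have hinj : Function.Injective fun j : ℤ => (j, (0 : ℤ)) := fun a b h => (Prod.mk.inj h).1
  rw [trilinear, ← hinj.tsum_eq, ← tsum_norm_sq_sub_left c k, Complex.ofReal_tsum, ← tsum_mul_right]
  · refine tsum_congr fun j => ?_
    simp only [trilinearTerm, sub_zero, if_true, one_mul, Complex.ofReal_pow]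
    rw [← mul_assoc, Complex.mul_conj']
  · intro p hp
    by_contra h
    refine hp ?_
    have hp2 : p.2 ≠ 0 := fun hp2 => h ⟨p.1, by rw [← hp2]⟩
    simp [trilinearTerm, hp2]

theorem trilinear_fst_eq_zero (c : ℤ → ℂ) (k : ℤ) :
    trilinear (fun _ p => if p.1 = 0 then 1 else 0) c c c k = (∑' j, ‖c j‖ ^ 2 : ℝ) * c k := by
  rw [← trilinear_snd_eq_zero, trilinear, trilinear, ← (Equiv.prodComm ℤ ℤ).tsum_eq]
  refine tsum_congr fun p => ?_
  change (if p.2 = 0 then (1 : ℂ) else 0) *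
      (c (k - p.2) * (conj (c (k - p.2 - p.1)) * c (k - p.1))) =
    (if p.2 = 0 then 1 else 0) * (c (k - p.1) * (conj (c (k - p.1 - p.2)) * c (k - p.2)))
  rw [show k - p.2 - p.1 = k - p.1 - p.2 by ring]
  ring

theorem cubicSeq_eq {s : ℝ} (hs : 1 / 2 < s) {c : ℤ → ℂ} (hc : wnorm s c < ∞) (k : ℤ) :
    cubicSeq c k = (2 * ∑' j, ‖c j‖ ^ 2 : ℝ) * c k +
      (trilinear nonres c c c k - trilinear diagRes c c c k) := by
  have hsum {m : ℤ → ℤ × ℤ → ℂ} (hm : ∀ k p, ‖m k p‖ ≤ 1) : Summable (trilinearTerm m c c c k) :=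
    (admissible_of_norm_le_one (by linarith) s hm).summable_trilinearTerm hs le_rfl hc hc hc k
  have hfst : Summable (trilinearTerm (fun _ p => if p.1 = 0 then 1 else 0) c c c k) :=
    hsum fun _ p => by split_ifs <;> simp
  have hsnd : Summable (trilinearTerm (fun _ p => if p.2 = 0 then 1 else 0) c c c k) :=
    hsum fun _ p => by split_ifs <;> simp
  have hnonres := hsum norm_nonres_le_one
  have hdiag := hsum norm_diagRes_le_one
  have hmass : ((2 * ∑' j, ‖c j‖ ^ 2 : ℝ) : ℂ) * c k =
      trilinear (fun _ p => if p.1 = 0 then 1 else 0) c c c k +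
        trilinear (fun _ p => if p.2 = 0 then 1 else 0) c c c k := by
    rw [trilinear_fst_eq_zero, trilinear_snd_eq_zero]; push_cast; ring
  rw [hmass]
  simp only [cubicSeq, trilinear]
  rw [← hfst.tsum_add hsnd, ← hnonres.tsum_sub hdiag,
    ← (hfst.add hsnd).tsum_add (hnonres.sub hdiag)]
  refine tsum_congr fun p => ?_
  simp only [trilinearTerm, nonres, diagRes]
  by_cases hj : p.1 = 0 <;> by_cases hl : p.2 = 0 <;> simp [hj, hl]

/-- The part of the nonlinearity which the mean-field phase `exp (-iσPt)` does not absorb. -/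
def forcing (σ : ℝ) (c : ℤ → ℂ) : ℤ → ℂ :=
  (-(Complex.I * σ)) • (trilinear nonres c c c - trilinear diagRes c c c)

/-- The summand of index `p = (j, l)` of `trilinearDeriv`. -/
def trilinearDerivTerm (m : ℤ → ℤ × ℤ → ℂ) (c x : ℤ → ℂ) (k : ℤ) (p : ℤ × ℤ) : ℂ :=
  trilinearTerm m x c c k p + trilinearTerm m c x c k p + trilinearTerm m c c x k p

/-- The derivative at `c` in the direction `x` of the cubic map `c ↦ trilinear m c c c`. -/
def trilinearDeriv (m : ℤ → ℤ × ℤ → ℂ) (c x : ℤ → ℂ) : ℤ → ℂ :=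
  trilinear m x c c + trilinear m c x c + trilinear m c c x

/-- The integrand left over by the normal form transformation: the resonant term together with a
quintic term. -/
def remainder (σ α : ℝ) (c : ℤ → ℂ) : ℤ → ℂ :=
  (Complex.I * σ) • trilinear diagRes c c c -
    (σ : ℂ) • trilinearDeriv (normalForm α) c (forcing σ c)

theorem Admissible.hasSum_trilinearDeriv {r s q A : ℝ} {m : ℤ → ℤ × ℤ → ℂ}
    (hm : Admissible r s q A m) (hq : 1 / 2 < q) (hqs : q ≤ s) {c x : ℤ → ℂ}
    (hc : wnorm s c < ∞) (hx : wnorm s x < ∞) (k : ℤ) :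
    HasSum (trilinearDerivTerm m c x k) (trilinearDeriv m c x k) :=
  ((hm.summable_trilinearTerm hq hqs hx hc hc k).hasSum.add
    (hm.summable_trilinearTerm hq hqs hc hx hc k).hasSum).add
      (hm.summable_trilinearTerm hq hqs hc hc hx k).hasSum

theorem Admissible.wnorm_trilinearDeriv_le {r s q A : ℝ} {m : ℤ → ℤ × ℤ → ℂ}
    (hm : Admissible r s q A m) (c x : ℤ → ℂ) :
    wnorm r (trilinearDeriv m c x) ≤ 3 * trilinearConst q A *
      (wnorm s x * wnorm q c ^ 2 + 2 * (wnorm s c * (wnorm q c * wnorm q x))) := by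
  calc wnorm r (trilinearDeriv m c x)
      ≤ wnorm r (trilinear m x c c) + wnorm r (trilinear m c x c) +
          wnorm r (trilinear m c c x) :=
        (wnorm_add_le _ _ _).trans (add_le_add (wnorm_add_le _ _ _) le_rfl)
    _ ≤ trilinearConst q A * mixedNorm s q x c c + trilinearConst q A * mixedNorm s q c x c +
          trilinearConst q A * mixedNorm s q c c x :=
        add_le_add (add_le_add (hm.wnorm_trilinear_le _ _ _) (hm.wnorm_trilinear_le _ _ _))
          (hm.wnorm_trilinear_le _ _ _)
    _ = _ := by simp only [mixedNorm]; ring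

theorem enorm_I : ‖Complex.I‖ₑ = 1 := by rw [← ofReal_norm, Complex.norm_I, ENNReal.ofReal_one]

theorem wnorm_forcing_le {r : ℝ} (hr : 0 ≤ r) (σ q : ℝ) (c : ℤ → ℂ) :
    wnorm r (forcing σ c) ≤
      ‖(σ : ℂ)‖ₑ * (6 * trilinearConst q (3 ^ r) * (wnorm r c * wnorm q c ^ 2)) := by
  rw [forcing, wnorm_smul, enorm_neg, enorm_mul, enorm_I, one_mul]
  have hnonres := (admissible_of_norm_le_one hr q norm_nonres_le_one).wnorm_trilinear_le c c c
  have hdiag := (admissible_of_norm_le_one hr q norm_diagRes_le_one).wnorm_trilinear_le c c c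
  refine mul_le_mul_right ((wnorm_sub_le _ _ _).trans
    ((add_le_add hnonres hdiag).trans (le_of_eq ?_))) _
  rw [mixedNorm_self]; ring

theorem wnorm_trilinearDeriv_forcing_le {r s q A : ℝ} {m : ℤ → ℤ × ℤ → ℂ}
    (hm : Admissible r s q A m) (hs : 0 ≤ s) (hq : 0 ≤ q) (σ : ℝ) (c : ℤ → ℂ) :
    wnorm r (trilinearDeriv m c (forcing σ c)) ≤
      ‖(σ : ℂ)‖ₑ * (18 * trilinearConst q A *
        (trilinearConst q (3 ^ s) + 2 * trilinearConst q (3 ^ q)) *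
          (wnorm s c * wnorm q c ^ 4)) := by
  refine (hm.wnorm_trilinearDeriv_le c _).trans ((mul_le_mul_right (add_le_add
    (mul_le_mul_left (wnorm_forcing_le hs σ q c) _) (mul_le_mul_right (mul_le_mul_right
      (mul_le_mul_right (wnorm_forcing_le hq σ q c) _) _) _)) _).trans (le_of_eq ?_))
  ring

theorem wnorm_remainder_le {α r s q : ℝ} (hα : 1 / 2 < α) (hα' : α ≤ 1) (hq : 1 / 2 < q)
    (hqs : q ≤ s) (hr : r ≤ s + (2 * α - 1)) (Λ : ℝ) :
    ∃ C : ℝ≥0∞, C < ∞ ∧ ∀ σ : ℝ, |σ| ≤ Λ → ∀ c : ℤ → ℂ,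
      wnorm r (remainder σ α c) ≤ C * (wnorm s c * (wnorm q c ^ 2 + wnorm q c ^ 4)) := by
  have hs : 0 ≤ s := by linarith
  have hnf := admissible_normalForm hα hα' hs hq.le hr
  have hdiag : Admissible r s q 1 diagRes := admissible_diagRes hq.le (by linarith)
  let L := ENNReal.ofReal Λ
  let D := 3 * trilinearConst q 1
  let E := 18 * trilinearConst q (normalFormConst α s q) *
    (trilinearConst q (3 ^ s) + 2 * trilinearConst q (3 ^ q))
  have hT := trilinearConst_lt_top hq
  have hD : D < ∞ := ENNReal.mul_lt_top (by norm_num) (hT _)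
  have hE : E < ∞ := ENNReal.mul_lt_top (ENNReal.mul_lt_top (by norm_num) (hT _))
    (ENNReal.add_lt_top.2 ⟨hT _, ENNReal.mul_lt_top (by norm_num) (hT _)⟩)
  have hL : L < ∞ := ENNReal.ofReal_lt_top
  refine ⟨L * D + L * (L * E), ENNReal.add_lt_top.2 ⟨ENNReal.mul_lt_top hL hD,
    ENNReal.mul_lt_top hL (ENNReal.mul_lt_top hL hE)⟩, fun σ hσ c => ?_⟩
  have hσL : ‖(σ : ℂ)‖ₑ ≤ L := by
    rw [← ofReal_norm, Complex.norm_real]; exact ENNReal.ofReal_le_ofReal hσ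
  calc wnorm r (remainder σ α c)
      ≤ ‖(σ : ℂ)‖ₑ * wnorm r (trilinear diagRes c c c) +
          ‖(σ : ℂ)‖ₑ * wnorm r (trilinearDeriv (normalForm α) c (forcing σ c)) := by
        refine (wnorm_sub_le _ _ _).trans_eq ?_
        rw [wnorm_smul, wnorm_smul, enorm_mul, enorm_I, one_mul]
    _ ≤ L * (D * (wnorm s c * wnorm q c ^ 2)) + L * (L * (E * (wnorm s c * wnorm q c ^ 4))) := by
        have hcubic := hdiag.wnorm_trilinear_le c c c
        rw [mixedNorm_self, mul_left_comm, ← mul_assoc] at hcubic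
        have hquintic := wnorm_trilinearDeriv_forcing_le hnf hs (by linarith) σ c
        exact add_le_add (mul_le_mul' hσL hcubic)
          (mul_le_mul' hσL (hquintic.trans (mul_le_mul_left hσL _)))
    _ = L * D * (wnorm s c * wnorm q c ^ 2) + L * (L * E) * (wnorm s c * wnorm q c ^ 4) := by ring
    _ ≤ (L * D + L * (L * E)) * (wnorm s c * wnorm q c ^ 2) +
          (L * D + L * (L * E)) * (wnorm s c * wnorm q c ^ 4) :=
        add_le_add (mul_le_mul_left le_self_add _) (mul_le_mul_left le_add_self _)
    _ = _ := by ring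

/-! ### The normal form transformation -/

/-- The dispersion relation of the solution with the mean-field phase `exp (-iσPt)` removed. -/
def shiftedSymbol (σ α P : ℝ) (k : ℤ) : ℝ := symbol α k - σ * P

theorem resonance_shiftedSymbol (σ α P : ℝ) (k : ℤ) (p : ℤ × ℤ) :
    shiftedSymbol σ α P k - shiftedSymbol σ α P (k - p.1) + shiftedSymbol σ α P (k - p.1 - p.2) -
      shiftedSymbol σ α P (k - p.2) = resonance α k p := by
  simp only [shiftedSymbol, resonance]; ring

theorem rhs_eq {σ α s P : ℝ} (hs : 1 / 2 < s) {c : ℤ → ℂ} (hc : wnorm s c < ∞)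
    (hP : P = 2 * ∑' j, ‖c j‖ ^ 2) (k : ℤ) :
    rhs σ α c k = Complex.I * (shiftedSymbol σ α P k * c k) + forcing σ c k := by
  rw [rhs, cubicSeq_eq hs hc, ← hP, forcing, shiftedSymbol]
  simp only [Pi.smul_apply, Pi.sub_apply, smul_eq_mul]
  push_cast
  ring

theorem resonance_mul_normalForm {α : ℝ} (hα : 1 / 2 < α) (hα' : α ≤ 1) (k : ℤ) (p : ℤ × ℤ) :
    (resonance α k p : ℂ) * normalForm α k p = nonres k p := by
  rw [normalForm, nonres]
  split_ifs with h
  · exact mul_zero _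
  · rw [not_or] at h
    exact mul_inv_cancel₀ (by exact_mod_cast resonance_ne_zero hα hα' h.1 h.2)

/-- The summand of index `p = (j, l)` of `normalFormDeriv`. -/
def normalFormDerivTerm (σ α : ℝ) (c : ℤ → ℂ) (k : ℤ) (p : ℤ × ℤ) : ℂ :=
  -Complex.I * trilinearTerm nonres c c c k p +
    trilinearDerivTerm (normalForm α) c (forcing σ c) k p

/-- The time derivative of `trilinear (normalForm α) c c c` along the flow, computed in the
interaction picture, where the linear evolution acts by the resonance function only. -/
def normalFormDeriv (σ α : ℝ) (c : ℤ → ℂ) : ℤ → ℂ :=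
  -Complex.I • trilinear nonres c c c + trilinearDeriv (normalForm α) c (forcing σ c)

theorem remainder_eq (σ α : ℝ) (c : ℤ → ℂ) :
    remainder σ α c = forcing σ c - (σ : ℂ) • normalFormDeriv σ α c := by
  ext k
  simp only [remainder, normalFormDeriv, Pi.sub_apply, Pi.add_apply, Pi.smul_apply, smul_eq_mul]
  rw [show forcing σ c k = -(Complex.I * σ) *
    (trilinear nonres c c c k - trilinear diagRes c c c k) from rfl]
  ring

theorem admissible_normalForm_self {α s : ℝ} (hα : 1 / 2 < α) (hα' : α ≤ 1) (hs : 1 / 2 < s) :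
    Admissible s s s (normalFormConst α s s) (normalForm α) :=
  admissible_normalForm hα hα' (by linarith) hs.le (by linarith)

theorem admissible_nonres {s : ℝ} (hs : 0 ≤ s) : Admissible s s s (3 ^ s) nonres :=
  admissible_of_norm_le_one hs s norm_nonres_le_one

theorem wnorm_forcing_lt_top {s : ℝ} (hs : 1 / 2 < s) (σ : ℝ) {c : ℤ → ℂ} (hc : wnorm s c < ∞) :
    wnorm s (forcing σ c) < ∞ :=
  (wnorm_forcing_le (by linarith) σ s c).trans_lt (ENNReal.mul_lt_top enorm_lt_top
    (ENNReal.mul_lt_top (ENNReal.mul_lt_top (by norm_num) (trilinearConst_lt_top hs _))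
      (ENNReal.mul_lt_top hc (ENNReal.pow_lt_top hc))))

theorem hasSum_normalFormDeriv {α s : ℝ} (hα : 1 / 2 < α) (hα' : α ≤ 1) (hs : 1 / 2 < s) (σ : ℝ)
    {c : ℤ → ℂ} (hc : wnorm s c < ∞) (k : ℤ) :
    HasSum (normalFormDerivTerm σ α c k) (normalFormDeriv σ α c k) := by
  have hnonres := (admissible_nonres (s := s) (by linarith)).summable_trilinearTerm hs le_rfl
    hc hc hc k
  exact (hnonres.hasSum.mul_left (-Complex.I)).add
    ((admissible_normalForm_self hα hα' hs).hasSum_trilinearDeriv hs le_rfl hc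
      (wnorm_forcing_lt_top hs σ hc) k)

theorem hasDerivAt_modulate_neg (θ : ℤ → ℝ) {f : ℝ → ℤ → ℂ} {f' : ℤ → ℂ} {t : ℝ} {k : ℤ}
    (hf : HasDerivAt (fun τ => f τ k) (f' k) t) :
    HasDerivAt (fun τ => modulate θ (-τ) (f τ) k)
      (modulate θ (-t) (fun n => f' n - Complex.I * (θ n * f t n)) k) t := by
  have hphase : HasDerivAt (fun τ : ℝ => Complex.I * ((-τ * θ k : ℝ) : ℂ))
      (Complex.I * ((-1 * θ k : ℝ) : ℂ)) t :=
    ((hasDerivAt_id t).neg.mul_const (θ k)).ofReal_comp.const_mul Complex.I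
  refine (hphase.cexp.mul hf).congr_deriv ?_
  simp only [modulate]
  push_cast
  ring

theorem enorm_modulate (θ : ℤ → ℝ) (t : ℝ) (c : ℤ → ℂ) (k : ℤ) :
    ‖modulate θ t c k‖ₑ = ‖c k‖ₑ := by
  rw [modulate, enorm_mul, ← ofReal_norm, norm_exp_I_mul_ofReal, ENNReal.ofReal_one, one_mul]

theorem hasSum_modulate {ι : Type*} (θ : ℤ → ℝ) (t : ℝ) {f : ℤ → ι → ℂ} {c : ℤ → ℂ} {k : ℤ}
    (hf : HasSum (f k) (c k)) :
    HasSum (fun i => modulate θ t (fun n => f n i) k) (modulate θ t c k) :=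
  hf.mul_left _

theorem tsum_enorm_normalFormDerivTerm_le (σ α : ℝ) (c : ℤ → ℂ) (k : ℤ) :
    ∑' p, ‖normalFormDerivTerm σ α c k p‖ₑ ≤ trilinearAbs nonres c c c k +
      (trilinearAbs (normalForm α) (forcing σ c) c c k +
        trilinearAbs (normalForm α) c (forcing σ c) c k +
        trilinearAbs (normalForm α) c c (forcing σ c) k) := by
  simp only [trilinearAbs]
  rw [← ENNReal.tsum_add, ← ENNReal.tsum_add, ← ENNReal.tsum_add]
  refine ENNReal.tsum_le_tsum fun p => (enorm_add_le _ _).trans (add_le_add (le_of_eq ?_)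
    ((enorm_add_le _ _).trans (add_le_add (enorm_add_le _ _) le_rfl)))
  rw [enorm_mul, enorm_neg, enorm_I, one_mul]

section Continuity

variable {r s q A : ℝ} {I : Set ℝ} {m : ℤ → ℤ × ℤ → ℂ} {f g h c x : ℝ → ℤ → ℂ}

theorem SeqContinuousOn.trilinearDeriv (hq : 1 / 2 < q) (hqs : q ≤ s) (hm : Admissible r s q A m)
    (hc : SeqContinuousOn s I c) (hx : SeqContinuousOn s I x) :
    SeqContinuousOn r I (fun t => FNLS.trilinearDeriv m (c t) (x t)) :=
  ((SeqContinuousOn.trilinear hq hqs hm hx hc hc).add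
    (SeqContinuousOn.trilinear hq hqs hm hc hx hc)).add
      (SeqContinuousOn.trilinear hq hqs hm hc hc hx)

theorem SeqContinuousOn.forcing (hs : 1 / 2 < s) (hc : SeqContinuousOn s I c) (σ : ℝ) :
    SeqContinuousOn s I (fun t => FNLS.forcing σ (c t)) := by
  have hs₀ : 0 ≤ s := by linarith
  have hnonres := admissible_of_norm_le_one hs₀ s norm_nonres_le_one
  have hdiag := admissible_of_norm_le_one hs₀ s norm_diagRes_le_one
  exact ((SeqContinuousOn.trilinear hs le_rfl hnonres hc hc hc).sub
    (SeqContinuousOn.trilinear hs le_rfl hdiag hc hc hc)).smul _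

theorem SeqContinuousOn.remainder {α : ℝ} (hα : 1 / 2 < α) (hα' : α ≤ 1) (hs : 1 / 2 < s)
    (hr : r ≤ s + (2 * α - 1)) (hc : SeqContinuousOn s I c) (σ : ℝ) :
    SeqContinuousOn r I (fun t => FNLS.remainder σ α (c t)) := by
  have hdiag : Admissible r s s 1 diagRes := admissible_diagRes hs.le (by linarith)
  have hnf := admissible_normalForm hα hα' (by linarith) hs.le hr
  exact ((SeqContinuousOn.trilinear hs le_rfl hdiag hc hc hc).smul _).sub
    ((SeqContinuousOn.trilinearDeriv hs le_rfl hnf hc (hc.forcing hs σ)).smul _)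

theorem SeqContinuousOn.trilinearTerm (hf : SeqContinuousOn s I f) (hg : SeqContinuousOn s I g)
    (hh : SeqContinuousOn s I h) (m : ℤ → ℤ × ℤ → ℂ) (k : ℤ) (p : ℤ × ℤ) :
    ContinuousOn (fun t => FNLS.trilinearTerm m (f t) (g t) (h t) k p) I :=
  continuousOn_const.mul ((hf.coeff _).mul
    ((Complex.continuous_conj.comp_continuousOn (hg.coeff _)).mul (hh.coeff _)))

theorem Admissible.trilinearAbs_bounded (hq : 1 / 2 < q) (hqs : q ≤ s) (hm : Admissible r s q A m)
    (hf : SeqContinuousOn s I f) (hg : SeqContinuousOn s I g) (hh : SeqContinuousOn s I h)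
    {a b : ℝ} (hab : Set.uIcc a b ⊆ I) (k : ℤ) :
    ∃ C : ℝ≥0∞, C < ∞ ∧ ∀ t ∈ Set.uIcc a b, trilinearAbs m (f t) (g t) (h t) k ≤ C := by
  obtain ⟨F, hF⟩ := hf.bounded_on_uIcc hab
  obtain ⟨G, hG⟩ := hg.bounded_on_uIcc hab
  obtain ⟨H, hH⟩ := hh.bounded_on_uIcc hab
  refine ⟨eweight (-r) k * (trilinearConst q A * (3 * (ENNReal.ofReal F *
    (ENNReal.ofReal G * ENNReal.ofReal H)))), ?_, fun t ht => ?_⟩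
  · exact ENNReal.mul_lt_top ENNReal.ofReal_lt_top (ENNReal.mul_lt_top (trilinearConst_lt_top hq _)
      (ENNReal.mul_lt_top (by norm_num) (ENNReal.mul_lt_top ENNReal.ofReal_lt_top
        (ENNReal.mul_lt_top ENNReal.ofReal_lt_top ENNReal.ofReal_lt_top))))
  · refine (hm.trilinearAbs_le _ _ _ k).trans (mul_le_mul_right (mul_le_mul_right
      ((mixedNorm_le hqs (f t) (g t) (h t)).trans (mul_le_mul_right ?_ _)) _) _)
    exact mul_le_mul' (hF t ht) (mul_le_mul' (hG t ht) (hH t ht))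

end Continuity

section NormalForm

variable {σ α s P : ℝ} {I : Set ℝ} {c : ℝ → ℤ → ℂ}

theorem SeqContinuousOn.normalFormDeriv (hα : 1 / 2 < α) (hα' : α ≤ 1) (hs : 1 / 2 < s)
    (hc : SeqContinuousOn s I c) (σ : ℝ) :
    SeqContinuousOn s I (fun t => FNLS.normalFormDeriv σ α (c t)) :=
  ((SeqContinuousOn.trilinear hs le_rfl (admissible_nonres (by linarith)) hc hc hc).smul _).add
    (SeqContinuousOn.trilinearDeriv hs le_rfl (admissible_normalForm_self hα hα' hs) hc
      (hc.forcing hs σ))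

theorem SeqContinuousOn.normalFormDerivTerm (hs : 1 / 2 < s) (hc : SeqContinuousOn s I c)
    (σ α : ℝ) (k : ℤ) (p : ℤ × ℤ) :
    ContinuousOn (fun t => FNLS.normalFormDerivTerm σ α (c t) k p) I := by
  have hx := hc.forcing hs σ
  exact (continuousOn_const.mul (hc.trilinearTerm hc hc nonres k p)).add
    (((hx.trilinearTerm hc hc (normalForm α) k p).add
      (hc.trilinearTerm hx hc (normalForm α) k p)).add
        (hc.trilinearTerm hc hx (normalForm α) k p))

theorem SeqContinuousOn.tsum_normalFormDerivTerm_bounded (hα : 1 / 2 < α) (hα' : α ≤ 1)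
    (hs : 1 / 2 < s) (hc : SeqContinuousOn s I c) (σ : ℝ) {a b : ℝ} (hab : Set.uIcc a b ⊆ I)
    (k : ℤ) : ∃ C : ℝ≥0∞, C < ∞ ∧
      ∀ t ∈ Set.uIcc a b, ∑' p, ‖FNLS.normalFormDerivTerm σ α (c t) k p‖ₑ ≤ C := by
  have hx := hc.forcing hs σ
  have hnonres := admissible_nonres (s := s) (by linarith)
  have hnf := admissible_normalForm_self hα hα' hs
  obtain ⟨C₀, hC₀, hb₀⟩ := hnonres.trilinearAbs_bounded hs le_rfl hc hc hc hab k
  obtain ⟨C₁, hC₁, hb₁⟩ := hnf.trilinearAbs_bounded hs le_rfl hx hc hc hab k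
  obtain ⟨C₂, hC₂, hb₂⟩ := hnf.trilinearAbs_bounded hs le_rfl hc hx hc hab k
  obtain ⟨C₃, hC₃, hb₃⟩ := hnf.trilinearAbs_bounded hs le_rfl hc hc hx hab k
  exact ⟨C₀ + (C₁ + C₂ + C₃), by simp [hC₀, hC₁, hC₂, hC₃], fun t ht =>
    (tsum_enorm_normalFormDerivTerm_le σ α (c t) k).trans (add_le_add (hb₀ t ht)
      (add_le_add (add_le_add (hb₁ t ht) (hb₂ t ht)) (hb₃ t ht)))⟩

theorem SeqSolution.hasDerivAt_trilinearTerm_normalForm (hα : 1 / 2 < α) (hα' : α ≤ 1)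
    (hs : 1 / 2 < s) (h : SeqSolution σ α s I c) {t : ℝ} (ht : t ∈ I)
    (hP : P = 2 * ∑' j, ‖c t j‖ ^ 2) (k : ℤ) (p : ℤ × ℤ) :
    HasDerivAt (fun τ => modulate (shiftedSymbol σ α P) (-τ)
        (fun n => trilinearTerm (normalForm α) (c τ) (c τ) (c τ) n p) k)
      (modulate (shiftedSymbol σ α P) (-t) (fun n => normalFormDerivTerm σ α (c t) n p) k) t := by
  have hc (n : ℤ) : HasDerivAt (fun τ => c τ n)
      (Complex.I * (shiftedSymbol σ α P n * c t n) + forcing σ (c t) n) t :=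
    (h.hasDerivAt t ht n).congr_deriv (rhs_eq hs (h.seqContinuousOn.1 t ht) hP n)
  have hterm := ((hc (k - p.1)).mul ((hc (k - p.1 - p.2)).star.mul (hc (k - p.2)))).const_mul
    (normalForm α k p)
  refine (hasDerivAt_modulate_neg (shiftedSymbol σ α P)
    (f := fun τ n => trilinearTerm (normalForm α) (c τ) (c τ) (c τ) n p)
    (f' := fun _ => _) hterm).congr_deriv ?_
  have hres := resonance_mul_normalForm hα hα' k p
  rw [← resonance_shiftedSymbol σ α P] at hres
  simp only [modulate, normalFormDerivTerm, trilinearTerm, trilinearDerivTerm, Complex.star_def,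
    map_add, map_mul, Complex.conj_I, Complex.conj_ofReal, Pi.mul_apply, ← hres]
  push_cast
  ring

theorem SeqSolution.modulate_sub_eq_integral (hs : 1 / 2 < s) (h : SeqSolution σ α s I c)
    (hP : ∀ t ∈ I, P = 2 * ∑' j, ‖c t j‖ ^ 2) {t₀ t : ℝ} (ht₀ : t₀ ∈ I) (ht : t ∈ I) (k : ℤ) :
    modulate (shiftedSymbol σ α P) (-t) (c t) k - modulate (shiftedSymbol σ α P) (-t₀) (c t₀) k =
      ∫ τ in t₀..t, modulate (shiftedSymbol σ α P) (-τ) (forcing σ (c τ)) k := by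
  have hsub := h.uIcc_subset ht₀ ht
  have hcont := (((h.seqContinuousOn.forcing hs σ).modulate_neg (shiftedSymbol σ α P)).coeff
    k).mono hsub
  refine (intervalIntegral.integral_eq_sub_of_hasDerivAt
    (f := fun τ => modulate (shiftedSymbol σ α P) (-τ) (c τ) k) (fun τ hτ => ?_)
    hcont.intervalIntegrable).symm
  refine (hasDerivAt_modulate_neg _ (f' := rhs σ α (c τ))
    (h.hasDerivAt τ (hsub hτ) k)).congr_deriv ?_
  simp only [modulate, rhs_eq hs (h.seqContinuousOn.1 τ (hsub hτ)) (hP τ (hsub hτ)),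
    add_sub_cancel_left]

theorem SeqSolution.normalForm_sub_eq_integral (hα : 1 / 2 < α) (hα' : α ≤ 1) (hs : 1 / 2 < s)
    (h : SeqSolution σ α s I c) (hP : ∀ t ∈ I, P = 2 * ∑' j, ‖c t j‖ ^ 2) {t₀ t : ℝ}
    (ht₀ : t₀ ∈ I) (ht : t ∈ I) (k : ℤ) :
    modulate (shiftedSymbol σ α P) (-t) (trilinear (normalForm α) (c t) (c t) (c t)) k -
        modulate (shiftedSymbol σ α P) (-t₀) (trilinear (normalForm α) (c t₀) (c t₀) (c t₀)) k =
      ∫ τ in t₀..t, modulate (shiftedSymbol σ α P) (-τ) (normalFormDeriv σ α (c τ)) k := by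
  have hsub := h.uIcc_subset ht₀ ht
  have hc := h.seqContinuousOn
  have hboundary (τ : ℝ) (hτ : τ ∈ I) := hasSum_modulate (shiftedSymbol σ α P) (-τ)
    (c := trilinear (normalForm α) (c τ) (c τ) (c τ))
    ((admissible_normalForm_self hα hα' hs).summable_trilinearTerm hs le_rfl
      (hc.1 τ hτ) (hc.1 τ hτ) (hc.1 τ hτ) k).hasSum
  obtain ⟨C, hC, hbound⟩ := hc.tsum_normalFormDerivTerm_bounded hα hα' hs σ hsub k
  have hftc := tsum_sub_tsum_eq_integral
    (fun p τ hτ => h.hasDerivAt_trilinearTerm_normalForm hα hα' hs (hsub hτ) (hP τ (hsub hτ)) k p)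
    (fun p => ?_) hC (fun τ hτ => ?_) (hboundary t₀ ht₀).summable (hboundary t ht).summable
  · rw [(hboundary t ht).tsum_eq, (hboundary t₀ ht₀).tsum_eq] at hftc
    exact hftc.trans (intervalIntegral.integral_congr fun τ hτ => (hasSum_modulate _ _
      (hasSum_normalFormDeriv hα hα' hs σ (hc.1 τ (hsub hτ)) k)).tsum_eq)
  · have hphase : Continuous fun τ : ℝ =>
        Complex.exp (Complex.I * (-τ * shiftedSymbol σ α P k : ℝ)) := by fun_prop
    exact hphase.continuousOn.mul ((hc.normalFormDerivTerm hs σ α k p).mono hsub)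
  · simp only [enorm_modulate]
    exact hbound τ hτ

theorem SeqSolution.normalForm_identity (hα : 1 / 2 < α) (hα' : α ≤ 1) (hs : 1 / 2 < s)
    (h : SeqSolution σ α s I c) (hP : ∀ t ∈ I, P = 2 * ∑' j, ‖c t j‖ ^ 2) {t₀ t : ℝ}
    (ht₀ : t₀ ∈ I) (ht : t ∈ I) (k : ℤ) :
    modulate (shiftedSymbol σ α P) (-t)
        (c t - (σ : ℂ) • trilinear (normalForm α) (c t) (c t) (c t)) k -
      modulate (shiftedSymbol σ α P) (-t₀)
        (c t₀ - (σ : ℂ) • trilinear (normalForm α) (c t₀) (c t₀) (c t₀)) k =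
      ∫ τ in t₀..t, modulate (shiftedSymbol σ α P) (-τ) (remainder σ α (c τ)) k := by
  have hsub := h.uIcc_subset ht₀ ht
  have hc := h.seqContinuousOn
  have hintegrable {f : ℝ → ℤ → ℂ} (hf : SeqContinuousOn s I f) : IntervalIntegrable
      (fun τ => modulate (shiftedSymbol σ α P) (-τ) (f τ) k) volume t₀ t :=
    (((hf.modulate_neg _).coeff k).mono hsub).intervalIntegrable
  have hsplit (τ : ℝ) (d e : ℤ → ℂ) : modulate (shiftedSymbol σ α P) (-τ) (d - (σ : ℂ) • e) k =
      modulate (shiftedSymbol σ α P) (-τ) d k -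
        σ * modulate (shiftedSymbol σ α P) (-τ) e k := by
    simp only [modulate, Pi.sub_apply, Pi.smul_apply, smul_eq_mul]; ring
  simp only [remainder_eq, hsplit]
  rw [sub_sub_sub_comm, ← mul_sub, h.modulate_sub_eq_integral hs hP ht₀ ht k,
    h.normalForm_sub_eq_integral hα hα' hs hP ht₀ ht k, ← intervalIntegral.integral_const_mul,
    ← intervalIntegral.integral_sub (hintegrable (hc.forcing hs σ))
      ((hintegrable (hc.normalFormDeriv hα hα' hs σ)).const_mul (σ : ℂ))]

end NormalForm

/-! ### Smoothing -/

section Smoothing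

variable {σ Λ α s q P r t₀ t : ℝ} {I : Set ℝ} {c : ℝ → ℤ → ℂ}

/-- The boundary term produced by integrating the nonresonant cubic terms by parts in time. -/
def boundaryTerm (σ α : ℝ) (c : ℤ → ℂ) : ℤ → ℂ :=
  (σ : ℂ) • trilinear (normalForm α) c c c

/-- The solution in the interaction picture, corrected by the boundary term. Its time derivative
is the smoother `remainder`. -/
def profile (σ α P : ℝ) (c : ℝ → ℤ → ℂ) (t : ℝ) : ℤ → ℂ :=
  modulate (shiftedSymbol σ α P) (-t) (c t - boundaryTerm σ α (c t))

theorem wnorm_boundaryTerm_le (hα : 1 / 2 < α) (hα' : α ≤ 1) (hq : 1 / 2 < q) (hs : 0 ≤ s)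
    (hr : r ≤ s + (2 * α - 1)) (Λ : ℝ) :
    ∃ C < ∞, ∀ σ : ℝ, |σ| ≤ Λ → ∀ c : ℤ → ℂ,
      wnorm r (boundaryTerm σ α c) ≤ C * (wnorm s c * wnorm q c ^ 2) := by
  have hnf := admissible_normalForm hα hα' hs hq.le hr
  refine ⟨ENNReal.ofReal Λ * (trilinearConst q (normalFormConst α s q) * 3),
    ENNReal.mul_lt_top ENNReal.ofReal_lt_top
      (ENNReal.mul_lt_top (trilinearConst_lt_top hq _) (by norm_num)), fun σ hσ c => ?_⟩
  rw [boundaryTerm, wnorm_smul, mul_assoc, mul_assoc, ← mixedNorm_self, ← ofReal_norm,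
    Complex.norm_real]
  exact mul_le_mul' (ENNReal.ofReal_le_ofReal hσ) (hnf.wnorm_trilinear_le c c c)

theorem SeqContinuousOn.boundaryTerm (hα : 1 / 2 < α) (hα' : α ≤ 1) (hs : 1 / 2 < s)
    (hr : r ≤ s + (2 * α - 1)) (hc : SeqContinuousOn s I c) (σ : ℝ) :
    SeqContinuousOn r I (fun t => FNLS.boundaryTerm σ α (c t)) :=
  (SeqContinuousOn.trilinear hs le_rfl (admissible_normalForm hα hα' (by linarith) hs.le hr)
    hc hc hc).smul _

theorem modulate_neg_difference (σ α P : ℝ) (c : ℝ → ℤ → ℂ) (t : ℝ) :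
    modulate (shiftedSymbol σ α P) (-t) (c t - modulate (shiftedSymbol σ α P) t (c 0)) =
      profile σ α P c t - profile σ α P c 0 +
        modulate (shiftedSymbol σ α P) (-t) (boundaryTerm σ α (c t)) -
          boundaryTerm σ α (c 0) := by
  have hcancel : modulate (shiftedSymbol σ α P) (-t) (modulate (shiftedSymbol σ α P) t (c 0)) =
      c 0 := by
    simpa only [neg_neg] using modulate_modulate_neg (shiftedSymbol σ α P) (-t) (c 0)
  rw [profile, profile, neg_zero, modulate_zero, modulate_sub, modulate_sub, hcancel]
  abel

theorem SeqSolution.wnorm_profile_sub_le (hα : 1 / 2 < α) (hα' : α ≤ 1) (hs : 1 / 2 < s)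
    (hr : r ≤ s + (2 * α - 1)) (h : SeqSolution σ α s I c)
    (hP : ∀ t ∈ I, P = 2 * ∑' j, ‖c t j‖ ^ 2) (ht₀ : t₀ ∈ I) (ht : t ∈ I) :
    wnorm r (profile σ α P c t - profile σ α P c t₀) ≤
      ENNReal.ofReal |∫ τ in t₀..t, (wnorm r (remainder σ α (c τ))).toReal| := by
  have hsub := h.uIcc_subset ht₀ ht
  have hrem := h.seqContinuousOn.remainder hα hα' hs hr σ
  have hintegral : profile σ α P c t - profile σ α P c t₀ =
      fun k => ∫ τ in t₀..t, modulate (shiftedSymbol σ α P) (-τ) (remainder σ α (c τ)) k :=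
    funext (h.normalForm_identity hα hα' hs hP ht₀ ht)
  rw [hintegral]
  refine wnorm_integral_le (hrem.toReal_wnorm.mono hsub) (fun _ _ => ENNReal.toReal_nonneg)
    fun τ hτ => ?_
  rw [wnorm_modulate, ENNReal.ofReal_toReal (hrem.1 τ (hsub hτ)).ne]

theorem tendsto_abs_integral (hI : IsOpen I) {G : ℝ → ℝ} (hG : ContinuousOn G I)
    (ht₀ : t₀ ∈ I) :
    Tendsto (fun t => ENNReal.ofReal |∫ τ in t₀..t, G τ|) (𝓝 t₀) (𝓝 0) := by
  have hderiv := intervalIntegral.integral_hasDerivAt_right (a := t₀) (b := t₀) (f := G)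
    IntervalIntegrable.refl (hG.stronglyMeasurableAtFilter hI t₀ ht₀)
    (hG.continuousAt (hI.mem_nhds ht₀))
  simpa only [intervalIntegral.integral_same, abs_zero, ENNReal.ofReal_zero] using
    ENNReal.tendsto_ofReal hderiv.continuousAt.abs.tendsto

theorem SeqSolution.seqContinuousOn_profile_sub (hα : 1 / 2 < α) (hα' : α ≤ 1) (hs : 1 / 2 < s)
    (hr : r ≤ s + (2 * α - 1)) (h : SeqSolution σ α s I c) (h0 : (0 : ℝ) ∈ I)
    (hP : ∀ t ∈ I, P = 2 * ∑' j, ‖c t j‖ ^ 2) :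
    SeqContinuousOn r I (fun t => profile σ α P c t - profile σ α P c 0) := by
  refine ⟨fun t ht => (h.wnorm_profile_sub_le hα hα' hs hr hP h0 ht).trans_lt
    ENNReal.ofReal_lt_top, fun t₀ ht₀ => ?_⟩
  have hrem := (h.seqContinuousOn.remainder hα hα' hs hr σ).toReal_wnorm
  refine SeqContinuousOn.tendsto_of_le
    ((tendsto_abs_integral h.isOpen hrem ht₀).mono_left nhdsWithin_le_nhds) ?_
  filter_upwards [self_mem_nhdsWithin] with t ht
  rw [sub_sub_sub_cancel_right]
  exact h.wnorm_profile_sub_le hα hα' hs hr hP ht₀ ht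

theorem SeqSolution.seqContinuousOn_difference (hα : 1 / 2 < α) (hα' : α ≤ 1) (hs : 1 / 2 < s)
    (hr : r ≤ s + (2 * α - 1)) (h : SeqSolution σ α s I c) (h0 : (0 : ℝ) ∈ I)
    (hP : ∀ t ∈ I, P = 2 * ∑' j, ‖c t j‖ ^ 2) :
    SeqContinuousOn r I (fun t => c t - modulate (shiftedSymbol σ α P) t (c 0)) := by
  have hboundary := h.seqContinuousOn.boundaryTerm hα hα' hs hr σ
  refine ((((h.seqContinuousOn_profile_sub hα hα' hs hr h0 hP).add
    (hboundary.modulate_neg (shiftedSymbol σ α P))).sub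
      (SeqContinuousOn.const (hboundary.1 0 h0))).modulate (shiftedSymbol σ α P)).congr
        fun t _ => ?_
  rw [← modulate_neg_difference, modulate_modulate_neg]

theorem SeqSolution.toReal_wnorm_difference_le (hα : 1 / 2 < α) (hα' : α ≤ 1) (hs : 1 / 2 < s)
    (hr : r ≤ s + (2 * α - 1)) (h : SeqSolution σ α s I c) (h0 : (0 : ℝ) ∈ I)
    (hP : ∀ t ∈ I, P = 2 * ∑' j, ‖c t j‖ ^ 2) (ht : t ∈ I) :
    (wnorm r (c t - modulate (shiftedSymbol σ α P) t (c 0))).toReal ≤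
      |∫ τ in (0 : ℝ)..t, (wnorm r (remainder σ α (c τ))).toReal| +
        (wnorm r (boundaryTerm σ α (c t))).toReal + (wnorm r (boundaryTerm σ α (c 0))).toReal := by
  have hboundary := (h.seqContinuousOn.boundaryTerm hα hα' hs hr σ).1
  refine ENNReal.toReal_le_of_le_ofReal (by positivity) ?_
  rw [ENNReal.ofReal_add (by positivity) (by positivity),
    ENNReal.ofReal_add (by positivity) (by positivity),
    ENNReal.ofReal_toReal (hboundary t ht).ne, ENNReal.ofReal_toReal (hboundary 0 h0).ne,
    ← wnorm_modulate r (shiftedSymbol σ α P) (-t), modulate_neg_difference]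
  refine (wnorm_sub_le _ _ _).trans (add_le_add_left ((wnorm_add_le _ _ _).trans ?_) _)
  rw [wnorm_modulate]
  exact add_le_add_left (h.wnorm_profile_sub_le hα hα' hs hr hP h0 ht) _

theorem abs_integral_le_mul_abs_integral {f g : ℝ → ℝ} {a b C : ℝ} (hC : 0 ≤ C)
    (hf : ∀ τ ∈ Set.uIcc a b, 0 ≤ f τ) (hfg : ∀ τ ∈ Set.uIcc a b, f τ ≤ C * g τ)
    (hg : ContinuousOn g (Set.uIcc a b)) :
    |∫ τ in a..b, f τ| ≤ C * |∫ τ in a..b, g τ| := by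
  have hmul : C * |∫ τ in a..b, g τ| = |∫ τ in a..b, C * g τ| := by
    rw [intervalIntegral.integral_const_mul, abs_mul, abs_of_nonneg hC]
  rw [hmul, ← Real.norm_eq_abs]
  refine intervalIntegral.norm_integral_le_abs_of_norm_le ?_
    (continuousOn_const.mul hg).intervalIntegrable
  refine ae_restrict_of_forall_mem measurableSet_uIoc fun τ hτ => ?_
  rw [Real.norm_of_nonneg (hf τ (Set.uIoc_subset_uIcc hτ))]
  exact hfg τ (Set.uIoc_subset_uIcc hτ)

theorem SeqSolution.exists_smoothing_bound (hα : 1 / 2 < α) (hα' : α ≤ 1) (hq : 1 / 2 < q)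
    (hqs : q ≤ s) (hr : r ≤ s + (2 * α - 1)) (Λ : ℝ) :
    ∃ C : ℝ, 0 < C ∧ ∀ (σ : ℝ) (I : Set ℝ) (c : ℝ → ℤ → ℂ) (P : ℝ), |σ| ≤ Λ →
      SeqSolution σ α s I c → (0 : ℝ) ∈ I → (∀ t ∈ I, P = 2 * ∑' j, ‖c t j‖ ^ 2) → ∀ t ∈ I,
      (wnorm r (c t - modulate (shiftedSymbol σ α P) t (c 0))).toReal ≤
        C * ((wnorm s (c 0)).toReal * (wnorm q (c 0)).toReal ^ 2 +
          (wnorm s (c t)).toReal * (wnorm q (c t)).toReal ^ 2 +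
          |∫ τ in (0 : ℝ)..t, (wnorm s (c τ)).toReal *
            ((wnorm q (c τ)).toReal ^ 2 + (wnorm q (c τ)).toReal ^ 4)|) := by
  obtain ⟨D, hD, hrem⟩ := wnorm_remainder_le hα hα' hq hqs hr Λ
  obtain ⟨B, hB, hbdry⟩ := wnorm_boundaryTerm_le hα hα' hq (by linarith) hr Λ
  refine ⟨B.toReal + D.toReal + 1, by positivity, fun σ I c P hσ h h0 hP t ht => ?_⟩
  have hs := hq.trans_le hqs
  have hc := h.seqContinuousOn
  have hcq := hc.mono_exp hqs
  have hboundary (τ : ℝ) (hτ : τ ∈ I) : (wnorm r (boundaryTerm σ α (c τ))).toReal ≤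
      B.toReal * ((wnorm s (c τ)).toReal * (wnorm q (c τ)).toReal ^ 2) := by
    simpa only [ENNReal.toReal_mul, ENNReal.toReal_pow] using ENNReal.toReal_mono
      (ENNReal.mul_lt_top hB (ENNReal.mul_lt_top (hc.1 τ hτ) (ENNReal.pow_lt_top (hcq.1 τ hτ)))).ne
      (hbdry σ hσ (c τ))
  have hremainder (τ : ℝ) (hτ : τ ∈ I) : (wnorm r (remainder σ α (c τ))).toReal ≤
      D.toReal * ((wnorm s (c τ)).toReal *
        ((wnorm q (c τ)).toReal ^ 2 + (wnorm q (c τ)).toReal ^ 4)) := by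
    have hpow (n : ℕ) : wnorm q (c τ) ^ n < ∞ := ENNReal.pow_lt_top (hcq.1 τ hτ)
    simpa only [ENNReal.toReal_mul, ENNReal.toReal_pow,
      ENNReal.toReal_add (hpow 2).ne (hpow 4).ne] using ENNReal.toReal_mono
        (ENNReal.mul_lt_top hD (ENNReal.mul_lt_top (hc.1 τ hτ)
          (ENNReal.add_lt_top.2 ⟨hpow 2, hpow 4⟩))).ne (hrem σ hσ (c τ))
  have hintegral := abs_integral_le_mul_abs_integral ENNReal.toReal_nonneg
    (fun τ _ => ENNReal.toReal_nonneg) (fun τ hτ => hremainder τ (h.uIcc_subset h0 ht hτ))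
    ((hc.toReal_wnorm.mul ((hcq.toReal_wnorm.pow 2).add (hcq.toReal_wnorm.pow 4))).mono
      (h.uIcc_subset h0 ht))
  refine (h.toReal_wnorm_difference_le hα hα' hs hr h0 hP ht).trans ((add_le_add (add_le_add
    hintegral (hboundary t ht)) (hboundary 0 h0)).trans ?_)
  set J := |∫ τ in (0 : ℝ)..t, (wnorm s (c τ)).toReal *
    ((wnorm q (c τ)).toReal ^ 2 + (wnorm q (c τ)).toReal ^ 4)|
  have : 0 ≤ J := abs_nonneg _
  rw [add_assoc, ← mul_add, add_comm (_ * _) (B.toReal * _), mul_add _ _ J,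
    add_comm ((wnorm s (c t)).toReal * _)]
  gcongr <;> linarith [ENNReal.toReal_nonneg (a := B), ENNReal.toReal_nonneg (a := D)]

theorem coeff_phasedFlow (σ α t : ℝ) (f : L2) :
    coeff (phasedFlow σ α t f) = modulate (shiftedSymbol σ α (phase f)) t (coeff f) := by
  ext k
  rw [phasedFlow, coeff_smul, Pi.smul_apply, coeff_freeFlow, smul_eq_mul, ← mul_assoc,
    ← Complex.exp_add, modulate, shiftedSymbol]
  congr 2
  push_cast
  ring

theorem IsSolution.phase_eq_tsum {u₀ : L2} {u : ℝ → L2} (hs : 1 / 2 < s)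
    (h : IsSolution σ α s u₀ I u) {t : ℝ} (ht : t ∈ I) :
    phase u₀ = 2 * ∑' j, ‖coeff (u t) j‖ ^ 2 := by
  rw [phase_eq, (h.seqSolution hs).mass_eq hs h.zero_mem ht, h.initial]

theorem IsSolution.coeff_difference {u₀ : L2} {u : ℝ → L2} (h : IsSolution σ α s u₀ I u) (t : ℝ) :
    coeff (u t - phasedFlow σ α t u₀) =
      coeff (u t) - modulate (shiftedSymbol σ α (phase u₀)) t (coeff (u 0)) := by
  rw [coeff_sub, coeff_phasedFlow, h.initial]

theorem IsSolution.continuousInSobolev_difference {u₀ : L2} {u : ℝ → L2} (hα : 1 / 2 < α)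
    (hα' : α ≤ 1) (hs : 1 / 2 < s) (hr : r ≤ s + (2 * α - 1)) (h : IsSolution σ α s u₀ I u) :
    ContinuousInSobolev r I (fun t => u t - phasedFlow σ α t u₀) := by
  rw [continuousInSobolev_iff]
  refine ((h.seqSolution hs).seqContinuousOn_difference hα hα' hs hr h.zero_mem
    fun t ht => h.phase_eq_tsum hs ht).congr fun t _ => ?_
  exact h.coeff_difference t

theorem exists_smoothing_bound (hα : 1 / 2 < α) (hα' : α ≤ 1) (hq : 1 / 2 < q) (hqs : q ≤ s)
    (hr : r ≤ s + (2 * α - 1)) (Λ : ℝ) :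
    ∃ C : ℝ, 0 < C ∧ ∀ σ : ℝ, |σ| ≤ Λ → ∀ (u₀ : L2) (I : Set ℝ) (u : ℝ → L2),
      IsSolution σ α s u₀ I u → ∀ t ∈ I,
      sobolevNorm r (u t - phasedFlow σ α t u₀) ≤
        C * (sobolevNorm s u₀ * sobolevNorm q u₀ ^ 2 +
          sobolevNorm s (u t) * sobolevNorm q (u t) ^ 2 +
          |∫ τ in (0 : ℝ)..t, sobolevNorm s (u τ) *
            (sobolevNorm q (u τ) ^ 2 + sobolevNorm q (u τ) ^ 4)|) := by
  obtain ⟨C, hC, hbound⟩ := SeqSolution.exists_smoothing_bound hα hα' hq hqs hr Λ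
  refine ⟨C, hC, fun σ hσ u₀ I u h t ht => ?_⟩
  have hs := hq.trans_le hqs
  simpa only [sobolevNorm_eq, h.coeff_difference t, h.initial] using
    hbound σ I (fun τ => coeff (u τ)) (phase u₀) hσ (h.seqSolution hs) h.zero_mem
      (fun τ hτ => h.phase_eq_tsum hs hτ) t ht

end Smoothing

/-! ### Conservation of energy -/

theorem symbol_nonneg (α : ℝ) (k : ℤ) : 0 ≤ symbol α k := Real.rpow_nonneg (abs_nonneg _) _

theorem symbol_le_bracket {α : ℝ} (hα : 0 ≤ α) (k : ℤ) : symbol α k ≤ bracket k ^ (2 * α) :=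
  Real.rpow_le_rpow (abs_nonneg _) (abs_le_bracket k) (by linarith)

theorem bracket_rpow_le_one_add_symbol {α : ℝ} (hα : 0 ≤ α) (hα' : α ≤ 1) (k : ℤ) :
    bracket k ^ (2 * α) ≤ 1 + symbol α k := by
  have hbracket : bracket k ^ (2 * α) = (1 + (k : ℝ) ^ 2) ^ α := by
    rw [Real.rpow_mul (bracket_pos k).le, Real.rpow_two, bracket_sq]
  have hsymbol : symbol α k = ((k : ℝ) ^ 2) ^ α := by
    rw [symbol, Real.rpow_mul (abs_nonneg _), Real.rpow_two, sq_abs]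
  simpa only [hbracket, hsymbol, Real.one_rpow] using
    Real.rpow_add_le_add_rpow zero_le_one (sq_nonneg (k : ℝ)) hα hα'

theorem wnorm_rhs_le {α : ℝ} (hα : 0 ≤ α) (σ : ℝ) (c : ℤ → ℂ) :
    wnorm (-α) (rhs σ α c) ≤ wnorm α c + ‖(σ : ℂ)‖ₑ * wnorm α (cubicSeq c) := by
  have hsplit : rhs σ α c = (fun k => Complex.I * (symbol α k * c k)) -
      (Complex.I * σ) • cubicSeq c := by
    ext k; simp only [rhs, Pi.sub_apply, Pi.smul_apply, smul_eq_mul]; ring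
  rw [hsplit]
  refine (wnorm_sub_le _ _ _).trans (add_le_add (l2Norm_mono fun k => ?_) ?_)
  · rw [enorm_mul, enorm_mul, enorm_I, one_mul, ← mul_assoc]
    refine mul_le_mul_left ?_ _
    rw [eweight, eweight, ← ofReal_norm, Complex.norm_real,
      Real.norm_of_nonneg (symbol_nonneg α k), ← ENNReal.ofReal_mul (bracket_rpow_pos k _).le]
    refine ENNReal.ofReal_le_ofReal ?_
    calc bracket k ^ (-α) * symbol α k ≤ bracket k ^ (-α) * bracket k ^ (2 * α) :=
          mul_le_mul_of_nonneg_left (symbol_le_bracket hα k) (bracket_rpow_pos k _).le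
      _ = bracket k ^ α := by rw [← Real.rpow_add (bracket_pos k)]; congr 1; ring
  · rw [wnorm_smul, enorm_mul, enorm_I, one_mul]
    exact mul_le_mul_right (wnorm_mono_exp (by linarith) _) _

section QuarticDerivative

/-- The derivative of the summands of `quartic c c c c` in the direction `y`. -/
def quarticDerivTerm (c y : ℤ → ℂ) (x : ℤ × (ℤ × ℤ)) : ℂ :=
  quarticTerm y c c c x + quarticTerm c y c c x + (quarticTerm c c y c x + quarticTerm c c c y x)

theorem hasDerivAt_quarticTerm {c : ℝ → ℤ → ℂ} {y : ℤ → ℂ} {t : ℝ}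
    (h : ∀ k, HasDerivAt (fun τ => c τ k) (y k) t) (x : ℤ × (ℤ × ℤ)) :
    HasDerivAt (fun τ => quarticTerm (c τ) (c τ) (c τ) (c τ) x) (quarticDerivTerm (c t) y x) t := by
  refine ((h x.1).star.mul (((h (x.1 - x.2.1)).mul ((h (x.1 - x.2.1 - x.2.2)).star.mul
    (h (x.1 - x.2.2)))).const_mul 1)).congr_deriv ?_
  simp only [quarticDerivTerm, quarticTerm, trilinearTerm, Complex.star_def, Pi.mul_apply]
  ring

theorem tsum_enorm_quarticDerivTerm_le (c y : ℤ → ℂ) :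
    ∑' x, ‖quarticDerivTerm c y x‖ₑ ≤ 4 * quarticAbs y c c c := by
  calc ∑' x, ‖quarticDerivTerm c y x‖ₑ
      ≤ quarticAbs y c c c + quarticAbs c y c c + (quarticAbs c c y c + quarticAbs c c c y) := by
        simp only [quarticAbs]
        rw [← ENNReal.tsum_add, ← ENNReal.tsum_add, ← ENNReal.tsum_add]
        exact ENNReal.tsum_le_tsum fun x => (enorm_add_le _ _).trans
          (add_le_add (enorm_add_le _ _) (enorm_add_le _ _))
    _ = 4 * quarticAbs y c c c := by
        rw [quarticAbs_swap₁₃ c y c c, quarticAbs_swap₀₂ y c c c, quarticAbs_swap₀₁ y c c c]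
        ring

theorem hasSum_quarticDerivTerm {c y : ℤ → ℂ} (H : quarticAbs y c c c < ∞) :
    HasSum (quarticDerivTerm c y) (2 * (quartic y c c c + conj (quartic y c c c))) := by
  have hsecond : quarticAbs c y c c < ∞ := by rwa [quarticAbs_swap₀₁]
  have hthird : quarticAbs c c y c < ∞ := by rwa [quarticAbs_swap₀₂]
  have hfourth : quarticAbs c c c y < ∞ := by rwa [quarticAbs_swap₁₃]
  convert ((summable_quarticTerm H).hasSum.add (summable_quarticTerm hsecond).hasSum).add
    ((summable_quarticTerm hthird).hasSum.add (summable_quarticTerm hfourth).hasSum) using 1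
  · rfl
  change _ = quartic _ _ _ _ + quartic _ _ _ _ + (quartic _ _ _ _ + quartic _ _ _ _)
  rw [quartic_swap₀₂ y c c c, quartic_swap₁₃ c y c c, conj_quartic]
  ring

theorem continuousOn_quarticTerm {a f g h : ℝ → ℤ → ℂ} {S : Set ℝ}
    (ha : ∀ n, ContinuousOn (fun τ => a τ n) S) (hf : ∀ n, ContinuousOn (fun τ => f τ n) S)
    (hg : ∀ n, ContinuousOn (fun τ => g τ n) S) (hh : ∀ n, ContinuousOn (fun τ => h τ n) S)
    (x : ℤ × (ℤ × ℤ)) :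
    ContinuousOn (fun τ => quarticTerm (a τ) (f τ) (g τ) (h τ) x) S :=
  (Complex.continuous_conj.comp_continuousOn (ha _)).mul (continuousOn_const.mul
    ((hf _).mul ((Complex.continuous_conj.comp_continuousOn (hg _)).mul (hh _))))

theorem continuousOn_quarticDerivTerm {c y : ℝ → ℤ → ℂ} {S : Set ℝ}
    (hc : ∀ n, ContinuousOn (fun τ => c τ n) S) (hy : ∀ n, ContinuousOn (fun τ => y τ n) S)
    (x : ℤ × (ℤ × ℤ)) : ContinuousOn (fun τ => quarticDerivTerm (c τ) (y τ) x) S :=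
  ((continuousOn_quarticTerm hy hc hc hc x).add (continuousOn_quarticTerm hc hy hc hc x)).add
    ((continuousOn_quarticTerm hc hc hy hc x).add (continuousOn_quarticTerm hc hc hc hy x))

end QuarticDerivative

section Energy

variable {σ α s t₀ t : ℝ} {I : Set ℝ} {c : ℝ → ℤ → ℂ}

theorem SeqSolution.mono_exp {r : ℝ} (hr : r ≤ s) (h : SeqSolution σ α s I c) :
    SeqSolution σ α r I c :=
  ⟨h.isOpen, h.ordConnected, h.seqContinuousOn.mono_exp hr, h.hasDerivAt⟩

theorem SeqContinuousOn.continuousOn_rhs (hs : 1 / 2 < s) (hc : SeqContinuousOn s I c) (σ α : ℝ)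
    (k : ℤ) : ContinuousOn (fun τ => rhs σ α (c τ) k) I :=
  (continuousOn_const.mul (continuousOn_const.mul (hc.coeff k))).sub
    (continuousOn_const.mul (continuousOn_const.mul ((hc.cubicSeq hs).coeff k)))

theorem SeqSolution.quarticAbs_rhs_bounded (hα : 1 / 2 < α) (h : SeqSolution σ α α I c)
    (ht₀ : t₀ ∈ I) (ht : t ∈ I) :
    ∃ B < ∞, ∀ τ ∈ Set.uIcc t₀ t, quarticAbs (rhs σ α (c τ)) (c τ) (c τ) (c τ) ≤ B := by
  have hsub := h.uIcc_subset ht₀ ht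
  obtain ⟨K, hK⟩ := h.seqContinuousOn.bounded_on_uIcc hsub
  obtain ⟨K', hK'⟩ := (h.seqContinuousOn.cubicSeq hα).bounded_on_uIcc hsub
  refine ⟨(ENNReal.ofReal K + ‖(σ : ℂ)‖ₑ * ENNReal.ofReal K') *
    (trilinearConst α (3 ^ α) * (3 * (ENNReal.ofReal K * ENNReal.ofReal K ^ 2))),
    ENNReal.mul_lt_top (ENNReal.add_lt_top.2 ⟨ENNReal.ofReal_lt_top,
      ENNReal.mul_lt_top enorm_lt_top ENNReal.ofReal_lt_top⟩)
      (ENNReal.mul_lt_top (trilinearConst_lt_top hα _) (ENNReal.mul_lt_top (by norm_num)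
        (ENNReal.mul_lt_top ENNReal.ofReal_lt_top (ENNReal.pow_lt_top ENNReal.ofReal_lt_top)))),
    fun τ hτ => ?_⟩
  have hα0 : 0 ≤ α := by linarith
  refine (quarticAbs_le (q := α) hα0 _ _ _ _).trans (mul_le_mul' ((wnorm_rhs_le hα0 σ _).trans ?_)
    (mul_le_mul_right ?_ _))
  · gcongr
    exacts [hK τ hτ, hK' τ hτ]
  · rw [mixedNorm_self]
    gcongr <;> exact hK τ hτ

theorem SeqSolution.quartic_sub_eq_integral (hα : 1 / 2 < α) (h : SeqSolution σ α α I c)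
    (ht₀ : t₀ ∈ I) (ht : t ∈ I) :
    quartic (c t) (c t) (c t) (c t) - quartic (c t₀) (c t₀) (c t₀) (c t₀) =
      ∫ τ in t₀..t, ∑' x, quarticDerivTerm (c τ) (rhs σ α (c τ)) x := by
  have hsub := h.uIcc_subset ht₀ ht
  have hsummable (τ : ℝ) (hτ : τ ∈ I) :=
    summable_quarticTerm (quarticAbs_lt_top hα (h.seqContinuousOn.1 τ hτ))
  obtain ⟨B, hB, hbound⟩ := h.quarticAbs_rhs_bounded hα ht₀ ht
  exact tsum_sub_tsum_eq_integral (C := 4 * B)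
    (fun x τ hτ => hasDerivAt_quarticTerm (h.hasDerivAt τ (hsub hτ)) x)
    (fun x => continuousOn_quarticDerivTerm (fun n => (h.seqContinuousOn.coeff n).mono hsub)
      (fun n => (h.seqContinuousOn.continuousOn_rhs hα σ α n).mono hsub) x)
    (ENNReal.mul_lt_top (by norm_num) hB)
    (fun τ hτ => (tsum_enorm_quarticDerivTerm_le _ _).trans (mul_le_mul_right (hbound τ hτ) _))
    (hsummable t₀ ht₀) (hsummable t ht)

theorem tsum_quarticDerivTerm_rhs {c : ℤ → ℂ} (H : quarticAbs (rhs σ α c) c c c < ∞) :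
    ∑' k, (symbol α k : ℂ) * (-(Complex.I * σ) *
        (conj (c k) * cubicSeq c k - conj (conj (c k) * cubicSeq c k))) =
      (σ / 2 : ℂ) * ∑' x, quarticDerivTerm c (rhs σ α c) x := by
  have hsum := hasSum_quartic H
  rw [(hasSum_quarticDerivTerm H).tsum_eq,
    ← (((hsum.add (Complex.hasSum_conj'.2 hsum)).mul_left 2).mul_left (σ / 2 : ℂ)).tsum_eq]
  refine tsum_congr fun k => ?_
  change _ = (σ / 2 : ℂ) * (2 * (conj (rhs σ α c k) * cubicSeq c k +
    conj (conj (rhs σ α c k) * cubicSeq c k)))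
  simp only [rhs, map_sub, map_mul, map_neg, Complex.conj_I, Complex.conj_ofReal, Complex.conj_conj]
  ring

theorem SeqSolution.energy_identity (hα : 1 / 2 < α) (h : SeqSolution σ α α I c)
    (ht₀ : t₀ ∈ I) (ht : t ∈ I) :
    ∑' k, (symbol α k : ℂ) * (c t k * conj (c t k)) -
      ∑' k, (symbol α k : ℂ) * (c t₀ k * conj (c t₀ k)) =
      (σ / 2 : ℂ) * (quartic (c t) (c t) (c t) (c t) - quartic (c t₀) (c t₀) (c t₀) (c t₀)) := by
  obtain ⟨B, hB, hbound⟩ := h.quarticAbs_rhs_bounded hα ht₀ ht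
  have hweight (k : ℤ) : |symbol α k| ≤ bracket k ^ (2 * α) := by
    rw [abs_of_nonneg (symbol_nonneg α k)]
    exact symbol_le_bracket (by linarith) k
  rw [h.weighted_balance hα le_rfl hweight ht₀ ht, h.quartic_sub_eq_integral hα ht₀ ht,
    ← intervalIntegral.integral_const_mul]
  exact intervalIntegral.integral_congr fun τ hτ =>
    tsum_quarticDerivTerm_rhs ((hbound τ hτ).trans_lt hB)

end Energy

/-! ### A priori bounds -/

theorem toReal_wnorm_sq (r : ℝ) (c : ℤ → ℂ) :
    (wnorm r c).toReal ^ 2 = ∑' k : ℤ, bracket k ^ (2 * r) * ‖c k‖ ^ 2 := by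
  rw [← sqrt_tsum_eq_wnorm, Real.sq_sqrt (tsum_nonneg fun k => weight_nonneg r k _)]

theorem summable_sq_norm {r : ℝ} (hr : 0 ≤ r) {c : ℤ → ℂ} (hc : wnorm r c < ∞) :
    Summable fun k => ‖c k‖ ^ 2 := by
  simpa only [mul_zero, Real.rpow_zero, one_mul] using
    (summable_iff_wnorm_lt_top 0 c).2 ((wnorm_mono_exp hr c).trans_lt hc)

theorem tsum_sq_norm_le {r : ℝ} (hr : 0 ≤ r) {c : ℤ → ℂ} (hc : wnorm r c < ∞) :
    ∑' k, ‖c k‖ ^ 2 ≤ (wnorm r c).toReal ^ 2 := by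
  rw [toReal_wnorm_sq]
  exact (summable_sq_norm hr hc).tsum_le_tsum (fun k => le_mul_of_one_le_left (sq_nonneg _)
    (Real.one_le_rpow (one_le_bracket k) (by linarith))) ((summable_iff_wnorm_lt_top r c).2 hc)

theorem rpow_interpolation {q α δ : ℝ} (hq : 0 ≤ q) (hqα : q < α) (hδ : 0 < δ) :
    ∃ B : ℝ, 0 ≤ B ∧ ∀ x : ℝ, 1 ≤ x → x ^ (2 * q) ≤ δ * x ^ (2 * α) + B := by
  set b : ℝ := δ⁻¹ ^ (2 * α - 2 * q)⁻¹ with hb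
  have hb0 : 0 ≤ b := by positivity
  refine ⟨b ^ (2 * q), by positivity, fun x hx => ?_⟩
  have hx0 : 0 < x := by linarith
  rcases le_total x b with hxb | hbx
  · exact (Real.rpow_le_rpow hx0.le hxb (by linarith)).trans
      (le_add_of_nonneg_left (by positivity))
  · have hgap : δ⁻¹ ≤ x ^ (2 * α - 2 * q) := by
      have := Real.rpow_le_rpow hb0 hbx (by linarith : 0 ≤ 2 * α - 2 * q)
      rwa [hb, ← Real.rpow_mul (by positivity), inv_mul_cancel₀ (by linarith), Real.rpow_one]
        at this
    calc x ^ (2 * q) ≤ δ * x ^ (2 * α - 2 * q) * x ^ (2 * q) :=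
          le_mul_of_one_le_left (by positivity) ((inv_le_iff_one_le_mul₀' hδ).1 hgap)
      _ = δ * x ^ (2 * α) := by rw [mul_assoc, ← Real.rpow_add hx0]; ring_nf
      _ ≤ δ * x ^ (2 * α) + b ^ (2 * q) := le_add_of_nonneg_right (by positivity)

theorem wnorm_interpolation {q α δ : ℝ} (hq : 0 ≤ q) (hqα : q < α) (hδ : 0 < δ) :
    ∃ B : ℝ, 0 ≤ B ∧ ∀ c : ℤ → ℂ, wnorm α c < ∞ →
      (wnorm q c).toReal ^ 2 ≤ δ * (wnorm α c).toReal ^ 2 + B * ∑' k, ‖c k‖ ^ 2 := by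
  obtain ⟨B, hB, hpow⟩ := rpow_interpolation hq hqα hδ
  refine ⟨B, hB, fun c hc => ?_⟩
  have hsumα := ((summable_iff_wnorm_lt_top α c).2 hc).mul_left δ
  have hsumq := (summable_iff_wnorm_lt_top q c).2 ((wnorm_mono_exp hqα.le c).trans_lt hc)
  have hsum := (summable_sq_norm (hq.trans hqα.le) hc).mul_left B
  rw [toReal_wnorm_sq, toReal_wnorm_sq, ← tsum_mul_left, ← tsum_mul_left, ← hsumα.tsum_add hsum]
  refine hsumq.tsum_le_tsum (fun k => ?_) (hsumα.add hsum)
  rw [← mul_assoc, ← add_mul]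
  exact mul_le_mul_of_nonneg_right (hpow _ (one_le_bracket k)) (sq_nonneg _)

theorem norm_quartic_self_le {q : ℝ} (hq : 1 / 2 < q) {c : ℤ → ℂ} (hc : wnorm q c < ∞) :
    ‖quartic c c c c‖ ≤ 3 * (trilinearConst q 1).toReal *
      ((∑' k, ‖c k‖ ^ 2) * (wnorm q c).toReal ^ 2) := by
  have hmass : (wnorm 0 c).toReal ^ 2 = ∑' k, ‖c k‖ ^ 2 := by
    simp only [toReal_wnorm_sq, mul_zero, Real.rpow_zero, one_mul]
  have hc₀ : wnorm 0 c < ∞ := (wnorm_mono_exp (by linarith) c).trans_lt hc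
  have hle : ‖quartic c c c c‖ₑ ≤
      wnorm 0 c * (trilinearConst q 1 * (3 * (wnorm 0 c * wnorm q c ^ 2))) := by
    have habs := quarticAbs_le (r := 0) (q := q) le_rfl c c c c
    rw [neg_zero, Real.rpow_zero, mixedNorm_self] at habs
    exact enorm_tsum_le_tsum_enorm.trans habs
  have hfin : wnorm 0 c * (trilinearConst q 1 * (3 * (wnorm 0 c * wnorm q c ^ 2))) < ∞ :=
    ENNReal.mul_lt_top hc₀ (ENNReal.mul_lt_top (trilinearConst_lt_top hq 1) (ENNReal.mul_lt_top
      (by norm_num) (ENNReal.mul_lt_top hc₀ (ENNReal.pow_lt_top hc))))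
  have hreal := ENNReal.toReal_mono hfin.ne hle
  simp only [toReal_enorm, ENNReal.toReal_mul, ENNReal.toReal_pow, ENNReal.toReal_ofNat] at hreal
  rw [← hmass]
  linarith

theorem exists_norm_quartic_self_le {α δ : ℝ} (hα : 1 / 2 < α) (hδ : 0 < δ) :
    ∃ B : ℝ, 0 ≤ B ∧ ∀ c : ℤ → ℂ, wnorm α c < ∞ →
      ‖quartic c c c c‖ ≤
        (∑' k, ‖c k‖ ^ 2) * (δ * (wnorm α c).toReal ^ 2 + B * ∑' k, ‖c k‖ ^ 2) := by
  obtain ⟨q, hq, hqα⟩ := exists_between hα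
  set T := 3 * (trilinearConst q 1).toReal
  have : 0 ≤ T := by positivity
  obtain ⟨B, hB, hinterp⟩ := wnorm_interpolation (by linarith) hqα
    (show 0 < δ / (T + 1) by positivity)
  refine ⟨T * B, by positivity, fun c hc => ?_⟩
  have : 0 ≤ ∑' k, ‖c k‖ ^ 2 := tsum_nonneg fun k => sq_nonneg _
  have hTδ : T * (δ / (T + 1)) ≤ δ := by
    rw [mul_div_assoc', div_le_iff₀ (by positivity)]
    linarith
  calc ‖quartic c c c c‖ ≤ T * ((∑' k, ‖c k‖ ^ 2) * (wnorm q c).toReal ^ 2) :=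
        norm_quartic_self_le hq ((wnorm_mono_exp hqα.le c).trans_lt hc)
    _ ≤ T * ((∑' k, ‖c k‖ ^ 2) *
          (δ / (T + 1) * (wnorm α c).toReal ^ 2 + B * ∑' k, ‖c k‖ ^ 2)) := by
        gcongr
        exact hinterp c hc
    _ = (∑' k, ‖c k‖ ^ 2) *
          (T * (δ / (T + 1)) * (wnorm α c).toReal ^ 2 + T * B * ∑' k, ‖c k‖ ^ 2) := by ring
    _ ≤ _ := by gcongr

/-- The kinetic energy `∑ |k| ^ (2 * α) * |c k| ^ 2`, the quadratic part of the Hamiltonian. -/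
def kineticEnergy (α : ℝ) (c : ℤ → ℂ) : ℝ :=
  ∑' k, symbol α k * ‖c k‖ ^ 2

section KineticEnergy

variable {α : ℝ} {c : ℤ → ℂ}

theorem symbol_mul_sq_le (hα : 0 ≤ α) (c : ℤ → ℂ) (k : ℤ) :
    symbol α k * ‖c k‖ ^ 2 ≤ bracket k ^ (2 * α) * ‖c k‖ ^ 2 :=
  mul_le_mul_of_nonneg_right (symbol_le_bracket hα k) (sq_nonneg _)

theorem summable_symbol_mul_sq (hα : 0 ≤ α) (hc : wnorm α c < ∞) :
    Summable fun k => symbol α k * ‖c k‖ ^ 2 :=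
  .of_nonneg_of_le (fun k => mul_nonneg (symbol_nonneg α k) (sq_nonneg _))
    (symbol_mul_sq_le hα c) ((summable_iff_wnorm_lt_top α c).2 hc)

theorem kineticEnergy_le (hα : 0 ≤ α) (hc : wnorm α c < ∞) :
    kineticEnergy α c ≤ (wnorm α c).toReal ^ 2 := by
  rw [toReal_wnorm_sq]
  exact (summable_symbol_mul_sq hα hc).tsum_le_tsum (symbol_mul_sq_le hα c)
    ((summable_iff_wnorm_lt_top α c).2 hc)

theorem sq_wnorm_le_mass_add_kineticEnergy (hα : 0 ≤ α) (hα' : α ≤ 1) (hc : wnorm α c < ∞) :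
    (wnorm α c).toReal ^ 2 ≤ ∑' k, ‖c k‖ ^ 2 + kineticEnergy α c := by
  have hmass := summable_sq_norm hα hc
  have hkin := summable_symbol_mul_sq hα hc
  rw [toReal_wnorm_sq, kineticEnergy, ← hmass.tsum_add hkin]
  refine ((summable_iff_wnorm_lt_top α c).2 hc).tsum_le_tsum (fun k => ?_) (hmass.add hkin)
  rw [← one_add_mul]
  exact mul_le_mul_of_nonneg_right (bracket_rpow_le_one_add_symbol hα hα' k) (sq_nonneg _)

end KineticEnergy

theorem SeqSolution.kineticEnergy_sub_le {σ α t₀ t : ℝ} {I : Set ℝ} {c : ℝ → ℤ → ℂ}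
    (hα : 1 / 2 < α) (h : SeqSolution σ α α I c) (ht₀ : t₀ ∈ I) (ht : t ∈ I) :
    kineticEnergy α (c t) - kineticEnergy α (c t₀) ≤
      |σ| / 2 * (‖quartic (c t) (c t) (c t) (c t)‖ + ‖quartic (c t₀) (c t₀) (c t₀) (c t₀)‖) := by
  have hcast (τ : ℝ) :
      ∑' k, (symbol α k : ℂ) * (c τ k * conj (c τ k)) = (kineticEnergy α (c τ) : ℂ) := by
    simp only [kineticEnergy, Complex.ofReal_tsum, Complex.mul_conj', Complex.ofReal_mul,
      Complex.ofReal_pow]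
  have hconserved := congrArg norm (h.energy_identity hα ht₀ ht)
  rw [hcast, hcast, ← Complex.ofReal_sub, Complex.norm_real, Real.norm_eq_abs, norm_mul, norm_div,
    Complex.norm_real, Real.norm_eq_abs, Complex.norm_ofNat] at hconserved
  exact (le_abs_self _).trans (hconserved.le.trans
    (mul_le_mul_of_nonneg_left (norm_sub_le _ _) (by positivity)))

theorem exists_energy_bound {α : ℝ} (hα : 1 / 2 < α) (hα' : α ≤ 1) (Λ M : ℝ) :
    ∃ R : ℝ, ∀ (σ : ℝ) (I : Set ℝ) (c : ℝ → ℤ → ℂ), |σ| ≤ Λ → SeqSolution σ α α I c →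
      ∀ t₀ ∈ I, (wnorm α (c t₀)).toReal ≤ M → ∀ t ∈ I, (wnorm α (c t)).toReal ≤ R := by
  have hα0 : 0 ≤ α := by linarith
  obtain ⟨B, hB, hquartic⟩ := exists_norm_quartic_self_le hα
    (show 0 < (|Λ| * M ^ 2 + 1)⁻¹ by positivity)
  set δ := (|Λ| * M ^ 2 + 1)⁻¹
  have hδ : |Λ| * (M ^ 2 * δ) ≤ 1 := by
    rw [← mul_assoc, ← div_eq_mul_inv, div_le_one (by positivity)]
    linarith
  refine ⟨√(5 * M ^ 2 + 2 * (|Λ| * B * M ^ 4)),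
    fun σ I c hσ h t₀ ht₀ hM t ht => Real.le_sqrt_of_sq_le ?_⟩
  have hfin (τ : ℝ) (hτ : τ ∈ I) : wnorm α (c τ) < ∞ := h.seqContinuousOn.1 τ hτ
  have hstart : (wnorm α (c t₀)).toReal ^ 2 ≤ M ^ 2 := pow_le_pow_left₀ ENNReal.toReal_nonneg hM 2
  have hmass (τ : ℝ) (hτ : τ ∈ I) : ∑' k, ‖c τ k‖ ^ 2 ≤ M ^ 2 :=
    (h.mass_eq hα ht₀ hτ).trans_le ((tsum_sq_norm_le hα0 (hfin t₀ ht₀)).trans hstart)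
  have hpotential (τ : ℝ) (hτ : τ ∈ I) :
      |Λ| * ‖quartic (c τ) (c τ) (c τ) (c τ)‖ ≤
        (wnorm α (c τ)).toReal ^ 2 + |Λ| * B * M ^ 4 := by
    have : 0 ≤ ∑' k, ‖c τ k‖ ^ 2 := tsum_nonneg fun k => sq_nonneg _
    calc |Λ| * ‖quartic (c τ) (c τ) (c τ) (c τ)‖
        ≤ |Λ| * (M ^ 2 * (δ * (wnorm α (c τ)).toReal ^ 2 + B * M ^ 2)) := by
          grw [hquartic _ (hfin τ hτ)]
          gcongr <;> exact hmass τ hτ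
      _ = |Λ| * (M ^ 2 * δ) * (wnorm α (c τ)).toReal ^ 2 + |Λ| * B * M ^ 4 := by ring
      _ ≤ _ := by
          gcongr
          exact mul_le_of_le_one_left (sq_nonneg _) hδ
  have hkinetic := (h.kineticEnergy_sub_le hα ht₀ ht).trans
    (mul_le_mul_of_nonneg_right (div_le_div_of_nonneg_right (hσ.trans (le_abs_self Λ)) zero_le_two)
      (by positivity))
  linarith [sq_wnorm_le_mass_add_kineticEnergy hα0 hα' (hfin t ht), hmass t ht,
    kineticEnergy_le hα0 (hfin t₀ ht₀), hpotential t ht, hpotential t₀ ht₀]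

/-! ### Local existence -/

/-- The space `ℓ²(ℤ)`. -/
abbrev EllTwo : Type := lp (fun _ : ℤ => ℂ) 2

/-- The coefficient sequence `⟨k⟩^{-s} x_k` in `H^s` given by `x ∈ ℓ²`. -/
def toSeq (s : ℝ) (x : EllTwo) : ℤ → ℂ := fun k => (bracket k ^ (-s) : ℝ) * x k

/-- The element `⟨k⟩^s c_k` of `ℓ²` given by a coefficient sequence in `H^s`. -/
def ofSeq (s : ℝ) (c : ℤ → ℂ) : EllTwo :=
  open Classical in
  if h : Memℓp (fun k => ((bracket k ^ s : ℝ) : ℂ) * c k) 2 then ⟨_, h⟩ else 0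

theorem wnorm_weight (s : ℝ) (c : ℤ → ℂ) :
    wnorm 0 (fun k => ((bracket k ^ s : ℝ) : ℂ) * c k) = wnorm s c := by
  rw [wnorm, wnorm]
  congr 1; ext k
  rw [eweight, eweight, Real.rpow_zero, ENNReal.ofReal_one, one_mul, enorm_mul,
    ← ofReal_norm (_ : ℂ), Complex.norm_real, Real.norm_of_nonneg (bracket_rpow_pos k s).le]

theorem enorm_ellTwo (x : EllTwo) : ‖x‖ₑ = wnorm 0 x := by
  have hsum : Summable fun k => bracket k ^ (2 * (0 : ℝ)) * ‖x k‖ ^ 2 := by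
    simpa using (lp.memℓp x).summable (by norm_num)
  have hnorm : ‖x‖ ^ 2 = ∑' k, bracket k ^ (2 * (0 : ℝ)) * ‖x k‖ ^ 2 := by
    simpa using lp.norm_rpow_eq_tsum (p := 2) (by norm_num) x
  rw [← ofReal_norm, ← Real.sqrt_sq (norm_nonneg x), hnorm, sqrt_tsum_eq_wnorm,
    ENNReal.ofReal_toReal ((summable_iff_wnorm_lt_top 0 _).1 hsum).ne]

theorem bracket_cast_mul_neg (s : ℝ) (k : ℤ) :
    ((bracket k ^ s : ℝ) : ℂ) * ((bracket k ^ (-s) : ℝ) : ℂ) = 1 := by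
  rw [← Complex.ofReal_mul, ← Real.rpow_add (bracket_pos k)]; simp

theorem wnorm_toSeq (s : ℝ) (x : EllTwo) : wnorm s (toSeq s x) = ‖x‖ₑ := by
  rw [enorm_ellTwo, ← wnorm_weight]
  congr 1; ext k
  rw [toSeq, ← mul_assoc, bracket_cast_mul_neg, one_mul]

theorem toSeq_sub (s : ℝ) (x y : EllTwo) : toSeq s (x - y) = toSeq s x - toSeq s y := by
  ext k; simp [toSeq, mul_sub]

theorem ofSeq_apply {s : ℝ} {c : ℤ → ℂ} (hc : wnorm s c < ∞) (k : ℤ) :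
    ofSeq s c k = ((bracket k ^ s : ℝ) : ℂ) * c k := by
  rw [ofSeq, dif_pos (memℓp_of_wnorm (by rwa [wnorm_weight]))]

theorem toSeq_ofSeq {s : ℝ} {c : ℤ → ℂ} (hc : wnorm s c < ∞) : toSeq s (ofSeq s c) = c := by
  ext k
  rw [toSeq, ofSeq_apply hc, ← mul_assoc, mul_comm (Complex.ofReal _), bracket_cast_mul_neg,
    one_mul]

theorem enorm_ofSeq {s : ℝ} {c : ℤ → ℂ} (hc : wnorm s c < ∞) : ‖ofSeq s c‖ₑ = wnorm s c := by
  rw [← wnorm_toSeq s, toSeq_ofSeq hc]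

theorem edist_ofSeq {s : ℝ} {c d : ℤ → ℂ} (hc : wnorm s c < ∞) (hd : wnorm s d < ∞) :
    edist (ofSeq s c) (ofSeq s d) = wnorm s (c - d) := by
  rw [edist_eq_enorm_sub, ← wnorm_toSeq s, toSeq_sub, toSeq_ofSeq hc, toSeq_ofSeq hd]

theorem edist_eq_wnorm (s : ℝ) (x y : EllTwo) :
    edist x y = wnorm s (toSeq s x - toSeq s y) := by
  rw [edist_eq_enorm_sub, ← wnorm_toSeq s, toSeq_sub]

theorem SeqContinuousOn.continuousOn_ofSeq {s : ℝ} {I : Set ℝ} {c : ℝ → ℤ → ℂ}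
    (hc : SeqContinuousOn s I c) : ContinuousOn (fun t => ofSeq s (c t)) I := by
  intro t₀ ht₀
  rw [ContinuousWithinAt, tendsto_iff_edist_tendsto_0]
  refine (hc.2 t₀ ht₀).congr' ?_
  filter_upwards [self_mem_nhdsWithin] with t ht
  rw [edist_ofSeq (hc.1 t ht) (hc.1 t₀ ht₀)]

theorem seqContinuousOn_toSeq {s : ℝ} {I : Set ℝ} {X : ℝ → EllTwo} (hX : ContinuousOn X I) :
    SeqContinuousOn s I (fun t => toSeq s (X t)) := by
  refine ⟨fun t _ => by rw [wnorm_toSeq]; exact enorm_lt_top, fun t₀ ht₀ => ?_⟩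
  exact (tendsto_iff_edist_tendsto_0.1 (hX t₀ ht₀)).congr fun t => edist_eq_wnorm s _ _

/-- The equation in the interaction picture, as a vector field on coefficient sequences. -/
def interactionSeq (σ α t : ℝ) (c : ℤ → ℂ) : ℤ → ℂ :=
  (-(Complex.I * σ)) • modulate (symbol α) (-t) (cubicSeq (modulate (symbol α) t c))

/-- The equation in the interaction picture, as a vector field on `ℓ²`. -/
def interaction (σ α s t : ℝ) (x : EllTwo) : EllTwo :=
  ofSeq s (interactionSeq σ α t (toSeq s x))

/-- The constant of the cubic estimate in `H^s`. -/
def cubicConst (s : ℝ) : ℝ≥0∞ := 3 * trilinearConst s (3 ^ s)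

theorem cubicConst_lt_top {s : ℝ} (hs : 1 / 2 < s) : cubicConst s < ∞ :=
  ENNReal.mul_lt_top (by norm_num) (trilinearConst_lt_top hs _)

theorem wnorm_cubicSeq_le {s : ℝ} (hs : 0 ≤ s) (c : ℤ → ℂ) :
    wnorm s (cubicSeq c) ≤ cubicConst s * wnorm s c ^ 3 := by
  refine ((admissible_one hs s).wnorm_trilinear_le c c c).trans_eq ?_
  rw [mixedNorm_self, cubicConst]
  ring

theorem wnorm_cubicSeq_sub_le {s : ℝ} (hs : 1 / 2 < s) {R : ℝ≥0∞} (hR : R < ∞) {c d : ℤ → ℂ}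
    (hc : wnorm s c ≤ R) (hd : wnorm s d ≤ R) :
    wnorm s (cubicSeq c - cubicSeq d) ≤ 3 * cubicConst s * R ^ 2 * wnorm s (c - d) := by
  have hc' := hc.trans_lt hR
  have hd' := hd.trans_lt hR
  calc wnorm s (cubicSeq c - cubicSeq d)
      ≤ 3 * trilinearConst s (3 ^ s) * (wnorm s (c - d) * (wnorm s c * wnorm s c) +
          wnorm s d * (wnorm s (c - d) * wnorm s c) + wnorm s d * (wnorm s d * wnorm s (c - d))) :=
        (admissible_one (by linarith) s).wnorm_trilinear_sub_le hs le_rfl hc' hc' hc' hd' hd' hd'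
    _ ≤ 3 * trilinearConst s (3 ^ s) * (wnorm s (c - d) * (R * R) + R * (wnorm s (c - d) * R) +
          R * (R * wnorm s (c - d))) := by gcongr
    _ = 3 * cubicConst s * R ^ 2 * wnorm s (c - d) := by rw [cubicConst]; ring

section Interaction

variable {s : ℝ}

theorem wnorm_interactionSeq_le (hs : 0 ≤ s) (σ α t : ℝ) (c : ℤ → ℂ) :
    wnorm s (interactionSeq σ α t c) ≤ ‖(σ : ℂ)‖ₑ * (cubicConst s * wnorm s c ^ 3) := by
  rw [interactionSeq, wnorm_smul, enorm_neg, enorm_mul, enorm_I, one_mul, wnorm_modulate]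
  refine mul_le_mul_right ((wnorm_cubicSeq_le hs _).trans_eq ?_) _
  rw [wnorm_modulate]

theorem wnorm_interactionSeq_lt_top (hs : 1 / 2 < s) (σ α t : ℝ) (x : EllTwo) :
    wnorm s (interactionSeq σ α t (toSeq s x)) < ∞ := by
  refine (wnorm_interactionSeq_le (by linarith) σ α t _).trans_lt (ENNReal.mul_lt_top enorm_lt_top
    (ENNReal.mul_lt_top (cubicConst_lt_top hs) (ENNReal.pow_lt_top ?_)))
  rw [wnorm_toSeq]
  exact enorm_lt_top

theorem wnorm_interactionSeq_sub_le (hs : 1 / 2 < s) (σ α t : ℝ) {R : ℝ≥0∞} (hR : R < ∞)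
    {c d : ℤ → ℂ} (hc : wnorm s c ≤ R) (hd : wnorm s d ≤ R) :
    wnorm s (interactionSeq σ α t c - interactionSeq σ α t d) ≤
      ‖(σ : ℂ)‖ₑ * (3 * cubicConst s * R ^ 2 * wnorm s (c - d)) := by
  rw [interactionSeq, interactionSeq, ← smul_sub, ← modulate_sub, wnorm_smul, enorm_neg, enorm_mul,
    enorm_I, one_mul, wnorm_modulate]
  rw [← wnorm_modulate s (symbol α) t] at hc hd
  refine mul_le_mul_right ((wnorm_cubicSeq_sub_le hs hR hc hd).trans_eq ?_) _
  rw [← modulate_sub, wnorm_modulate]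

theorem enorm_interaction_le (hs : 1 / 2 < s) (σ α t : ℝ) (x : EllTwo) :
    ‖interaction σ α s t x‖ₑ ≤ ‖(σ : ℂ)‖ₑ * (cubicConst s * ‖x‖ₑ ^ 3) := by
  rw [interaction, enorm_ofSeq (wnorm_interactionSeq_lt_top hs σ α t x), ← wnorm_toSeq s x]
  exact wnorm_interactionSeq_le (by linarith) σ α t _

theorem edist_interaction_le (hs : 1 / 2 < s) (σ α t : ℝ) {R : ℝ≥0∞} (hR : R < ∞) {x y : EllTwo}
    (hx : ‖x‖ₑ ≤ R) (hy : ‖y‖ₑ ≤ R) :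
    edist (interaction σ α s t x) (interaction σ α s t y) ≤
      ‖(σ : ℂ)‖ₑ * (3 * cubicConst s * R ^ 2) * edist x y := by
  rw [interaction, interaction, edist_ofSeq (wnorm_interactionSeq_lt_top hs σ α t x)
    (wnorm_interactionSeq_lt_top hs σ α t y), edist_eq_wnorm s x, mul_assoc]
  rw [← wnorm_toSeq s] at hx hy
  exact wnorm_interactionSeq_sub_le hs σ α t hR hx hy

theorem continuousOn_interaction (hs : 1 / 2 < s) (σ α : ℝ) {I : Set ℝ} {X : ℝ → EllTwo}
    (hX : ContinuousOn X I) : ContinuousOn (fun t => interaction σ α s t (X t)) I :=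
  (((((seqContinuousOn_toSeq hX).modulate (symbol α)).cubicSeq hs).modulate_neg (symbol α)).smul
    _).continuousOn_ofSeq

theorem enorm_le_of_mem_closedBall_one {x₀ x : EllTwo} (hx : x ∈ Metric.closedBall x₀ 1) :
    ‖x‖ₑ ≤ ‖x₀‖ₑ + 1 := by
  rw [mem_closedBall_iff_norm] at hx
  rw [← ofReal_norm, ← ofReal_norm, ← ENNReal.ofReal_one,
    ← ENNReal.ofReal_add (norm_nonneg _) zero_le_one]
  exact ENNReal.ofReal_le_ofReal (by linarith [norm_le_norm_add_norm_sub' x x₀])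

theorem exists_interaction_solution (hs : 1 / 2 < s) (σ α T : ℝ) (x₀ : EllTwo) :
    ∃ δ > 0, ∃ X : ℝ → EllTwo, X T = x₀ ∧ ∀ t ∈ Set.Ioo (T - δ) (T + δ),
      HasDerivAt X (interaction σ α s t (X t)) t := by
  set R : ℝ≥0∞ := ‖x₀‖ₑ + 1
  have hR : R < ∞ := ENNReal.add_lt_top.2 ⟨enorm_lt_top, ENNReal.one_lt_top⟩
  set K : ℝ≥0∞ := ‖(σ : ℂ)‖ₑ * (3 * cubicConst s * R ^ 2)
  have hK : K < ∞ := ENNReal.mul_lt_top enorm_lt_top (ENNReal.mul_lt_top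
    (ENNReal.mul_lt_top (by norm_num) (cubicConst_lt_top hs)) (ENNReal.pow_lt_top hR))
  set L : ℝ≥0∞ := ‖(σ : ℂ)‖ₑ * (cubicConst s * R ^ 3)
  have hL : L < ∞ := ENNReal.mul_lt_top enorm_lt_top (ENNReal.mul_lt_top
    (cubicConst_lt_top hs) (ENNReal.pow_lt_top hR))
  set δ : ℝ := ((L.toNNReal : ℝ) + 1)⁻¹ with hδ
  have hδ0 : 0 < δ := by positivity
  have hpicard : IsPicardLindelof (interaction σ α s) (tmin := T - δ) (tmax := T + δ)
      ⟨T, by constructor <;> linarith⟩ x₀ 1 0 L.toNNReal K.toNNReal := by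
    refine ⟨fun t _ x hx y hy => ?_, fun x _ => continuousOn_interaction hs σ α continuousOn_const,
      fun t _ x hx => ?_, ?_⟩
    · rw [ENNReal.coe_toNNReal hK.ne]
      exact edist_interaction_le hs σ α t hR (enorm_le_of_mem_closedBall_one hx)
        (enorm_le_of_mem_closedBall_one hy)
    · have hbound : ‖interaction σ α s t x‖ₑ ≤ L := (enorm_interaction_le hs σ α t x).trans
        (mul_le_mul_right (mul_le_mul_right
          (pow_le_pow_left' (enorm_le_of_mem_closedBall_one hx) 3) _) _)
      rw [← toReal_enorm]
      exact ENNReal.toReal_mono hL.ne hbound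
    · simp only [add_sub_cancel_left, sub_sub_cancel, max_self, NNReal.coe_one, NNReal.coe_zero,
        sub_zero]
      rw [hδ, ← div_eq_mul_inv, div_le_one (by positivity)]
      linarith
  obtain ⟨X, hX0, hX⟩ := hpicard.exists_eq_forall_mem_Icc_hasDerivWithinAt₀
  exact ⟨δ, hδ0, X, hX0, fun t ht => (hX t ⟨ht.1.le, ht.2.le⟩).hasDerivAt
    (Icc_mem_nhds ht.1 ht.2)⟩

theorem hasDerivAt_toSeq {X : ℝ → EllTwo} {X' : EllTwo} {t : ℝ} (hX : HasDerivAt X X' t) (k : ℤ) :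
    HasDerivAt (fun τ => toSeq s (X τ) k) (toSeq s X' k) t :=
  (((lp.evalCLM ℂ (fun _ : ℤ => ℂ) 2 k).restrictScalars ℝ).hasFDerivAt.comp_hasDerivAt t
    hX).const_mul _

theorem hasDerivAt_modulate (θ : ℤ → ℝ) {f : ℝ → ℤ → ℂ} {f' : ℤ → ℂ} {t : ℝ} {k : ℤ}
    (hf : HasDerivAt (fun τ => f τ k) (f' k) t) :
    HasDerivAt (fun τ => modulate θ τ (f τ) k)
      (modulate θ t (fun n => f' n + Complex.I * (θ n * f t n)) k) t := by
  simpa [modulate] using hasDerivAt_modulate_neg (-θ) hf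

theorem modulate_interactionSeq_add (σ α t : ℝ) (y : ℤ → ℂ) :
    modulate (symbol α) t (fun n => interactionSeq σ α t y n + Complex.I * (symbol α n * y n)) =
      rhs σ α (modulate (symbol α) t y) := by
  ext k
  have hcancel := congrFun
    (modulate_modulate_neg (symbol α) t (cubicSeq (modulate (symbol α) t y))) k
  rw [rhs, ← hcancel]
  simp only [interactionSeq, modulate, Pi.smul_apply, smul_eq_mul]
  ring

theorem seqSolution_of_hasDerivAt (hs : 1 / 2 < s) {σ α : ℝ} {I : Set ℝ} {X : ℝ → EllTwo}
    (hIo : IsOpen I) (hI : I.OrdConnected)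
    (hX : ∀ t ∈ I, HasDerivAt X (interaction σ α s t (X t)) t) :
    SeqSolution σ α s I (fun t => modulate (symbol α) t (toSeq s (X t))) where
  isOpen := hIo
  ordConnected := hI
  seqContinuousOn := (seqContinuousOn_toSeq fun t ht =>
    (hX t ht).continuousAt.continuousWithinAt).modulate _
  hasDerivAt t ht k := by
    have hderiv := hasDerivAt_toSeq (s := s) (hX t ht) k
    rw [interaction, toSeq_ofSeq (wnorm_interactionSeq_lt_top hs σ α t (X t))] at hderiv
    rw [← modulate_interactionSeq_add]
    exact hasDerivAt_modulate (symbol α) (f := fun τ => toSeq s (X τ)) hderiv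

theorem hasDerivAt_of_forall_apply {X G : ℝ → EllTwo} {I : Set ℝ} (hIo : IsOpen I)
    (hI : I.OrdConnected) (hG : ContinuousOn G I)
    (hX : ∀ t ∈ I, ∀ k, HasDerivAt (fun τ => X τ k) (G t k) t) {t : ℝ} (ht : t ∈ I) :
    HasDerivAt X (G t) t := by
  have hprimitive : ∀ τ ∈ I, X t + ∫ y in t..τ, G y = X τ := fun τ hτ => by
    have hsub := hI.uIcc_subset ht hτ
    ext k
    let eval : EllTwo →L[ℝ] ℂ := (lp.evalCLM ℂ (fun _ : ℤ => ℂ) 2 k).restrictScalars ℝ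
    have hftc := intervalIntegral.integral_eq_sub_of_hasDerivAt
      (fun y hy => hX y (hsub hy) k)
      (eval.continuous.comp_continuousOn (hG.mono hsub)).intervalIntegrable
    have hcomm := eval.intervalIntegral_comp_comm (μ := volume)
      (hG.mono hsub).intervalIntegrable
    change X t k + eval (∫ y in t..τ, G y) = X τ k
    rw [← hcomm]
    exact add_eq_of_eq_sub' hftc
  have hderiv := (intervalIntegral.integral_hasDerivAt_right (a := t) (b := t) (f := G)
    IntervalIntegrable.refl (hG.stronglyMeasurableAtFilter hIo t ht)
    (hG.continuousAt (hIo.mem_nhds ht))).const_add (X t)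
  refine hderiv.congr_of_eventuallyEq ?_
  filter_upwards [hIo.mem_nhds ht] with τ hτ
  exact (hprimitive τ hτ).symm

theorem SeqSolution.hasDerivAt_ofSeq (hs : 1 / 2 < s) {σ α : ℝ} {I : Set ℝ} {c : ℝ → ℤ → ℂ}
    (h : SeqSolution σ α s I c) {t : ℝ} (ht : t ∈ I) :
    HasDerivAt (fun τ => ofSeq s (modulate (symbol α) (-τ) (c τ)))
      (interaction σ α s t (ofSeq s (modulate (symbol α) (-t) (c t)))) t := by
  have hX := (h.seqContinuousOn.modulate_neg (symbol α)).continuousOn_ofSeq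
  refine hasDerivAt_of_forall_apply h.isOpen h.ordConnected
    (G := fun τ => interaction σ α s τ (ofSeq s (modulate (symbol α) (-τ) (c τ))))
    (continuousOn_interaction hs σ α hX) (fun τ hτ k => ?_) ht
  have hfin (y : ℝ) (hy : y ∈ I) : wnorm s (modulate (symbol α) (-y) (c y)) < ∞ := by
    rw [wnorm_modulate]; exact h.seqContinuousOn.1 y hy
  have hcoord : (fun y => ofSeq s (modulate (symbol α) (-y) (c y)) k) =ᶠ[𝓝 τ]
      fun y => ((bracket k ^ s : ℝ) : ℂ) * modulate (symbol α) (-y) (c y) k := by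
    filter_upwards [h.isOpen.mem_nhds hτ] with y hy
    exact ofSeq_apply (hfin y hy) k
  rw [interaction, ofSeq_apply (wnorm_interactionSeq_lt_top hs σ α τ _), interactionSeq,
    toSeq_ofSeq (hfin τ hτ), modulate_modulate_neg]
  refine (((hasDerivAt_modulate_neg (symbol α) (f' := rhs σ α (c τ))
    (h.hasDerivAt τ hτ k)).const_mul _).congr_of_eventuallyEq hcoord).congr_deriv ?_
  simp only [rhs, modulate, Pi.smul_apply, smul_eq_mul]
  ring

end Interaction

/-! ### Continuation of solutions -/

section Endpoint

variable {E : Type*} {I U : Set ℝ} {T : ℝ}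

section Normed

variable [NormedAddCommGroup E] [NormedSpace ℝ E]

theorem hasDerivAt_of_eventually_punctured {f g : ℝ → E} {x : ℝ}
    (hd : ∀ᶠ y in 𝓝[≠] x, HasDerivAt f (g y) y) (hf : ContinuousAt f x) (hg : ContinuousAt g x) :
    HasDerivAt f (g x) x := by
  rw [← Set.Iio_union_Ioi, nhdsWithin_union, eventually_sup] at hd
  have hderiv {l : Filter ℝ} (hl : l ≤ 𝓝 x) (hdl : ∀ᶠ y in l, HasDerivAt f (g y) y) :
      Tendsto (deriv f) l (𝓝 (g x)) :=
    (hg.tendsto.mono_left hl).congr' (hdl.mono fun y hy => hy.deriv.symm)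
  have hright : HasDerivWithinAt f (g x) (Set.Ici x) x :=
    hasDerivWithinAt_Ici_of_tendsto_deriv (s := {y | HasDerivAt f (g y) y})
      (fun y hy => hy.differentiableAt.differentiableWithinAt) hf.continuousWithinAt hd.2
      (hderiv nhdsWithin_le_nhds hd.2)
  have hleft : HasDerivWithinAt f (g x) (Set.Iic x) x :=
    hasDerivWithinAt_Iic_of_tendsto_deriv (s := {y | HasDerivAt f (g y) y})
      (fun y hy => hy.differentiableAt.differentiableWithinAt) hf.continuousWithinAt hd.1
      (hderiv nhdsWithin_le_nhds hd.1)
  simpa using hleft.union hright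

theorem norm_le_mul_exp_of_le {X X' : ℝ → E} {D a b : ℝ} (hab : a ≤ b)
    (hX : ∀ t ∈ Set.Icc a b, HasDerivAt X (X' t) t)
    (hD : ∀ t ∈ Set.Icc a b, ‖X' t‖ ≤ D * ‖X t‖) : ‖X b‖ ≤ ‖X a‖ * Real.exp (D * (b - a)) := by
  rw [← gronwallBound_ε0]
  exact norm_le_gronwallBound_of_norm_deriv_right_le
    (fun t ht => (hX t ht).continuousAt.continuousWithinAt)
    (fun t ht => (hX t (Set.Ico_subset_Icc_self ht)).hasDerivWithinAt) le_rfl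
    (fun t ht => by simpa using hD t (Set.Ico_subset_Icc_self ht)) b (Set.right_mem_Icc.2 hab)

theorem norm_le_mul_exp {X X' : ℝ → E} {D a b : ℝ}
    (hX : ∀ t ∈ Set.uIcc a b, HasDerivAt X (X' t) t)
    (hD : ∀ t ∈ Set.uIcc a b, ‖X' t‖ ≤ D * ‖X t‖) : ‖X b‖ ≤ ‖X a‖ * Real.exp (D * |b - a|) := by
  rcases le_total a b with hab | hba
  · rw [Set.uIcc_of_le hab] at hX hD
    rw [abs_of_nonneg (sub_nonneg.2 hab)]
    exact norm_le_mul_exp_of_le hab hX hD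
  · rw [Set.uIcc_of_ge hba] at hX hD
    have hneg {t : ℝ} (ht : t ∈ Set.Icc (-a) (-b)) : -t ∈ Set.Icc b a :=
      ⟨by linarith [ht.2], by linarith [ht.1]⟩
    have hreflected := norm_le_mul_exp_of_le (X := fun t => X (-t)) (X' := fun t => -X' (-t))
      (neg_le_neg hba) (fun t ht => by
        simpa [Function.comp_def] using (hX _ (hneg ht)).scomp t (hasDerivAt_neg t))
      (fun t ht => by simpa using hD _ (hneg ht))
    rw [abs_of_nonpos (sub_nonpos.2 hba)]
    simpa [neg_add_eq_sub] using hreflected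

theorem exists_tendsto_of_norm_deriv_le_mul_norm [CompleteSpace E] {X X' : ℝ → E} {D : ℝ}
    (hD0 : 0 ≤ D) (hI : I.OrdConnected) (hX : ∀ t ∈ I, HasDerivAt X (X' t) t)
    (hD : ∀ t ∈ I, ‖X' t‖ ≤ D * ‖X t‖) (hT : T ∈ closure I) :
    ∃ x, Tendsto X (𝓝[I] T) (𝓝 x) := by
  obtain ⟨p, hp, hpT⟩ := Metric.mem_closure_iff.1 hT 1 one_pos
  have hball : 𝓝[I ∩ Metric.ball T 1] T = 𝓝[I] T :=
    nhdsWithin_inter_of_mem' (mem_nhdsWithin_of_mem_nhds (Metric.ball_mem_nhds T one_pos))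
  have hne : (𝓝[I ∩ Metric.ball T 1] T).NeBot := hball ▸ mem_closure_iff_nhdsWithin_neBot.1 hT
  have hbound : ∀ t ∈ I ∩ Metric.ball T 1, ‖X' t‖ ≤ D * (‖X p‖ * Real.exp (D * 2)) :=
    fun t ht => by
      have hsub := hI.uIcc_subset hp ht.1
      have hdist : |t - p| ≤ 2 := by
        rw [← Real.dist_eq]
        linarith [dist_triangle t T p, Metric.mem_ball.1 ht.2]
      calc ‖X' t‖ ≤ D * ‖X t‖ := hD t ht.1
        _ ≤ D * (‖X p‖ * Real.exp (D * |t - p|)) := by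
          gcongr
          exact norm_le_mul_exp (fun τ hτ => hX τ (hsub hτ)) fun τ hτ => hD τ (hsub hτ)
        _ ≤ D * (‖X p‖ * Real.exp (D * 2)) := by gcongr
  have hconvex : Convex ℝ (I ∩ Metric.ball T 1) := hI.convex.inter (convex_ball T 1)
  have hlip : LipschitzOnWith _ X (I ∩ Metric.ball T 1) :=
    hconvex.lipschitzOnWith_of_nnnorm_hasDerivWithin_le
      (C := ⟨D * (‖X p‖ * Real.exp (D * 2)), by positivity⟩)
      (fun t ht => (hX t ht.1).hasDerivWithinAt) hbound
  have hcauchy : Cauchy (map X (𝓝[I ∩ Metric.ball T 1] T)) :=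
    (cauchy_nhds.mono nhdsWithin_le_nhds).map_of_le hlip.uniformContinuousOn
      (le_principal_iff.2 self_mem_nhdsWithin)
  rw [hball] at hcauchy
  exact CompleteSpace.complete hcauchy

end Normed

theorem closure_subset_Iic_of_lt {p y : ℝ} (hI : I.OrdConnected) (hy : y ∈ I) (hyp : y < p)
    (hp : p ∉ I) : closure I ⊆ Set.Iic p :=
  closure_minimal (fun _ hx => not_lt.1 fun hpx => hp (hI.out hy hx ⟨hyp.le, hpx.le⟩)) isClosed_Iic

theorem closure_subset_Ici_of_lt {p y : ℝ} (hI : I.OrdConnected) (hy : y ∈ I) (hpy : p < y)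
    (hp : p ∉ I) : closure I ⊆ Set.Ici p :=
  closure_minimal (fun _ hx => not_lt.1 fun hxp => hp (hI.out hx hy ⟨hxp.le, hpy.le⟩)) isClosed_Ici

theorem ball_inter_frontier_subset {p : ℝ} (hIo : IsOpen I) (hI : I.OrdConnected) (hp : p ∈ I)
    (hT : T ∈ frontier I) : Metric.ball T |T - p| ∩ frontier I ⊆ {T} := by
  rintro t ⟨hball, ht⟩
  rw [hIo.frontier_eq] at hT ht
  rw [Metric.mem_ball, Real.dist_eq] at hball
  rcases lt_trichotomy p T with hpT | rfl | hTp
  · rw [abs_of_pos (sub_pos.2 hpT), abs_lt] at hball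
    exact le_antisymm (closure_subset_Iic_of_lt hI hp hpT hT.2 ht.1)
      (closure_subset_Iic_of_lt hI hp (by linarith) ht.2 hT.1)
  · exact absurd hp hT.2
  · rw [abs_of_neg (sub_neg.2 hTp), abs_lt] at hball
    exact le_antisymm (closure_subset_Ici_of_lt hI hp (by linarith) ht.2 hT.1)
      (closure_subset_Ici_of_lt hI hp hTp hT.2 ht.1)

section Gluing

variable {X Y : ℝ → E} [∀ t, Decidable (t ∈ I)]

theorem continuousOn_piecewise_union [TopologicalSpace E] (hIo : IsOpen I) (hT : T ∈ frontier I)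
    (hU : U ∩ frontier I ⊆ {T}) (hX : ContinuousOn X I) (hY : ContinuousOn Y U)
    (hlim : Tendsto X (𝓝[I] T) (𝓝 (Y T))) : ContinuousOn (I.piecewise X Y) (I ∪ U) := by
  have hTI : T ∉ I := (hIo.frontier_eq ▸ hT).2
  have hmemU {t : ℝ} (ht : t ∈ I ∪ U) (htI : t ∉ I) : t ∈ U := ht.resolve_left htI
  have hfrontier {t : ℝ} (ht : t ∈ (I ∪ U) ∩ frontier I) : t ∈ U ∧ t = T := by
    have htU := hmemU ht.1 (hIo.frontier_eq ▸ ht.2).2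
    exact ⟨htU, hU ⟨htU, ht.2⟩⟩
  refine ContinuousOn.piecewise' (fun t ht => ?_) (fun t ht => ?_)
    (hX.mono Set.inter_subset_right) (hY.mono fun t ht => hmemU ht.1 ht.2)
  · obtain ⟨-, rfl⟩ := hfrontier ht
    rw [Set.piecewise_eq_of_notMem I X Y hTI, Set.inter_eq_right.2 Set.subset_union_left]
    exact hlim
  · obtain ⟨htU, rfl⟩ := hfrontier ht
    rw [Set.piecewise_eq_of_notMem I X Y hTI]
    exact (hY t htU).mono fun τ hτ => hmemU hτ.1 hτ.2

theorem hasDerivAt_piecewise_union [NormedAddCommGroup E] [NormedSpace ℝ E] {v : ℝ → E → E}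
    (hIo : IsOpen I) (hUo : IsOpen U) (hU : U ∩ frontier I ⊆ {T})
    (hX : ∀ t ∈ I, HasDerivAt X (v t (X t)) t) (hY : ∀ t ∈ U, HasDerivAt Y (v t (Y t)) t)
    (hcont : ContinuousOn (I.piecewise X Y) (I ∪ U))
    (hv : ContinuousOn (fun t => v t (I.piecewise X Y t)) (I ∪ U)) :
    ∀ t ∈ I ∪ U, HasDerivAt (I.piecewise X Y) (v t (I.piecewise X Y t)) t := by
  have hoff : ∀ t ∈ I ∪ U, t ≠ T →
      HasDerivAt (I.piecewise X Y) (v t (I.piecewise X Y t)) t := fun t ht htT => by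
    by_cases htI : t ∈ I
    · rw [Set.piecewise_eq_of_mem I X Y htI]
      refine (hX t htI).congr_of_eventuallyEq ?_
      filter_upwards [hIo.mem_nhds htI] with τ hτ using Set.piecewise_eq_of_mem I X Y hτ
    · have htU := ht.resolve_left htI
      have htcl : t ∉ closure I := fun htcl =>
        htT (hU ⟨htU, hIo.frontier_eq ▸ ⟨htcl, htI⟩⟩)
      rw [Set.piecewise_eq_of_notMem I X Y htI]
      refine (hY t htU).congr_of_eventuallyEq ?_
      filter_upwards [isClosed_closure.isOpen_compl.mem_nhds htcl] with τ hτ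
      exact Set.piecewise_eq_of_notMem I X Y fun hτI => hτ (subset_closure hτI)
  intro t ht
  have hnhds := (hIo.union hUo).mem_nhds ht
  by_cases htT : t = T
  · refine hasDerivAt_of_eventually_punctured (g := fun τ => v τ (I.piecewise X Y τ)) ?_
      (hcont.continuousAt hnhds) (hv.continuousAt hnhds)
    filter_upwards [self_mem_nhdsWithin, mem_nhdsWithin_of_mem_nhds hnhds] with τ hτT hτ
    exact hoff τ hτ (htT ▸ hτT)
  · exact hoff t ht htT

end Gluing

end Endpoint

section Continuation

variable {σ α s q R : ℝ} {I : Set ℝ} {c : ℝ → ℤ → ℂ}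

theorem enorm_interaction_le_mul (hs : 1 / 2 < s) (σ α t : ℝ) {B : ℝ≥0∞} {x : EllTwo}
    (hB : wnorm q (toSeq s x) ≤ B) :
    ‖interaction σ α s t x‖ₑ ≤
      ‖(σ : ℂ)‖ₑ * (trilinearConst q (3 ^ s) * (3 * B ^ 2)) * ‖x‖ₑ := by
  rw [interaction, enorm_ofSeq (wnorm_interactionSeq_lt_top hs σ α t x), interactionSeq, wnorm_smul,
    enorm_neg, enorm_mul, enorm_I, one_mul, wnorm_modulate]
  calc ‖(σ : ℂ)‖ₑ * wnorm s (cubicSeq (modulate (symbol α) t (toSeq s x)))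
      ≤ ‖(σ : ℂ)‖ₑ * (trilinearConst q (3 ^ s) *
          (3 * (wnorm s (toSeq s x) * wnorm q (toSeq s x) ^ 2))) := by
        refine mul_le_mul_right
          (((admissible_one (by linarith) q).wnorm_trilinear_le _ _ _).trans_eq ?_) _
        rw [mixedNorm_self, wnorm_modulate, wnorm_modulate]
    _ ≤ ‖(σ : ℂ)‖ₑ * (trilinearConst q (3 ^ s) * (3 * (‖x‖ₑ * B ^ 2))) := by
        rw [wnorm_toSeq]
        gcongr
    _ = _ := by ring

theorem SeqSolution.exists_tendsto_ofSeq (hs : 1 / 2 < s) (h : SeqSolution σ α s I c)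
    (hq : 1 / 2 < q) (hqs : q ≤ s) (hR : ∀ t ∈ I, (wnorm q (c t)).toReal ≤ R) {T : ℝ}
    (hT : T ∈ closure I) :
    ∃ x, Tendsto (fun t => ofSeq s (modulate (symbol α) (-t) (c t))) (𝓝[I] T) (𝓝 x) := by
  set K : ℝ≥0∞ := ‖(σ : ℂ)‖ₑ * (trilinearConst q (3 ^ s) * (3 * ENNReal.ofReal R ^ 2))
  have hK : K < ∞ := ENNReal.mul_lt_top enorm_lt_top (ENNReal.mul_lt_top
    (trilinearConst_lt_top hq _) (ENNReal.mul_lt_top (by norm_num)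
      (ENNReal.pow_lt_top ENNReal.ofReal_lt_top)))
  refine exists_tendsto_of_norm_deriv_le_mul_norm (D := K.toReal) ENNReal.toReal_nonneg
    h.ordConnected (fun t ht => h.hasDerivAt_ofSeq hs ht) (fun t ht => ?_) hT
  have hfin : wnorm s (modulate (symbol α) (-t) (c t)) < ∞ := by
    rw [wnorm_modulate]; exact h.seqContinuousOn.1 t ht
  rw [← toReal_enorm, ← toReal_enorm, ← ENNReal.toReal_mul]
  refine ENNReal.toReal_mono (ENNReal.mul_lt_top hK enorm_lt_top).ne
    (enorm_interaction_le_mul (q := q) hs σ α t ?_)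
  rw [toSeq_ofSeq hfin, wnorm_modulate]
  have hfinq := (wnorm_mono_exp hqs _).trans_lt (h.seqContinuousOn.1 t ht)
  exact (ENNReal.le_ofReal_iff_toReal_le hfinq.ne
    (ENNReal.toReal_nonneg.trans (hR t ht))).2 (hR t ht)

theorem SeqSolution.exists_extension (hs : 1 / 2 < s) (h : SeqSolution σ α s I c)
    (hq : 1 / 2 < q) (hqs : q ≤ s) (hR : ∀ t ∈ I, (wnorm q (c t)).toReal ≤ R) {T p : ℝ}
    (hp : p ∈ I) (hT : T ∈ frontier I) :
    ∃ (J : Set ℝ) (v : ℝ → ℤ → ℂ), SeqSolution σ α s J v ∧ I ⊆ J ∧ T ∈ J ∧ ∀ t ∈ I, v t = c t := by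
  classical
  let X : ℝ → EllTwo := fun t => ofSeq s (modulate (symbol α) (-t) (c t))
  obtain ⟨x₀, hx₀⟩ := h.exists_tendsto_ofSeq hs hq hqs hR (frontier_subset_closure hT)
  obtain ⟨δ, hδ, Y, hYT, hY⟩ := exists_interaction_solution hs σ α T x₀
  have hTp : 0 < |T - p| := abs_pos.2 <| sub_ne_zero.2 <| by
    rintro rfl; exact (h.isOpen.frontier_eq ▸ hT).2 hp
  set U := Metric.ball T (min δ |T - p|)
  have hTU : T ∈ U := Metric.mem_ball_self (lt_min hδ hTp)
  have hU : U ∩ frontier I ⊆ {T} :=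
    (Set.inter_subset_inter_left _ (Metric.ball_subset_ball (min_le_right _ _))).trans
      (ball_inter_frontier_subset h.isOpen h.ordConnected hp hT)
  have hX : ∀ t ∈ I, HasDerivAt X (interaction σ α s t (X t)) t := fun t => h.hasDerivAt_ofSeq hs
  replace hY : ∀ t ∈ U, HasDerivAt Y (interaction σ α s t (Y t)) t := fun t ht =>
    hY t (Real.ball_eq_Ioo T δ ▸ Metric.ball_subset_ball (min_le_left _ _) ht)
  have hcont : ContinuousOn (I.piecewise X Y) (I ∪ U) :=
    continuousOn_piecewise_union h.isOpen hT hU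
      (fun t ht => (hX t ht).continuousAt.continuousWithinAt)
      (fun t ht => (hY t ht).continuousAt.continuousWithinAt) (hYT ▸ hx₀)
  have hderiv := hasDerivAt_piecewise_union h.isOpen Metric.isOpen_ball hU hX hY hcont
    (continuousOn_interaction hs σ α hcont)
  have hconn : (I ∪ U).OrdConnected := by
    obtain ⟨y, hyU, hyI⟩ := mem_closure_iff.1 (frontier_subset_closure hT) U Metric.isOpen_ball hTU
    exact (h.ordConnected.isPreconnected.union y hyI hyU
      (convex_ball T _).isPreconnected).ordConnected
  refine ⟨I ∪ U, fun t => modulate (symbol α) t (toSeq s (I.piecewise X Y t)),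
    seqSolution_of_hasDerivAt hs (h.isOpen.union Metric.isOpen_ball) hconn hderiv,
    Set.subset_union_left, Or.inr hTU, fun t ht => ?_⟩
  have hfin : wnorm s (modulate (symbol α) (-t) (c t)) < ∞ := by
    rw [wnorm_modulate]; exact h.seqContinuousOn.1 t ht
  simp only [Set.piecewise_eq_of_mem I X Y ht, X]
  rw [toSeq_ofSeq hfin, modulate_modulate_neg]

end Continuation

/-! ### Global existence -/

theorem isSolution_of_seqSolution {σ α s : ℝ} (hs : 1 / 2 < s) {J : Set ℝ} {u : ℝ → L2} {u₀ : L2}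
    (h : SeqSolution σ α s J (fun t => coeff (u t))) (h0 : (0 : ℝ) ∈ J) (hu₀ : u 0 = u₀) :
    IsSolution σ α s u₀ J u where
  isOpen := h.isOpen
  ordConnected := h.ordConnected
  zero_mem := h0
  continuous := continuousInSobolev_iff.2 h.seqContinuousOn
  initial := hu₀
  equation t ht k := by
    have hd := h.hasDerivAt t ht k
    refine ⟨hd.differentiableAt, ?_⟩
    rw [hd.deriv, cubicCoeff_eq hs (h.seqContinuousOn.1 t ht), rhs, cubicSeq]
    linear_combination (symbol α k * coeff (u t) k -
      σ * trilinear (fun _ _ => 1) (coeff (u t)) (coeff (u t)) (coeff (u t)) k) * Complex.I_mul_I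

theorem SeqSolution.congr {σ α s : ℝ} {J : Set ℝ} {v w : ℝ → ℤ → ℂ} (h : SeqSolution σ α s J v)
    (hw : ∀ t ∈ J, w t = v t) : SeqSolution σ α s J w where
  isOpen := h.isOpen
  ordConnected := h.ordConnected
  seqContinuousOn := h.seqContinuousOn.congr hw
  hasDerivAt t ht k := by
    rw [hw t ht]
    refine (h.hasDerivAt t ht k).congr_of_eventuallyEq ?_
    filter_upwards [h.isOpen.mem_nhds ht] with y hy
    rw [hw y hy]

theorem IsSolution.exists_extension {σ α s q R : ℝ} (hs : 1 / 2 < s) (hq : 1 / 2 < q) (hqs : q ≤ s)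
    {u₀ : L2} {I : Set ℝ} {u : ℝ → L2} (h : IsSolution σ α s u₀ I u)
    (hR : ∀ t ∈ I, sobolevNorm q (u t) ≤ R) {T : ℝ} (hT : T ∈ frontier I) :
    ∃ (J : Set ℝ) (w : ℝ → L2), IsSolution σ α s u₀ J w ∧ I ⊆ J ∧ T ∈ J ∧ ∀ t ∈ I, w t = u t := by
  classical
  simp only [sobolevNorm_eq] at hR
  obtain ⟨J, v, hv, hIJ, hTJ, hvI⟩ :=
    (h.seqSolution hs).exists_extension hs hq hqs hR h.zero_mem hT
  let w : ℝ → L2 := I.piecewise u fun t => ofCoeff (v t)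
  have hwI : ∀ t ∈ I, w t = u t := fun t ht => Set.piecewise_eq_of_mem _ _ _ ht
  have hw : ∀ t ∈ J, coeff (w t) = v t := fun t ht => by
    by_cases htI : t ∈ I
    · rw [hwI t htI, hvI t htI]
    · simp only [w, Set.piecewise_eq_of_notMem _ _ _ htI]
      exact coeff_ofCoeff ((wnorm_mono_exp (by linarith) _).trans_lt (hv.seqContinuousOn.1 t ht))
  exact ⟨J, w, isSolution_of_seqSolution hs (hv.congr hw) (hIJ h.zero_mem)
    ((hwI 0 h.zero_mem).trans h.initial), hIJ, hTJ, hwI⟩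

section Energy

variable {α s r : ℝ}

theorem exists_sobolevNorm_le (hα : 1 / 2 < α) (hα' : α ≤ 1) (hαs : α ≤ s) (Λ M : ℝ) :
    ∃ R : ℝ, ∀ σ : ℝ, |σ| ≤ Λ → ∀ (u₀ : L2) (I : Set ℝ) (u : ℝ → L2), IsSolution σ α s u₀ I u →
      sobolevNorm α u₀ ≤ M → ∀ t ∈ I, sobolevNorm α (u t) ≤ R := by
  obtain ⟨R, hR⟩ := exists_energy_bound hα hα' Λ M
  refine ⟨R, fun σ hσ u₀ I u h hM => ?_⟩
  simp only [sobolevNorm_eq] at hM ⊢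
  exact hR σ I _ hσ ((h.seqSolution (hα.trans_le hαs)).mono_exp hαs) 0 h.zero_mem (h.initial ▸ hM)

theorem IsMaximalSolution.eq_univ {σ : ℝ} (hα : 1 / 2 < α) (hα' : α ≤ 1) (hαs : α ≤ s)
    {u₀ : L2} {I : Set ℝ} {u : ℝ → L2} (h : IsMaximalSolution σ α s u₀ I u) : I = Set.univ := by
  by_contra hne
  obtain ⟨T, hT⟩ := nonempty_frontier_iff.2 ⟨⟨0, h.isSolution.zero_mem⟩, hne⟩
  obtain ⟨R, hR⟩ := exists_sobolevNorm_le hα hα' hαs |σ| (sobolevNorm α u₀)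
  obtain ⟨J, w, hw, hIJ, hTJ, hwI⟩ := h.isSolution.exists_extension (hα.trans_le hαs) hα hαs
    (hR σ le_rfl u₀ I u h.isSolution le_rfl) hT
  have hTI : T ∈ I := h.maximal J w hw hIJ hwI ▸ hTJ
  exact (h.isSolution.isOpen.frontier_eq ▸ hT).2 hTI

theorem sobolevNorm_nonneg (s : ℝ) (f : L2) : 0 ≤ sobolevNorm s f := by
  rw [sobolevNorm_eq]; exact ENNReal.toReal_nonneg

theorem ContinuousInSobolev.continuousOn_sobolevNorm {I : Set ℝ} {u : ℝ → L2}
    (h : ContinuousInSobolev s I u) : ContinuousOn (fun t => sobolevNorm s (u t)) I := by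
  simp only [sobolevNorm_eq]
  exact (continuousInSobolev_iff.1 h).toReal_wnorm

theorem exists_energy_smoothing_bound (hα : 1 / 2 < α) (hα' : α ≤ 1) (hαs : α ≤ s)
    (hr : r ≤ s + (2 * α - 1)) (Λ M : ℝ) :
    ∃ C : ℝ, 0 < C ∧ ∀ σ : ℝ, |σ| ≤ Λ → ∀ (u₀ : L2) (I : Set ℝ) (u : ℝ → L2),
      IsSolution σ α s u₀ I u → sobolevNorm α u₀ ≤ M → ∀ t ∈ I,
      sobolevNorm r (u t - phasedFlow σ α t u₀) ≤
        C * (sobolevNorm s u₀ + sobolevNorm s (u t) +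
          |∫ τ in (0 : ℝ)..t, sobolevNorm s (u τ)|) := by
  obtain ⟨R, hR⟩ := exists_sobolevNorm_le hα hα' hαs Λ M
  obtain ⟨C, hC, hbound⟩ := exists_smoothing_bound hα hα' hα hαs hr Λ
  refine ⟨C * (1 + R ^ 2 + R ^ 4), by positivity, fun σ hσ u₀ I u h hM t ht => ?_⟩
  have hα_le : ∀ τ ∈ I, sobolevNorm α (u τ) ≤ R := hR σ hσ u₀ I u h hM
  have hpow : ∀ τ ∈ I, ∀ n : ℕ, sobolevNorm α (u τ) ^ n ≤ R ^ n := fun τ hτ n =>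
    pow_le_pow_left₀ (sobolevNorm_nonneg α _) (hα_le τ hτ) n
  have hfactor {x : ℝ} (hx : x ≤ R ^ 2 + R ^ 4) (τ : ℝ) :
      sobolevNorm s (u τ) * x ≤ (1 + R ^ 2 + R ^ 4) * sobolevNorm s (u τ) := by
    rw [mul_comm]
    exact mul_le_mul_of_nonneg_right (by linarith) (sobolevNorm_nonneg s _)
  have hsq : ∀ τ ∈ I, sobolevNorm s (u τ) * sobolevNorm α (u τ) ^ 2 ≤
      (1 + R ^ 2 + R ^ 4) * sobolevNorm s (u τ) := fun τ hτ =>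
    hfactor ((hpow τ hτ 2).trans (le_add_of_nonneg_right (by positivity))) τ
  have hsub := h.ordConnected.uIcc_subset h.zero_mem ht
  have hintegral := abs_integral_le_mul_abs_integral (a := 0) (b := t)
    (C := 1 + R ^ 2 + R ^ 4) (by positivity)
    (fun τ _ => mul_nonneg (sobolevNorm_nonneg s (u τ)) (by positivity))
    (fun τ hτ => hfactor (add_le_add (hpow τ (hsub hτ) 2) (hpow τ (hsub hτ) 4)) τ)
    (h.continuous.continuousOn_sobolevNorm.mono hsub)
  calc sobolevNorm r (u t - phasedFlow σ α t u₀) ≤ _ := hbound σ hσ u₀ I u h t ht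
    _ ≤ C * ((1 + R ^ 2 + R ^ 4) * sobolevNorm s u₀ +
          (1 + R ^ 2 + R ^ 4) * sobolevNorm s (u t) +
          (1 + R ^ 2 + R ^ 4) * |∫ τ in (0 : ℝ)..t, sobolevNorm s (u τ)|) := by
        refine mul_le_mul_of_nonneg_left (add_le_add (add_le_add ?_ (hsq t ht)) hintegral) hC.le
        exact h.initial ▸ hsq 0 h.zero_mem
    _ = _ := by ring

end Energy

end FNLS

end

theorem theorem2_general (α s r : ℝ) (hα : 1 / 2 < α) (hα' : α ≤ 1) (hs : 1 / 2 < s)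
    (hr : r ≤ s + (2 * α - 1)) :
    (∀ (σ : ℝ) (u₀ : FNLS.L2) (I : Set ℝ) (u : ℝ → FNLS.L2), FNLS.IsSolution σ α s u₀ I u →
      FNLS.ContinuousInSobolev r I (fun t => u t - FNLS.phasedFlow σ α t u₀)) ∧
    (∀ q Λ : ℝ, 1 / 2 < q → q ≤ s → ∃ C : ℝ, 0 < C ∧
      ∀ σ : ℝ, |σ| ≤ Λ → ∀ (u₀ : FNLS.L2) (I : Set ℝ) (u : ℝ → FNLS.L2),
        FNLS.IsSolution σ α s u₀ I u → ∀ t ∈ I,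
          FNLS.sobolevNorm r (u t - FNLS.phasedFlow σ α t u₀) ≤
            C * (FNLS.sobolevNorm s u₀ * FNLS.sobolevNorm q u₀ ^ 2 +
              FNLS.sobolevNorm s (u t) * FNLS.sobolevNorm q (u t) ^ 2 +
              |∫ τ in (0 : ℝ)..t, FNLS.sobolevNorm s (u τ) *
                (FNLS.sobolevNorm q (u τ) ^ 2 + FNLS.sobolevNorm q (u τ) ^ 4)|)) ∧
    (α ≤ s →
      (∀ (σ : ℝ) (u₀ : FNLS.L2) (I : Set ℝ) (u : ℝ → FNLS.L2),
        FNLS.IsMaximalSolution σ α s u₀ I u → I = Set.univ) ∧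
      ∀ Λ M : ℝ, ∃ C : ℝ, 0 < C ∧
        ∀ σ : ℝ, |σ| ≤ Λ → ∀ (u₀ : FNLS.L2) (I : Set ℝ) (u : ℝ → FNLS.L2),
          FNLS.IsSolution σ α s u₀ I u → FNLS.sobolevNorm α u₀ ≤ M → ∀ t ∈ I,
            FNLS.sobolevNorm r (u t - FNLS.phasedFlow σ α t u₀) ≤
              C * (FNLS.sobolevNorm s u₀ + FNLS.sobolevNorm s (u t) +
                |∫ τ in (0 : ℝ)..t, FNLS.sobolevNorm s (u τ)|)) :=
  ⟨fun _ _ _ _ h => h.continuousInSobolev_difference hα hα' hs hr,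
    fun _ Λ hq hqs => FNLS.exists_smoothing_bound hα hα' hq hqs hr Λ,
    fun hαs => ⟨fun _ _ _ _ h => h.eq_univ hα hα' hαs,
      fun Λ M => FNLS.exists_energy_smoothing_bound hα hα' hαs hr Λ M⟩⟩

theorem theorem2 (α s a : ℝ) (hα : 1 / 2 < α) (hα' : α ≤ 1) (hs : 1 / 2 < s)
    (ha : a ≤ 2 * α - 1) :
    (∀ σ : ℝ, σ = 1 ∨ σ = -1 → ∀ (u₀ : FNLS.L2) (I : Set ℝ) (u : ℝ → FNLS.L2),
      FNLS.IsMaximalSolution σ α s u₀ I u →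
        FNLS.ContinuousInSobolev (s + a) I (fun t => u t - FNLS.phasedFlow σ α t u₀)) ∧
    (∀ ε : ℝ, 0 < ε → 1 / 2 + ε ≤ s → ∃ C : ℝ, 0 < C ∧
      ∀ σ : ℝ, σ = 1 ∨ σ = -1 → ∀ (u₀ : FNLS.L2) (I : Set ℝ) (u : ℝ → FNLS.L2),
        FNLS.IsMaximalSolution σ α s u₀ I u → ∀ t ∈ I,
          FNLS.sobolevNorm (s + a) (u t - FNLS.phasedFlow σ α t u₀) ≤
            C * (FNLS.sobolevNorm s u₀ * (1 + FNLS.sobolevNorm (1 / 2 + ε) u₀ ^ 2) +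
              FNLS.sobolevNorm s (u t) * FNLS.sobolevNorm (1 / 2 + ε) (u t) ^ 2 +
              |∫ τ in (0 : ℝ)..t, FNLS.sobolevNorm s (u τ) *
                (FNLS.sobolevNorm (1 / 2 + ε) (u τ) ^ 2 +
                  FNLS.sobolevNorm (1 / 2 + ε) (u τ) ^ 4)|)) ∧
    (α ≤ s →
      (∀ σ : ℝ, σ = 1 ∨ σ = -1 → ∀ (u₀ : FNLS.L2) (I : Set ℝ) (u : ℝ → FNLS.L2),
        FNLS.IsMaximalSolution σ α s u₀ I u → I = Set.univ) ∧
      ∀ M : ℝ, ∃ C : ℝ, 0 < C ∧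
        ∀ σ : ℝ, σ = 1 ∨ σ = -1 → ∀ (u₀ : FNLS.L2) (I : Set ℝ) (u : ℝ → FNLS.L2),
          FNLS.IsMaximalSolution σ α s u₀ I u → FNLS.sobolevNorm α u₀ ≤ M → ∀ t : ℝ,
            FNLS.sobolevNorm (s + a) (u t - FNLS.phasedFlow σ α t u₀) ≤
              C * (FNLS.sobolevNorm s u₀ + FNLS.sobolevNorm s (u t) +
                |∫ τ in (0 : ℝ)..t, FNLS.sobolevNorm s (u τ)|)) := by
  obtain ⟨hcont, hsmooth, hglobal⟩ := theorem2_general α s (s + a) hα hα' hs (by linarith)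
  have habs {σ : ℝ} (hσ : σ = 1 ∨ σ = -1) : |σ| ≤ 1 := (abs_eq zero_le_one).2 hσ |>.le
  refine ⟨fun σ _ u₀ I u h => hcont σ u₀ I u h.isSolution, fun ε hε hεs => ?_, fun hαs =>
    ⟨fun σ _ => (hglobal hαs).1 σ, fun M => ?_⟩⟩
  · obtain ⟨C, hC, hbound⟩ := hsmooth (1 / 2 + ε) 1 (by linarith) hεs
    refine ⟨C, hC, fun σ hσ u₀ I u h t ht =>
      (hbound σ (habs hσ) u₀ I u h.isSolution t ht).trans ?_⟩
    gcongr
    · exact FNLS.sobolevNorm_nonneg s u₀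
    · linarith
  · obtain ⟨C, hC, hbound⟩ := (hglobal hαs).2 1 M
    refine ⟨C, hC, fun σ hσ u₀ I u h hM t => hbound σ (habs hσ) u₀ I u h.isSolution hM t ?_⟩
    exact (hglobal hαs).1 σ u₀ I u h ▸ Set.mem_univ t
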